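/- Let $(M,g)$ be a connected complete smooth Riemannian manifold (second countable, without boundary) and let $\varphi:M\to\mathbb R$ be smooth. Let $p>1$, $q>0$ satisfy $\delta:=q(p-1)-1=0$, and let $\Omega\subset M$ be an open, relatively compact set with $\Omega\neq M$. Write $u^q:=|u|^{q-1}u$ and $$\mathcal L_{p,\varphi}v=e^{\varphi}\operatorname{div}\bigl(e^{-\varphi}|\nabla v|^{p-2}\nabla v\bigr),\qquad I_\Omega(t)=\int_\Omega |u(x,t)|^{q+1}e^{-\varphi}\,dV_g .$$ Let $L^r_\varphi(\Omega)$ be the $L^r$ space of the measure $e^{-\varphi}dV_g$ on $\Omega$, and let $W^{1,r}_{0;\varphi}(\Omega)$ be the closure of $C_c^\infty(\Omega)$ in the space $W^{1,r}_\varphi(\Omega)$ of functions in $L^r_\varphi(\Omega)$ with weak gradient in $L^r_\varphi(\Omega)$. Let $u$ be an ancient solution of $$\begin{cases}\partial_t u=\mathcal L_{p,\varphi}u^q & \text{in }\Omega\times(-\infty,0),\\ u=0 & \text{on }\partial\Omega\times(-\infty,0),\end{cases}$$ in the following sense. For every $t<0$: $u(\cdot,t)\in W^{1,q+1}_{0;\varphi}(\Omega)$;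 the curve $s\mapsto u(\cdot,s)$ has at $s=t$ a derivative $u_t(\cdot,t)$ in $L^{q+1}_\varphi(\Omega)$, and $u_t(\cdot,t)\in W^{1,q+1}_{0;\varphi}(\Omega)$; the function $u^q(\cdot,t)$ has a weak gradient on $\Omega$, with $|\nabla u^q(\cdot,t)|\in L^p_\varphi(\Omega)$; for all $\psi\in C_c^\infty(\Omega)$ $$\int_\Omega u_t\,\psi\,e^{-\varphi}dV_g=-\int_\Omega |\nabla u^q|^{p-2}\langle\nabla u^q,\nabla\psi\rangle e^{-\varphi}dV_g ;$$ and $u(y,t)\to 0$ as $y\to x$, $y\in\Omega$, for every $x\in\partial\Omega$. Suppose that there are constants $C,d>0$ with $I_\Omega(t)\le C(1+|t|)^d$ for all $t<0$. Then $u\equiv 0$: for every $t<0$, $u(\cdot,t)=0$ almost everywhere in $\Omega$, and hence everywhere in $\Omega$ if $u(\cdot,t)$ is continuous on $\Omega$. -/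

import Mathlib

open MeasureTheory Filter Topology Manifold Bundle
open scoped ContDiff ENNReal

noncomputable section

/-- The model space `ℝⁿ` with its Euclidean norm. -/
abbrev Model (n : ℕ) : Type := EuclideanSpace ℝ (Fin n)

section Manifold

variable {n : ℕ} {M : Type*} [TopologicalSpace M] [ChartedSpace (Model n) M]
  [RiemannianBundle (fun x : M => TangentSpace 𝓘(ℝ, Model n) x)]

/-- The tangent vector at `e.symm y` with coordinate vector `w` in the chart `e`. -/
def coordVec (e : OpenPartialHomeomorph M (Model n)) (y w : Model n) :
    TangentSpace 𝓘(ℝ, Model n) (e.symm y) :=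
  mfderiv 𝓘(ℝ, Model n) 𝓘(ℝ, Model n) e.symm y w

/-- The Gram matrix `g_{ij}` of the metric in the chart `e`, at the point with coordinates `y`. -/
def metricMatrix (e : OpenPartialHomeomorph M (Model n)) (y : Model n) :
    Matrix (Fin n) (Fin n) ℝ :=
  Matrix.of fun i j =>
    inner ℝ (coordVec e y (EuclideanSpace.single i 1)) (coordVec e y (EuclideanSpace.single j 1))

/-- The measure `√(det g_{ij}) dy` of the domain of the chart `e`, extended by zero to `M`. -/
def chartVolume [MeasurableSpace M] (e : OpenPartialHomeomorph M (Model n)) : Measure M :=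
  (((volume : Measure (Model n)).restrict e.target).withDensity
    fun y => ENNReal.ofReal (Real.sqrt (metricMatrix e y).det)).map e.symm

variable (n M) in
/-- The Riemannian volume measure `dV_g`. The chart measures agree on overlaps of charts, so that
their supremum is the measure which restricts to `√(det g_{ij}) dy` on every chart domain. -/
def riemannianVolume [MeasurableSpace M] : Measure M :=
  ⨆ e ∈ atlas (Model n) M, chartVolume e

variable (n) in
/-- The weighted measure `e^{-φ} dV_g`. -/
def weightedVolume [MeasurableSpace M] (φ : M → ℝ) : Measure M :=
  (riemannianVolume n M).withDensity fun x => ENNReal.ofReal (Real.exp (-φ x))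

/-- The Riemannian gradient of a differentiable function: the vector representing `df`. -/
def riemannianGradient (f : M → ℝ) (x : M) : TangentSpace 𝓘(ℝ, Model n) x :=
  haveI : FiniteDimensional ℝ (TangentSpace 𝓘(ℝ, Model n) x) :=
    inferInstanceAs (FiniteDimensional ℝ (Model n))
  haveI : CompleteSpace (TangentSpace 𝓘(ℝ, Model n) x) := FiniteDimensional.complete ℝ _
  (InnerProductSpace.toDual ℝ (TangentSpace 𝓘(ℝ, Model n) x)).symm
    (mfderiv 𝓘(ℝ, Model n) 𝓘(ℝ, ℝ) f x : TangentSpace 𝓘(ℝ, Model n) x →L[ℝ] ℝ)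

theorem inner_riemannianGradient (f : M → ℝ) (x : M) (w : TangentSpace 𝓘(ℝ, Model n) x) :
    inner ℝ (riemannianGradient f x) w = mfderiv 𝓘(ℝ, Model n) 𝓘(ℝ, ℝ) f x w := by
  have : FiniteDimensional ℝ (TangentSpace 𝓘(ℝ, Model n) x) :=
    inferInstanceAs (FiniteDimensional ℝ (Model n))
  have : CompleteSpace (TangentSpace 𝓘(ℝ, Model n) x) := FiniteDimensional.complete ℝ _
  exact InnerProductSpace.toDual_symm_apply

variable (n) in
/-- The test functions `C_c^∞(Ω)`, as functions on `M`. -/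
def IsTestFunction (Ω : Set M) (ψ : M → ℝ) : Prop :=
  ContMDiff 𝓘(ℝ, Model n) 𝓘(ℝ, ℝ) ∞ ψ ∧ HasCompactSupport ψ ∧ tsupport ψ ⊆ Ω

/-- `X` is the weak gradient of `f` on the open set `Ω`: in every chart `f` and `X` are locally
integrable, and the components `⟨X, ∂_w⟩` are the weak partial derivatives of `f`. -/
structure IsWeakGradient (Ω : Set M) (f : M → ℝ)
    (X : (x : M) → TangentSpace 𝓘(ℝ, Model n) x) : Prop where
  locallyIntegrable : ∀ e ∈ atlas (Model n) M,
    LocallyIntegrableOn (fun y => f (e.symm y)) (e.target ∩ e.symm ⁻¹' Ω) volume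
  locallyIntegrable_grad : ∀ e ∈ atlas (Model n) M, ∀ w : Model n,
    LocallyIntegrableOn (fun y => inner ℝ (X (e.symm y)) (coordVec e y w))
      (e.target ∩ e.symm ⁻¹' Ω) volume
  integral_by_parts : ∀ e ∈ atlas (Model n) M, ∀ w : Model n, ∀ η : Model n → ℝ,
    ContDiff ℝ ∞ η → HasCompactSupport η → tsupport η ⊆ e.target ∩ e.symm ⁻¹' Ω →
      ∫ y, f (e.symm y) * fderiv ℝ η y w =
        -∫ y, inner ℝ (X (e.symm y)) (coordVec e y w) * η y

section Sobolev

variable [MeasurableSpace M]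

variable (n) in
/-- The weighted Sobolev space `W^{1,r}_{0;φ}(Ω)`: the functions in `L^r_φ(Ω)` with weak gradient
in `L^r_φ(Ω)` which are limits in the `W^{1,r}_φ(Ω)` norm of test functions in `C_c^∞(Ω)`. -/
def MemSobolevZero (φ : M → ℝ) (Ω : Set M) (r : ℝ) (f : M → ℝ) : Prop :=
  MemLp f (ENNReal.ofReal r) ((weightedVolume n φ).restrict Ω) ∧
  ∃ X : (x : M) → TangentSpace 𝓘(ℝ, Model n) x,
    IsWeakGradient Ω f X ∧
    MemLp (fun x => ‖X x‖) (ENNReal.ofReal r) ((weightedVolume n φ).restrict Ω) ∧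
    ∀ ε : ℝ≥0∞, 0 < ε → ∃ ψ : M → ℝ, IsTestFunction n Ω ψ ∧
      eLpNorm (fun x => f x - ψ x) (ENNReal.ofReal r) ((weightedVolume n φ).restrict Ω) < ε ∧
      eLpNorm (fun x => ‖X x - riemannianGradient ψ x‖) (ENNReal.ofReal r)
        ((weightedVolume n φ).restrict Ω) < ε

variable (n) in
/-- `w` is the time derivative `u_t(·, t)` of the curve `s ↦ u(·, s)` in `L^r_φ(Ω)`. -/
def HasTimeDerivAt (φ : M → ℝ) (Ω : Set M) (r : ℝ) (u : ℝ → M → ℝ) (w : M → ℝ) (t : ℝ) : Prop :=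
  Tendsto (fun h : ℝ => eLpNorm (fun x => (u (t + h) x - u t x) / h - w x) (ENNReal.ofReal r)
    ((weightedVolume n φ).restrict Ω)) (𝓝[≠] 0) (𝓝 0)

/-- The signed power `u^q = |u|^{q-1} u`. -/
def signedPow (q s : ℝ) : ℝ := |s| ^ (q - 1) * s

/-- The equation `w = 𝓛_{p,φ} v` in the weak sense on `Ω`, where `X = ∇v` and
`𝓛_{p,φ} v = e^φ div (e^{-φ} |∇v|^{p-2} ∇v)`. -/
def IsWeakPLaplacian (φ : M → ℝ) (Ω : Set M) (p : ℝ)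
    (X : (x : M) → TangentSpace 𝓘(ℝ, Model n) x) (w : M → ℝ) : Prop :=
  ∀ ψ : M → ℝ, IsTestFunction n Ω ψ →
    ∫ x in Ω, w x * ψ x ∂(weightedVolume n φ) =
      -∫ x in Ω, ‖X x‖ ^ (p - 2) * inner ℝ (X x) (riemannianGradient ψ x) ∂(weightedVolume n φ)

variable (n) in
/-- `u` is an ancient solution on `Ω × (-∞, 0)` of the doubly nonlinear equation
`∂_t u = 𝓛_{p,φ} u^q` with `u = 0` on `∂Ω × (-∞, 0)`, such that
`u, u_t ∈ W^{1,q+1}_{0;φ}(Ω)` and `∇u^q ∈ L^p_φ(Ω)` for every time `t < 0`. -/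
structure IsAncientDirichletSolution (φ : M → ℝ) (Ω : Set M) (p q : ℝ) (u : ℝ → M → ℝ) :
    Prop where
  mem_sobolev : ∀ t < 0, MemSobolevZero n φ Ω (q + 1) (u t)
  equation : ∀ t < 0, ∃ (w : M → ℝ) (X : (x : M) → TangentSpace 𝓘(ℝ, Model n) x),
    HasTimeDerivAt n φ Ω (q + 1) u w t ∧
    MemSobolevZero n φ Ω (q + 1) w ∧
    IsWeakGradient Ω (fun x => signedPow q (u t x)) X ∧
    MemLp (fun x => ‖X x‖) (ENNReal.ofReal p) ((weightedVolume n φ).restrict Ω) ∧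
    IsWeakPLaplacian φ Ω p X w
  boundary : ∀ t < 0, ∀ x ∈ frontier Ω, Tendsto (u t) (𝓝[Ω] x) (𝓝 0)

variable (n) in
/-- The weighted energy `I_Ω = ∫_Ω |u|^{q+1} e^{-φ} dV_g` of a function on `Ω`. -/
def weightedEnergy (φ : M → ℝ) (Ω : Set M) (q : ℝ) (f : M → ℝ) : ℝ :=
  ∫ x in Ω, |f x| ^ (q + 1) ∂(weightedVolume n φ)

end Sobolev

end Manifold

end

/-! The condition δ = 0 reads q p = q + 1, so q + 1 and p are conjugate exponents and u^q lies in
L^p when u lies in L^{q+1}. With weighted integrals over Ω, put I(t) = ∫ |u|^{q+1} and E(t) = ∫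
|∇u^q|^p, and for two times P(s,t) = ∫ u(t) u^q(s) and D(s,t) = ∂_t P(s,t) = -∫ |∇u^q(t)|^{p-2}
⟨∇u^q(t), ∇u^q(s)⟩. On the diagonal P = I and D = -E. Young's inequality bounds μ P(s,t) and -μ
D(s,t) from above by the energies and dissipations at s and t. I is never differentiated: Young with
μ = 1 is the tangent inequality for the convex function |·|^{q+1}, which supports I from below at t
by a function with slope -(q+1) E(t).

The core is `dissipation_eq_zero_of_polynomial_growth`. If E(b) > 0, then I is larger at some
earlier time a. For small κ > 0 the function g(t) = e^{(q+1)κt} I(t) still satisfies g(b) < g(a),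
while polynomial growth makes g tend to 0 at -∞. So g has a maximum at a point x strictly between
some s < a and b, and there E(x) ≤ κ I(x). Now `energy_comparison` compares u after time x with the
separable profile e^{-κ(t-x)} u(x) and gives g(b) ≥ g(x), a contradiction. Hence ∇u^q = 0 almost
everywhere at every time.

It follows that u^q is locally constant in Ω; it vanishes at ∂Ω, M is connected and Ω ≠ M, so u^q =
0 (`IsWeakGradient.ae_eq_zero`).

The analytic work is the formula for D: the equation is given for test functions in C_c^∞(Ω) but
must be tested with u^q(s). Since u^q(s) tends to 0 at the boundary, its truncations near 0 have
compact support in Ω. A partition of unity and mollification in charts approximate these by test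
functions in W^{1,p} (`IsWeakGradient.exists_testFunction_near`, used in
`IsWeakPLaplacian.integral_mul_eq`). Convergence of the gradients of the truncations needs that a
weak gradient vanishes almost everywhere on the zero set of its function. -/

set_option linter.unusedSectionVars false

/-! ### The one-variable argument on energy and dissipation. -/

noncomputable section

/-- If `P` has derivative `-E` at `t` and `I` lies above `I t + r (P - I t)`, then `I` grows at least
at the rate `r E` to the left of `t`. -/
theorem eventually_left_gt_of_support {I P : ℝ → ℝ} {t r c e : ℝ} (hr : 0 < r)
    (hPt : P t = I t) (hP : HasDerivAt P (-e) t)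
    (hI : ∀ᶠ t' in 𝓝[<] t, I t + r * (P t' - I t) ≤ I t') (hc : c < r * e) :
    ∀ᶠ t' in 𝓝[<] t, I t + c * (t - t') < I t' := by
  have h1 := (hasDerivWithinAt_iff_tendsto_slope' (s := Set.Iio t) (by simp)).1
    hP.hasDerivWithinAt
  have h2 : -e < -(c / r) := by
    rw [neg_lt_neg_iff, div_lt_iff₀ hr]; linarith
  filter_upwards [h1.eventually (gt_mem_nhds h2), hI, self_mem_nhdsWithin] with t' h3 h4 h5
  have h6 : t' - t < 0 := sub_neg.2 h5
  rw [slope_def_field, div_lt_iff_of_neg h6, hPt] at h3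
  have h7 : r * (-(c / r) * (t' - t)) = c * (t - t') := by field_simp; ring
  nlinarith

/-- The strict inequality holds at κ = 0 and persists by continuity. It keeps a drop of the energy
between two times visible under a slow exponential weight. -/
theorem exists_exp_mul_lt {a b I₀ I₁ r : ℝ} (h : I₁ < I₀) :
    ∃ κ > 0, Real.exp (r * κ * b) * I₁ < Real.exp (r * κ * a) * I₀ := by
  have h1 : ContinuousAt (fun κ : ℝ =>
      Real.exp (r * κ * a) * I₀ - Real.exp (r * κ * b) * I₁) 0 := by fun_prop
  have h2 : ∀ᶠ κ in 𝓝[>] (0 : ℝ),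
      0 < Real.exp (r * κ * a) * I₀ - Real.exp (r * κ * b) * I₁ := by
    apply (h1.tendsto.mono_left nhdsWithin_le_nhds).eventually (lt_mem_nhds _)
    simpa using h
  obtain ⟨κ, h3, h4⟩ := (h2.and self_mem_nhdsWithin).exists
  exact ⟨κ, h4, by linarith⟩

/-- This is how polynomial growth is used: an exponential weight of any positive rate beats it in
the far past. -/
theorem tendsto_exp_mul_polynomial_atBot {k C d : ℝ} (hk : 0 < k) :
    Tendsto (fun t : ℝ => Real.exp (k * t) * (C * (1 + |t|) ^ d)) atBot (𝓝 0) := by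
  have h := tendsto_rpow_mul_exp_neg_mul_atTop_nhds_zero d k hk
  have h1 : Tendsto (fun t : ℝ => 1 + -t) atBot atTop :=
    tendsto_atTop_add_const_left _ _ tendsto_neg_atBot_atTop
  have h2 := (h.comp h1).const_mul (C * Real.exp k)
  rw [mul_zero] at h2
  refine h2.congr' ?_
  filter_upwards [eventually_lt_atBot 0] with t ht
  simp only [Function.comp_apply]
  rw [abs_of_neg ht, show k * t = k + -k * (1 + -t) by ring, Real.exp_add]
  ring

/-- The comparison argument behind the logarithmic convexity of the energy. -/
theorem energy_comparison {p q κ x b : ℝ} (hq : 0 < q)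
    (hpq : q * p = q + 1) (hκ : 0 < κ) (I E : ℝ → ℝ) (P D : ℝ → ℝ → ℝ)
    (hIc : ContinuousOn I (Set.Iio 0)) (hPI : ∀ t < 0, P t t = I t)
    (hDE : ∀ t < 0, D t t = -E t)
    (hP : ∀ s < 0, ∀ t < 0, HasDerivAt (P s) (D s t) t)
    (hYP : ∀ s < 0, ∀ t < 0, ∀ μ > 0, μ * P s t ≤ I t / (q + 1) + μ ^ p * I s / p)
    (hYD : ∀ s < 0, ∀ t < 0, ∀ μ > 0, -μ * D s t ≤ E t / (q + 1) + μ ^ p * E s / p)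
    (hsup : ∀ t < 0, ∀ t' < 0, I t + (q + 1) * (P t t' - I t) ≤ I t')
    (hxb : x < b) (hb : b < 0)
    (hEx : E x ≤ κ * I x)
    (hmax : ∀ t ∈ Set.Icc x b, I t ≤ I x * Real.exp (-((q + 1) * κ * (t - x)))) :
    I x * Real.exp (-((q + 1) * κ * (b - x))) ≤ I b := by
  have hx : x < 0 := hxb.trans hb
  have hp : p = (q + 1) / q := by field_simp; linarith
  -- The weights are fitted to the separable profile I t = e^{-(q+1)κ(t-x)} I x, P x t = e^{-κ(t-x)}
  -- I x, for which the function F below is identically 0. The factor 1/(q+1)² in A makes the terms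
  -- in E t cancel against Young's inequality for D, and μ is chosen so that μ^p = μ ε, the decay
  -- rate of the profile.
  set A : ℝ → ℝ := fun t => Real.exp (q * κ * (t - x)) / (q + 1) ^ 2 with hA
  set ε : ℝ → ℝ := fun t => Real.exp (-(κ * (t - x))) with hε
  set μ : ℝ → ℝ := fun t => Real.exp (-(q * κ * (t - x))) with hμ
  set B : ℝ := I x * (q / (q + 1) ^ 2 + 1 / p) with hB
  have hμ0 : ∀ t, 0 < μ t := fun t => Real.exp_pos _
  have hAμ : ∀ t, A t * μ t = 1 / (q + 1) ^ 2 := fun t => by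
    simp only [hA, hμ, div_mul_eq_mul_div, ← Real.exp_add]; simp
  have hμp : ∀ t, μ t ^ p = μ t * ε t := fun t => by
    simp only [hμ, hε, ← Real.exp_add, ← Real.exp_mul]
    congr 1
    linear_combination (-κ * (t - x)) * hpq
  have hμε : ∀ t, Real.exp (-((q + 1) * κ * (t - x))) = μ t * ε t := fun t => by
    simp only [hμ, hε, ← Real.exp_add]; congr 1; ring
  have hAd : ∀ t, HasDerivAt A (q * κ * A t) t := fun t => by
    have : HasDerivAt (fun t => q * κ * (t - x)) (q * κ * 1) t :=
      ((hasDerivAt_id t).sub_const x).const_mul _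
    exact (this.exp.div_const ((q + 1) ^ 2)).congr_deriv (by simp only [hA]; ring)
  have hεd : ∀ t, HasDerivAt ε (-κ * ε t) t := fun t => by
    have : HasDerivAt (fun t => -(κ * (t - x))) (-(κ * 1)) t :=
      (((hasDerivAt_id t).sub_const x).const_mul _).neg
    exact this.exp.congr_deriv (by simp only [hε]; ring)
  set F : ℝ → ℝ := fun t => A t * I t + B * ε t - P x t with hF
  have hFx : F x = 0 := by
    simp only [hF, hA, hε, hB, hPI x hx, hp]; simp; field_simp; ring
  have hFc : ContinuousOn F (Set.Iio 0) := by
    refine ((ContinuousOn.mul (fun t _ => (hAd t).continuousAt.continuousWithinAt) hIc).add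
      (continuousOn_const.mul fun t _ => (hεd t).continuousAt.continuousWithinAt)).sub ?_
    exact fun t ht => (hP x hx t ht).continuousAt.continuousWithinAt
  -- F is shown to be nonincreasing through its left slopes only, since I need not be
  -- differentiable.
  have hcmp : ∀ t, x < t → t ≤ b → ∀ ρ > 0, ∀ᶠ t' in 𝓝[<] t, F t - F t' < ρ * (t - t') := by
    intro t hxt htb ρ hρ
    have ht : t < 0 := htb.trans_lt hb
    -- H is F with I replaced by its lower support at t. It touches F at t, lies below F to the
    -- left, and is differentiable, so a nonpositive derivative of H at t controls the left slopes
    -- of F.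
    set H : ℝ → ℝ := fun t' => A t' * (I t + (q + 1) * (P t t' - I t)) + B * ε t' - P x t'
    have hHt : H t = F t := by simp only [H, hF, hPI t ht]; ring
    have hHd : HasDerivAt H (q * κ * A t * (I t + (q + 1) * (P t t - I t))
        + A t * ((q + 1) * (D t t)) + B * (-κ * ε t) - D x t) t := by
      refine (((hAd t).mul ?_).add ((hεd t).const_mul B)).sub (hP x hx t ht)
      exact (((hP t ht t ht).sub_const _).const_mul (q + 1)).const_add (I t)
    have hle : q * κ * A t * (I t + (q + 1) * (P t t - I t))
        + A t * ((q + 1) * (D t t)) + B * (-κ * ε t) - D x t ≤ 0 := by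
      have h1 := hYD x hx t ht (μ t) (hμ0 t)
      have h2 := hmax t ⟨hxt.le, htb⟩
      rw [hμε] at h2
      rw [hμp] at h1
      have hε0 : 0 < ε t := Real.exp_pos _
      have hp0 : 0 < p := by rw [hp]; positivity
      have h3 : μ t * ε t * E x / p ≤ μ t * ε t * (κ * I x) / p := by
        gcongr
      rw [hPI t ht, hDE t ht]
      -- After multiplication by μ the term -μ D x t can be bounded by Young. The terms in E t
      -- cancel, `hEx` bounds E x, and `hmax` bounds I t; what remains sums to exactly 0 by the
      -- choice of B.
      refine nonpos_of_mul_nonpos_right (a := μ t) ?_ (hμ0 t)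
      have e1 : μ t * (q * κ * A t * (I t + (q + 1) * (I t - I t))
        + A t * ((q + 1) * (-E t)) + B * (-κ * ε t) - D x t) =
        q * κ * (A t * μ t) * I t - (q + 1) * (A t * μ t) * E t - κ * B * (μ t * ε t)
          + -μ t * D x t := by ring
      rw [e1, hAμ]
      have h4 : q * κ * (1 / (q + 1) ^ 2) * I t ≤
          q * κ * (1 / (q + 1) ^ 2) * (I x * (μ t * ε t)) := by gcongr
      have h5 : (q + 1) * (1 / (q + 1) ^ 2) * E t = E t / (q + 1) := by field_simp
      have h6 : κ * B * (μ t * ε t) = q * κ * (1 / (q + 1) ^ 2) * (I x * (μ t * ε t))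
        + μ t * ε t * (κ * I x) / p := by simp only [hB]; ring
      rw [h5, h6]
      linarith
    have h1 := (hasDerivWithinAt_iff_tendsto_slope' (s := Set.Iio t) (by simp)).1
      hHd.hasDerivWithinAt
    filter_upwards [h1.eventually (gt_mem_nhds (hle.trans_lt hρ)), self_mem_nhdsWithin]
      with t' h3 h5
    have h6 : t' - t < 0 := sub_neg.2 h5
    rw [slope_def_field, div_lt_iff_of_neg h6, hHt] at h3
    have h7 : H t' ≤ F t' := by
      have : A t' * (I t + (q + 1) * (P t t' - I t)) ≤ A t' * I t' :=
        mul_le_mul_of_nonneg_left (hsup t ht t' (lt_trans h5 ht)) (by positivity)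
      simp only [H, hF]; linarith
    linarith
  -- The mean value inequality is stated for right slopes on an interval, so time is reversed: τ =
  -- -t.
  have hmono : -F (- -x) ≤ -F b := by
    refine image_le_of_liminf_slope_right_le_deriv_boundary (f := fun τ => -F (-τ)) (a := -b)
      (b := -x) (B := fun _ => -F b) (B' := fun _ => 0) ?_ (by simp) continuousOn_const
      (fun _ _ => hasDerivWithinAt_const _ _ _) ?_ (Set.right_mem_Icc.2 (by linarith))
    · refine (hFc.comp continuousOn_neg ?_).neg
      intro τ hτ
      have := hτ.1
      simp only [Set.mem_Iio]; linarith
    · intro τ hτ ρ hρ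
      apply Eventually.frequently
      have h1 := hcmp (-τ) (by linarith [hτ.2]) (by linarith [hτ.1]) ρ hρ
      have h2 : Tendsto (fun z : ℝ => -z) (𝓝[>] τ) (𝓝[<] (-τ)) := tendsto_neg_nhdsGT
      filter_upwards [h2.eventually h1, self_mem_nhdsWithin] with z h3 h4
      have h5 : 0 < z - τ := sub_pos.2 h4
      rw [slope_def_field, div_lt_iff₀ h5]
      linarith
  rw [neg_neg, hFx] at hmono
  -- Monotonicity of F bounds P x b from below, Young bounds it from above. The difference of the
  -- two bounds is a positive multiple of I x · μ b · ε b - I b.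
  have h1 := hYP x hx b hb (μ b) (hμ0 b)
  rw [hμp] at h1
  have h2 : A b * I b + B * ε b ≤ P x b := by simp only [hF] at hmono; linarith
  have h3 := mul_le_mul_of_nonneg_left h2 (hμ0 b).le
  have e1 : μ b * (A b * I b + B * ε b) = (A b * μ b) * I b + B * (μ b * ε b) := by ring
  rw [e1, hAμ] at h3
  have h4 := h3.trans h1
  rw [hμε]
  have h5 : (1 / (q + 1) ^ 2) * I b + B * (μ b * ε b) - (I b / (q + 1) + μ b * ε b * I x / p)
    = q / (q + 1) ^ 2 * (I x * (μ b * ε b) - I b) := by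
    simp only [hB, hp]; field_simp; ring
  have h6 : q / (q + 1) ^ 2 * (I x * (μ b * ε b) - I b) ≤ 0 := by linarith
  have h7 : 0 < q / (q + 1) ^ 2 := by positivity
  have := nonpos_of_mul_nonpos_right h6 h7
  linarith

/-- An ancient energy of polynomial growth has vanishing dissipation. -/
theorem dissipation_eq_zero_of_polynomial_growth {p q C d : ℝ} (hq : 0 < q)
    (hpq : q * p = q + 1) (I E : ℝ → ℝ) (P D : ℝ → ℝ → ℝ)
    (hIc : ContinuousOn I (Set.Iio 0)) (hI0 : ∀ t < 0, 0 ≤ I t) (hE0 : ∀ t < 0, 0 ≤ E t)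
    (hPI : ∀ t < 0, P t t = I t)
    (hDE : ∀ t < 0, D t t = -E t)
    (hP : ∀ s < 0, ∀ t < 0, HasDerivAt (P s) (D s t) t)
    (hYP : ∀ s < 0, ∀ t < 0, ∀ μ > 0, μ * P s t ≤ I t / (q + 1) + μ ^ p * I s / p)
    (hYD : ∀ s < 0, ∀ t < 0, ∀ μ > 0, -μ * D s t ≤ E t / (q + 1) + μ ^ p * E s / p)
    (hgrow : ∀ t < 0, I t ≤ C * (1 + |t|) ^ d) : ∀ t < 0, E t = 0 := by
  have hp : p = (q + 1) / q := by field_simp; linarith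
  -- Young with μ = 1 is the tangent inequality of the convex function |·|^{q+1}, whose derivative
  -- is (q+1) times the signed power.
  have hsup : ∀ t < 0, ∀ t' < 0, I t + (q + 1) * (P t t' - I t) ≤ I t' := by
    intro t ht t' ht'
    have h := hYP t ht t' ht' 1 one_pos
    rw [Real.one_rpow, one_mul, one_mul, hp] at h
    have h2 : I t / ((q + 1) / q) = q * I t / (q + 1) := by field_simp
    rw [h2, ← add_div, le_div_iff₀ (by positivity)] at h
    linarith
  have hleft : ∀ t < 0, ∀ c < (q + 1) * E t, ∀ᶠ t' in 𝓝[<] t, I t + c * (t - t') < I t' := by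
    intro t ht c hc
    refine eventually_left_gt_of_support (P := P t) (by positivity) (hPI t ht)
      (hDE t ht ▸ hP t ht t ht) ?_ hc
    filter_upwards [self_mem_nhdsWithin] with t' h
    exact hsup t ht t' (lt_trans h ht)
  intro b hb
  by_contra hEb
  have hEb : 0 < E b := lt_of_le_of_ne (hE0 b hb) (Ne.symm hEb)
  -- Positive dissipation at b forces a strictly larger energy just before b; rate c = 0 suffices.
  obtain ⟨a, ha1, hab⟩ : ∃ a, I b < I a ∧ a < b := by
    obtain ⟨a, h1, h2⟩ := ((hleft b hb 0 (by positivity)).and self_mem_nhdsWithin).exists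
    exact ⟨a, by simpa using h1, h2⟩
  obtain ⟨κ, hκ, hκab⟩ := exists_exp_mul_lt (a := a) (b := b) (r := q + 1) ha1
  -- The weighted energy is larger at a than at either end of [s, b], so its maximum x is interior.
  -- Interior on the left gives room for `hEx`, interior on the right gives an interval for the
  -- comparison.
  set g : ℝ → ℝ := fun t => Real.exp ((q + 1) * κ * t) * I t with hg
  have hga : 0 < g a := lt_of_le_of_lt (mul_nonneg (Real.exp_pos _).le (hI0 b hb)) hκab
  obtain ⟨s, hs1, hsa⟩ : ∃ s, g s < g a ∧ s < a := by
    have h1 := tendsto_exp_mul_polynomial_atBot (C := C) (d := d)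
      (show 0 < (q + 1) * κ by positivity)
    obtain ⟨s, h2, h3⟩ := ((h1.eventually (gt_mem_nhds hga)).and (eventually_lt_atBot a)).exists
    exact ⟨s, lt_of_le_of_lt (mul_le_mul_of_nonneg_left
      (hgrow s (h3.trans (hab.trans hb))) (Real.exp_pos _).le) h2, h3⟩
  have hgc : ContinuousOn g (Set.Icc s b) := by
    refine ContinuousOn.mul (by fun_prop) (hIc.mono fun t ht => lt_of_le_of_lt ht.2 hb)
  obtain ⟨x, hxm, hxmax⟩ := isCompact_Icc.exists_isMaxOn ⟨a, hsa.le, hab.le⟩ hgc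
  have hgax : g a ≤ g x := hxmax ⟨hsa.le, hab.le⟩
  have hxb : x < b := lt_of_le_of_ne hxm.2 (by
    rintro rfl; exact absurd hgax (not_le.2 hκab))
  have hsx : s < x := lt_of_le_of_ne hxm.1 (by
    rintro rfl; exact absurd hgax (not_le.2 hs1))
  have hx : x < 0 := hxb.trans hb
  have hmax : ∀ t ∈ Set.Icc s b, I t ≤ I x * Real.exp (-((q + 1) * κ * (t - x))) := by
    intro t ht
    have h1 : g t ≤ g x := hxmax ht
    have h2 : I t = Real.exp (-((q + 1) * κ * t)) * g t := by
      simp only [hg, ← mul_assoc, ← Real.exp_add]; simp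
    have h3 : I x * Real.exp (-((q + 1) * κ * (t - x))) = Real.exp (-((q + 1) * κ * t)) * g x := by
      simp only [hg, ← mul_assoc, ← Real.exp_add]
      rw [mul_comm]; congr 2; ring
    rw [h2, h3]
    exact mul_le_mul_of_nonneg_left h1 (Real.exp_pos _).le
  -- Maximality bounds I to the left of x by an exponential of slope -(q+1) κ I x at x, while I
  -- grows to the left at every rate below (q+1) E x. A rate c strictly between the two would
  -- contradict this.
  have hEx : E x ≤ κ * I x := by
    by_contra hlt
    rw [not_le] at hlt
    obtain ⟨c, hc1, hc2⟩ := exists_between (mul_lt_mul_of_pos_left hlt (show 0 < q + 1 by positivity))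
    have hd : HasDerivAt (fun t => I x * Real.exp (-((q + 1) * κ * (t - x))))
        (-((q + 1) * (κ * I x))) x := by
      have : HasDerivAt (fun t => -((q + 1) * κ * (t - x))) (-((q + 1) * κ * 1)) x :=
        (((hasDerivAt_id x).sub_const x).const_mul _).neg
      exact (this.exp.const_mul (I x)).congr_deriv (by simp; ring)
    have h1 := (hasDerivWithinAt_iff_tendsto_slope' (s := Set.Iio x) (by simp)).1
      hd.hasDerivWithinAt
    have h2 : ∀ᶠ t in 𝓝[<] x, s < t := nhdsWithin_le_nhds (lt_mem_nhds hsx)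
    obtain ⟨t, h3, h4, h5, h6⟩ := ((hleft x hx c hc2).and ((h1.eventually
      (lt_mem_nhds (neg_lt_neg hc1))).and (h2.and self_mem_nhdsWithin))).exists
    have h7 : t - x < 0 := sub_neg.2 h6
    have h8 := hmax t ⟨h5.le, (lt_trans h6 hxb).le⟩
    rw [slope_def_field, lt_div_iff_of_neg h7] at h4
    simp only [sub_self, mul_zero, neg_zero, Real.exp_zero, mul_one] at h4
    linarith
  have h1 := energy_comparison hq hpq hκ I E P D hIc hPI hDE hP hYP hYD hsup hxb hb hEx
    (fun t ht => hmax t ⟨hsx.le.trans ht.1, ht.2⟩)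
  have h2 : g x ≤ g b := by
    have h3 : Real.exp ((q + 1) * κ * b) * (I x * Real.exp (-((q + 1) * κ * (b - x)))) = g x := by
      rw [mul_left_comm, ← Real.exp_add, mul_comm]
      simp only [hg]; congr 2; ring
    rw [← h3]
    exact mul_le_mul_of_nonneg_left h1 (Real.exp_pos _).le
  exact absurd (hgax.trans h2) (not_le.2 hκab)

end

/-! ### Mollification in the model space. -/

noncomputable section

open scoped Convolution in
/-- The standard family of mollifications `ρ_k * f`, where `ρ_k` is supported in the ball of
radius `1 / (k + 1)`. -/
def stdBump (n k : ℕ) : ContDiffBump (0 : Model n) where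
  rIn := 1 / (2 * ((k : ℝ) + 1))
  rOut := 1 / ((k : ℝ) + 1)
  rIn_pos := by positivity
  rIn_lt_rOut := by
    apply one_div_lt_one_div_of_lt <;> [positivity; (have : (0 : ℝ) ≤ k := k.cast_nonneg; linarith)]

/-- The standard mollifier. -/
def stdMollifier (n k : ℕ) : Model n → ℝ := (stdBump n k).normed volume

open scoped Convolution in
/-- Mollification. -/
def mollify {n : ℕ} (k : ℕ) (f : Model n → ℝ) : Model n → ℝ :=
  stdMollifier n k ⋆[ContinuousLinearMap.lsmul ℝ ℝ, volume] f

section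

variable {n : ℕ}

theorem stdMollifier_nonneg (k : ℕ) (y : Model n) : 0 ≤ stdMollifier n k y :=
  (stdBump n k).nonneg_normed y

theorem contDiff_stdMollifier (k : ℕ) : ContDiff ℝ ∞ (stdMollifier n k) :=
  (stdBump n k).contDiff_normed

theorem hasCompactSupport_stdMollifier (k : ℕ) : HasCompactSupport (stdMollifier n k) :=
  (stdBump n k).hasCompactSupport_normed

theorem tsupport_stdMollifier (k : ℕ) :
    tsupport (stdMollifier n k) = Metric.closedBall 0 (1 / ((k : ℝ) + 1)) :=
  (stdBump n k).tsupport_normed_eq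

theorem integral_stdMollifier (k : ℕ) : ∫ y, stdMollifier n k y = 1 :=
  (stdBump n k).integral_normed

theorem integrable_stdMollifier (k : ℕ) : Integrable (stdMollifier n k) :=
  (stdBump n k).integrable_normed

theorem mollify_apply (k : ℕ) (f : Model n → ℝ) (x : Model n) :
    mollify k f x = ∫ y, stdMollifier n k y * f (x - y) := rfl

theorem mollify_apply_swap (k : ℕ) (f : Model n → ℝ) (x : Model n) :
    mollify k f x = ∫ y, stdMollifier n k (x - y) * f y := by
  rw [mollify, convolution_lsmul_swap]; rfl

theorem contDiff_mollify (k : ℕ) {f : Model n → ℝ} (hf : LocallyIntegrable f) :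
    ContDiff ℝ ∞ (mollify k f) :=
  (hasCompactSupport_stdMollifier k).contDiff_convolution_left _ (contDiff_stdMollifier k) hf

theorem ae_tendsto_mollify {f : Model n → ℝ} (hf : LocallyIntegrable f) :
    ∀ᵐ x, Tendsto (fun k => mollify k f x) atTop (𝓝 (f x)) := by
  -- K = 2 is the fixed ratio of outer to inner radius of the bumps, which lets Lebesgue
  -- differentiation apply.
  refine ContDiffBump.ae_convolution_tendsto_right_of_locallyIntegrable (K := 2)
    (φ := fun k => stdBump n k) ?_ (Eventually.of_forall fun k => ?_) hf
  · exact tendsto_one_div_add_atTop_nhds_zero_nat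
  · simp only [stdBump]
    apply le_of_eq; field_simp

theorem mollify_eq_zero {k : ℕ} {f : Model n → ℝ} {S : Set (Model n)} (hf : ∀ x ∉ S, f x = 0)
    {x : Model n} (hx : ∀ y ∈ S, 1 / ((k : ℝ) + 1) < dist x y) : mollify k f x = 0 := by
  rw [mollify_apply_swap]
  refine integral_eq_zero_of_ae (Eventually.of_forall fun y => ?_)
  by_cases hy : y ∈ S
  · have h1 : x - y ∉ tsupport (stdMollifier n k) := by
      rw [tsupport_stdMollifier, mem_closedBall_zero_iff, not_le, ← dist_eq_norm]
      exact hx y hy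
    simp [image_eq_zero_of_notMem_tsupport h1]
  · simp [hf y hy]

/-- Translations are continuous in `L^p`. -/
theorem tendsto_eLpNorm_translate {f : Model n → ℝ} {p : ℝ≥0∞} (hp1 : 1 ≤ p) (hp : p ≠ ⊤)
    (hf : MemLp f p) :
    Tendsto (fun y : Model n => eLpNorm (fun x => f (x - y) - f x) p volume) (𝓝 0) (𝓝 0) := by
  have : Fact (1 ≤ p) := ⟨hp1⟩
  -- The translations form a continuous family of measure preserving maps, and composition with such
  -- a family is continuous in L^p.
  let g : C(Model n, C(Model n, Model n)) :=
    ContinuousMap.curry ⟨fun z : Model n × Model n => z.2 - z.1, by fun_prop⟩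
  have hg : ∀ y, MeasurePreserving (g y) := fun y => measurePreserving_sub_right volume y
  have h := (continuous_const (y := hf.toLp f)).compMeasurePreservingLp g.continuous hg hp
  have h1 := h.tendsto 0
  rw [Lp.tendsto_Lp_iff_tendsto_eLpNorm'] at h1
  refine h1.congr fun y => eLpNorm_congr_ae ?_
  have e : ∀ y, (Lp.compMeasurePreserving (g y) (hg y) (hf.toLp f) : Model n → ℝ) =ᵐ[volume]
      fun x => f (x - y) := fun y =>
    (Lp.coeFn_compMeasurePreserving _ (hg y)).trans
      ((hg y).quasiMeasurePreserving.ae_eq_comp hf.coeFn_toLp)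
  filter_upwards [e y, e 0] with x h2 h3
  rw [Pi.sub_apply, h2, h3, sub_zero]

/-- Dominated convergence in `L^p`. -/
theorem tendsto_eLpNorm_zero_of_dominated {α : Type*} [MeasurableSpace α] {μ : Measure α}
    {p : ℝ≥0∞} (hp0 : p ≠ 0) (hp : p ≠ ⊤) {f : ℕ → α → ℝ} {g : α → ℝ}
    (hf : ∀ k, AEStronglyMeasurable (f k) μ) (hg : MemLp g p μ)
    (hfg : ∀ k, ∀ᵐ x ∂μ, ‖f k x‖ ≤ ‖g x‖)
    (hlim : ∀ᵐ x ∂μ, Tendsto (fun k => f k x) atTop (𝓝 0)) :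
    Tendsto (fun k => eLpNorm (f k) p μ) atTop (𝓝 0) := by
  have hp' : 0 < p.toReal := ENNReal.toReal_pos hp0 hp
  have h : Tendsto (fun k => ∫⁻ x, ‖f k x‖ₑ ^ p.toReal ∂μ) atTop (𝓝 (∫⁻ x, 0 ∂μ)) := by
    refine tendsto_lintegral_of_dominated_convergence' (fun x => ‖g x‖ₑ ^ p.toReal)
      (fun k => (hf k).enorm.pow_const _) (fun k => ?_) ?_ ?_
    · filter_upwards [hfg k] with x hx
      gcongr
      exact enorm_le_iff_norm_le.2 hx
    · exact (lintegral_rpow_enorm_lt_top_of_eLpNorm_lt_top hp0 hp hg.2).ne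
    · filter_upwards [hlim] with x hx
      have := (ENNReal.continuous_rpow_const (y := p.toReal)).tendsto 0
      rw [ENNReal.zero_rpow_of_pos hp'] at this
      refine this.comp ?_
      simpa using hx.enorm
  rw [lintegral_zero] at h
  have h2 := (ENNReal.continuous_rpow_const (y := 1 / p.toReal)).tendsto 0
  rw [ENNReal.zero_rpow_of_pos (by positivity)] at h2
  refine (h2.comp h).congr fun k => ?_
  exact (eLpNorm_eq_lintegral_rpow_enorm_toReal hp0 hp).symm

/-- The mollification averages translates against the probability measure ρ dy. By Jensen and
Tonelli its distance to f in L^p is at most the largest distance of f to a translate by a vector in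
the support of ρ. -/
theorem eLpNorm_mollify_sub_le {f : Model n → ℝ} {p : ℝ≥0∞} (hp1 : 1 ≤ p) (hp : p ≠ ⊤)
    (hf : MemLp f p) (k : ℕ) {C : ℝ≥0∞}
    (hC : ∀ y ∈ Metric.closedBall (0 : Model n) (1 / ((k : ℝ) + 1)),
      eLpNorm (fun x => f (x - y) - f x) p volume ≤ C) :
    eLpNorm (fun x => mollify k f x - f x) p volume ≤ C := by
  have hp0 : p ≠ 0 := (zero_lt_one.trans_le hp1).ne'
  have hp' : 0 < p.toReal := ENNReal.toReal_pos hp0 hp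
  set ρ := stdMollifier n k with hρ
  have hρm : Measurable ρ := (contDiff_stdMollifier k).continuous.measurable
  set ν : Measure (Model n) := volume.withDensity fun y => ENNReal.ofReal (ρ y) with hν
  have hνac : ν ≪ volume := withDensity_absolutelyContinuous _ _
  have : IsProbabilityMeasure ν := ⟨by
    rw [hν, withDensity_apply _ MeasurableSet.univ, Measure.restrict_univ,
      ← ofReal_integral_eq_lintegral_ofReal (integrable_stdMollifier k)
        (Eventually.of_forall (stdMollifier_nonneg k)), integral_stdMollifier, ENNReal.ofReal_one]⟩
  have hfl : LocallyIntegrable f := hf.locallyIntegrable hp1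
  have hpt : ∀ x, ‖mollify k f x - f x‖ₑ ^ p.toReal
      ≤ ∫⁻ y, ‖f (x - y) - f x‖ₑ ^ p.toReal ∂ν := by
    intro x
    have hm : AEStronglyMeasurable (fun y => f (x - y) - f x) ν :=
      ((hf.1.comp_quasiMeasurePreserving (quasiMeasurePreserving_sub_left volume x)).mono_ac
        hνac).sub aestronglyMeasurable_const
    have e1 : mollify k f x - f x = ∫ y, ρ y * (f (x - y) - f x) := by
      have hi : Integrable fun y => ρ y * f (x - y) :=
        ((hasCompactSupport_stdMollifier k).convolutionExists_left
          (ContinuousLinearMap.lsmul ℝ ℝ) (contDiff_stdMollifier k).continuous hfl x)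
      simp_rw [mul_sub]
      rw [integral_sub hi ((integrable_stdMollifier k).mul_const _), integral_mul_const,
        integral_stdMollifier, one_mul]
      rfl
    -- Jensen's inequality, in the form that the L¹ norm is at most the L^p norm on a probability
    -- space.
    have e2 : ‖mollify k f x - f x‖ₑ ≤ eLpNorm (fun y => f (x - y) - f x) p ν := by
      refine le_trans ?_ (eLpNorm_le_eLpNorm_of_exponent_le hp1 hm)
      rw [e1, eLpNorm_one_eq_lintegral_enorm, hν,
        lintegral_withDensity_eq_lintegral_mul_non_measurable _ hρm.ennreal_ofReal
          (Eventually.of_forall fun _ => ENNReal.ofReal_lt_top)]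
      refine (enorm_integral_le_lintegral_enorm _).trans (le_of_eq (lintegral_congr fun y => ?_))
      rw [enorm_mul, Real.enorm_of_nonneg (stdMollifier_nonneg k y)]
      rfl
    refine (ENNReal.rpow_le_rpow e2 hp'.le).trans (le_of_eq ?_)
    rw [eLpNorm_eq_lintegral_rpow_enorm_toReal hp0 hp, ← ENNReal.rpow_mul, one_div,
      inv_mul_cancel₀ hp'.ne', ENNReal.rpow_one]
  have hmeas : AEMeasurable (Function.uncurry fun x y => ‖f (x - y) - f x‖ₑ ^ p.toReal)
      (volume.prod ν) := by
    have h1 : (volume : Measure (Model n)).prod ν ≪ (volume : Measure (Model n)).prod volume :=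
      Measure.AbsolutelyContinuous.rfl.prod hνac
    have h2 : AEStronglyMeasurable (fun z : Model n × Model n => f (z.1 - z.2) - f z.1)
        ((volume : Measure (Model n)).prod volume) :=
      (hf.1.comp_quasiMeasurePreserving (quasiMeasurePreserving_sub volume volume)).sub
        (hf.1.comp_quasiMeasurePreserving Measure.quasiMeasurePreserving_fst)
    exact (h2.mono_ac h1).enorm.pow_const _
  have hball : ∀ᵐ y ∂ν, y ∈ Metric.closedBall (0 : Model n) (1 / ((k : ℝ) + 1)) := by
    rw [hν, ae_withDensity_iff hρm.ennreal_ofReal]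
    refine Eventually.of_forall fun y hy => ?_
    by_contra h
    rw [← tsupport_stdMollifier] at h
    exact hy (by rw [hρ, image_eq_zero_of_notMem_tsupport h, ENNReal.ofReal_zero])
  rw [eLpNorm_eq_lintegral_rpow_enorm_toReal hp0 hp, one_div,
    ENNReal.rpow_inv_le_iff hp']
  calc ∫⁻ x, ‖mollify k f x - f x‖ₑ ^ p.toReal
      ≤ ∫⁻ x, ∫⁻ y, ‖f (x - y) - f x‖ₑ ^ p.toReal ∂ν := lintegral_mono hpt
    _ = ∫⁻ y, (∫⁻ x, ‖f (x - y) - f x‖ₑ ^ p.toReal) ∂ν := lintegral_lintegral_swap hmeas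
    _ ≤ ∫⁻ y, C ^ p.toReal ∂ν := by
        refine lintegral_mono_ae ?_
        filter_upwards [hball] with y hy
        rw [← ENNReal.rpow_inv_le_iff hp', ← one_div,
          ← eLpNorm_eq_lintegral_rpow_enorm_toReal hp0 hp]
        exact hC y hy
    _ = C ^ p.toReal := by simp

theorem tendsto_eLpNorm_mollify_sub {f : Model n → ℝ} {p : ℝ≥0∞} (hp1 : 1 ≤ p) (hp : p ≠ ⊤)
    (hf : MemLp f p) :
    Tendsto (fun k => eLpNorm (fun x => mollify k f x - f x) p volume) atTop (𝓝 0) := by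
  rw [ENNReal.tendsto_nhds_zero]
  intro ε hε
  have h := (ENNReal.tendsto_nhds_zero.1 (tendsto_eLpNorm_translate hp1 hp hf)) ε hε
  obtain ⟨δ, hδ, h1⟩ := Metric.nhds_basis_closedBall.eventually_iff.1 h
  have h2 := (tendsto_one_div_add_atTop_nhds_zero_nat (𝕜 := ℝ)).eventually (gt_mem_nhds hδ)
  filter_upwards [h2] with k hk
  exact eLpNorm_mollify_sub_le hp1 hp hf k fun y hy =>
    h1 (Metric.closedBall_subset_closedBall hk.le hy)

end

end

/-! ### Weak derivatives in the model space: mollification and the chain rule. -/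

noncomputable section

section

variable {n : ℕ}

/-- `g` is the weak derivative of `f` in the direction `w` on `O`. -/
structure HasWeakDerivOn (O : Set (Model n)) (f : Model n → ℝ) (w : Model n)
    (g : Model n → ℝ) : Prop where
  locallyIntegrableOn : LocallyIntegrableOn f O volume
  locallyIntegrableOn_deriv : LocallyIntegrableOn g O volume
  integral_eq : ∀ η : Model n → ℝ, ContDiff ℝ ∞ η → HasCompactSupport η → tsupport η ⊆ O →
    ∫ y, f y * fderiv ℝ η y w = -∫ y, g y * η y

theorem integrable_mul_of_tsupport_subset {O : Set (Model n)} {f η : Model n → ℝ}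
    (hf : LocallyIntegrableOn f O volume) (hη : Continuous η) (hc : HasCompactSupport η)
    (hO : tsupport η ⊆ O) : Integrable fun y => f y * η y := by
  have h : IntegrableOn (fun y => f y * η y) (tsupport η) :=
    (hf.integrableOn_compact_subset hO hc).mul_continuousOn hη.continuousOn hc
  refine (integrableOn_iff_integrable_of_support_subset fun y hy => ?_).1 h
  exact subset_tsupport _ (right_ne_zero_of_mul hy)

theorem continuous_fderiv_apply_of_contDiff {η : Model n → ℝ} (hη : ContDiff ℝ ∞ η)
    (w : Model n) : Continuous fun y => fderiv ℝ η y w :=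
  (hη.continuous_fderiv (by simp)).clm_apply continuous_const

theorem tsupport_fderiv_apply_subset' (η : Model n → ℝ) (w : Model n) :
    tsupport (fun y => fderiv ℝ η y w) ⊆ tsupport η := tsupport_fderiv_apply_subset ℝ w

/-- Mollification needs a function on the whole space, but f is only locally integrable on O.
Cutting off to a compact K makes it integrable, and test functions supported in the interior of K do
not see the cut. -/
theorem HasWeakDerivOn.congr_indicator {O K : Set (Model n)} {f g : Model n → ℝ} {w : Model n}
    (h : HasWeakDerivOn O f w g) (hK : IsCompact K) (hKO : K ⊆ O) :
    HasWeakDerivOn (interior K) (K.indicator f) w (K.indicator g) := by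
  have hm := hK.measurableSet
  refine ⟨?_, ?_, fun η h1 h2 h3 => ?_⟩
  · exact ((integrable_indicator_iff hm).2
      (h.1.integrableOn_compact_subset hKO hK)).locallyIntegrable.locallyIntegrableOn _
  · exact ((integrable_indicator_iff hm).2
      (h.2.integrableOn_compact_subset hKO hK)).locallyIntegrable.locallyIntegrableOn _
  · have h4 := h.3 η h1 h2 (h3.trans (interior_subset.trans hKO))
    have e1 : ∀ y, K.indicator f y * fderiv ℝ η y w = f y * fderiv ℝ η y w := fun y => by
      by_cases hy : y ∈ K
      · rw [Set.indicator_of_mem hy]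
      · rw [image_eq_zero_of_notMem_tsupport (f := fun y => fderiv ℝ η y w) (fun h5 =>
          hy (interior_subset (h3 (tsupport_fderiv_apply_subset' η w h5))))]; simp
    have e2 : ∀ y, K.indicator g y * η y = g y * η y := fun y => by
      by_cases hy : y ∈ K
      · rw [Set.indicator_of_mem hy]
      · rw [image_eq_zero_of_notMem_tsupport (f := η) (fun h5 =>
          hy (interior_subset (h3 h5)))]; simp
    simpa only [e1, e2] using h4

/-- Mollification commutes with weak differentiation. -/
theorem HasWeakDerivOn.fderiv_mollify {O : Set (Model n)} {f g : Model n → ℝ} {w : Model n}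
    (h : HasWeakDerivOn O f w g) (hf : LocallyIntegrable f) {k : ℕ} {x : Model n}
    (hx : Metric.closedBall x (1 / ((k : ℝ) + 1)) ⊆ O) :
    fderiv ℝ (mollify k f) x w = mollify k g x := by
  set ρ := stdMollifier n k with hρ
  have hρc : ContDiff ℝ ∞ ρ := contDiff_stdMollifier k
  have hρs : HasCompactSupport ρ := hasCompactSupport_stdMollifier k
  have h1 := (hρs.hasFDerivAt_convolution_left (ContinuousLinearMap.lsmul ℝ ℝ)
    (hρc.of_le (by simp)) hf x)
  have hex : Integrable fun t => ((ContinuousLinearMap.lsmul ℝ ℝ).precompL (Model n))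
      (fderiv ℝ ρ t) (f (x - t)) :=
    (hρs.fderiv ℝ).convolutionExists_left _ (hρc.continuous_fderiv (by simp)) hf x
  have h2 : fderiv ℝ (mollify k f) x w = ∫ t, fderiv ℝ ρ t w * f (x - t) := by
    change fderiv ℝ (convolution ρ f (ContinuousLinearMap.lsmul ℝ ℝ) volume) x w = _
    rw [h1.fderiv, convolution_def, ContinuousLinearMap.integral_apply hex]
    rfl
  have h3 : ∫ t, fderiv ℝ ρ t w * f (x - t) = ∫ t, fderiv ℝ ρ (x - t) w * f t := by
    rw [← integral_sub_left_eq_self _ volume x]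
    simp
  -- The reflected kernel centred at x is an admissible test function, because its ball of support
  -- lies in O.
  have hη : ContDiff ℝ ∞ fun t => ρ (x - t) := hρc.comp (contDiff_const.sub contDiff_id)
  have hsupp : tsupport (fun t => ρ (x - t)) ⊆ Metric.closedBall x (1 / ((k : ℝ) + 1)) := by
    refine closure_minimal (fun t ht => ?_) Metric.isClosed_closedBall
    have h4 : x - t ∈ tsupport ρ := subset_tsupport _ ht
    rw [hρ, tsupport_stdMollifier, mem_closedBall_zero_iff] at h4
    rwa [Metric.mem_closedBall, dist_comm, dist_eq_norm]
  have hcs : HasCompactSupport fun t => ρ (x - t) :=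
    (isCompact_closedBall x _).of_isClosed_subset (isClosed_tsupport _) hsupp
  have hd : ∀ t, fderiv ℝ (fun t => ρ (x - t)) t w = -fderiv ℝ ρ (x - t) w := fun t => by
    have h5 : HasFDerivAt (fun t => ρ (x - t)) _ t := ((hρc.differentiable (by simp)) (x - t)).hasFDerivAt.comp t
      ((hasFDerivAt_const x t).sub (hasFDerivAt_id t))
    rw [h5.fderiv]
    simp
  have h6 := h.3 _ hη hcs (hsupp.trans hx)
  simp only [hd] at h6
  rw [h2, h3, mollify_apply_swap]
  have e1 : ∫ t, f t * -fderiv ℝ ρ (x - t) w = -∫ t, fderiv ℝ ρ (x - t) w * f t := by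
    rw [← integral_neg]; congr 1; ext t; ring
  rw [e1, neg_inj] at h6
  rw [h6]
  congr 1; ext t; ring

/-- A compact subset of an open set has a compact neighbourhood on which mollification at small
scales is controlled. -/
theorem exists_compact_nhds_mollify {S O : Set (Model n)} (hS : IsCompact S) (hO : IsOpen O)
    (hSO : S ⊆ O) : ∃ K, IsCompact K ∧ S ⊆ interior K ∧ K ⊆ O ∧
      ∀ᶠ k : ℕ in atTop, ∀ x ∈ S, Metric.closedBall x (1 / ((k : ℝ) + 1)) ⊆ interior K := by
  obtain ⟨K, hK, hSK, hKO⟩ := exists_compact_between hS hO hSO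
  obtain ⟨δ, hδ, h1⟩ := hS.exists_cthickening_subset_open isOpen_interior hSK
  refine ⟨K, hK, hSK, hKO, ?_⟩
  filter_upwards [(tendsto_one_div_add_atTop_nhds_zero_nat (𝕜 := ℝ)).eventually
    (gt_mem_nhds hδ)] with k hk x hx
  exact ((Metric.closedBall_subset_closedBall hk.le).trans
    (Metric.closedBall_subset_cthickening hx δ)).trans h1

/-- The chain rule for weak derivatives. -/
theorem HasWeakDerivOn.comp_contDiff {O : Set (Model n)} (hO : IsOpen O) {f g : Model n → ℝ}
    {w : Model n} (h : HasWeakDerivOn O f w g) {G : ℝ → ℝ} (hG : ContDiff ℝ 1 G) {C : ℝ}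
    (hC : ∀ s, |deriv G s| ≤ C) :
    HasWeakDerivOn O (fun y => G (f y)) w (fun y => deriv G (f y) * g y) := by
  have hlip : ∀ s t, |G s - G t| ≤ C * |s - t| := fun s t => by
    simpa [Real.norm_eq_abs] using Convex.norm_image_sub_le_of_norm_deriv_le (𝕜 := ℝ) (s := Set.univ)
      (fun x _ => (hG.differentiable (by simp)) x) (fun x _ => hC x) convex_univ
      (Set.mem_univ t) (Set.mem_univ s)
  have hGc : Continuous G := hG.continuous
  have hG'c : Continuous (deriv G) := hG.continuous_deriv (by simp)
  have hC0 : 0 ≤ C := (abs_nonneg _).trans (hC 0)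
  have hm : ∀ {K}, IsCompact K → K ⊆ O → IntegrableOn (fun y => G (f y)) K := fun {K} hK hKO => by
    have h1 := h.1.integrableOn_compact_subset hKO hK
    have h2 : IntegrableOn (fun _ : Model n => |G 0|) K := integrableOn_const hK.measure_ne_top
    refine ((h2.add (h1.norm.const_mul C)).mono' (hGc.comp_aestronglyMeasurable h1.1) ?_)
    refine Eventually.of_forall fun y => ?_
    have h3 := hlip (f y) 0
    have h4 := abs_sub_abs_le_abs_sub (G (f y)) (G 0)
    simp only [sub_zero] at h3
    simp only [Pi.add_apply, Real.norm_eq_abs]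
    linarith
  have hm' : ∀ {K}, IsCompact K → K ⊆ O → IntegrableOn (fun y => deriv G (f y) * g y) K :=
    fun {K} hK hKO => by
    have h1 := h.1.integrableOn_compact_subset hKO hK
    have h2 := h.2.integrableOn_compact_subset hKO hK
    exact h2.bdd_mul (hG'c.comp_aestronglyMeasurable h1.1) (c := C) (Eventually.of_forall fun y => hC _)
  refine ⟨(locallyIntegrableOn_iff hO.isLocallyClosed).2 fun K h1 h2 => hm h2 h1,
    (locallyIntegrableOn_iff hO.isLocallyClosed).2 fun K h1 h2 => hm' h2 h1, ?_⟩
  intro η hη hηc hηO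
  -- The identity for η involves f and g only near the support of η, so both are cut off to a
  -- compact neighbourhood K and mollified there.
  obtain ⟨K, hK, hSK, hKO, hev⟩ := exists_compact_nhds_mollify hηc hO hηO
  have hloc := h.congr_indicator hK hKO
  set F := K.indicator f with hF
  set g' := K.indicator g with hg'
  have hFi : Integrable F := (integrable_indicator_iff hK.measurableSet).2
    (h.1.integrableOn_compact_subset hKO hK)
  have hgi : Integrable g' := (integrable_indicator_iff hK.measurableSet).2
    (h.2.integrableOn_compact_subset hKO hK)
  have hηd := continuous_fderiv_apply_of_contDiff hη w
  have hηdc : HasCompactSupport fun y => fderiv ℝ η y w := hηc.fderiv_apply ℝ w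
  obtain ⟨B, hB⟩ := hη.continuous.bounded_above_of_compact_support hηc
  obtain ⟨B', hB'⟩ := hηd.bounded_above_of_compact_support hηdc
  have hGF : Integrable fun y => G (F y) * fderiv ℝ η y w := by
    have : LocallyIntegrable fun y => G (F y) := by
      have h2 : LocallyIntegrable fun _ : Model n => |G 0| := locallyIntegrable_const _
      refine (h2.add (hFi.norm.const_mul C).locallyIntegrable).mono
        (hGc.comp_aestronglyMeasurable hFi.1) (Eventually.of_forall fun y => ?_)
      have h3 := hlip (F y) 0
      have h4 := abs_sub_abs_le_abs_sub (G (F y)) (G 0)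
      simp only [sub_zero] at h3
      simp only [Pi.add_apply, Real.norm_eq_abs]
      rw [abs_of_nonneg (a := |G 0| + C * |F y|) (by positivity)]
      linarith
    exact integrable_mul_of_tsupport_subset (this.locallyIntegrableOn Set.univ) hηd hηdc
      (Set.subset_univ _)
  have hsm : ∀ k, ContDiff ℝ ∞ (mollify k F) := fun k => contDiff_mollify k hFi.locallyIntegrable
  have hsg : ∀ k, ContDiff ℝ ∞ (mollify k g') := fun k => contDiff_mollify k hgi.locallyIntegrable
  have hintk : ∀ k, Integrable fun y => G (mollify k F y) * fderiv ℝ η y w := fun k =>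
    (((hGc.comp (hsm k).continuous).mul hηd).integrable_of_hasCompactSupport hηdc.mul_left)
  have hL : Tendsto (fun k => ∫ y, G (mollify k F y) * fderiv ℝ η y w) atTop
      (𝓝 (∫ y, G (F y) * fderiv ℝ η y w)) := by
    refine tendsto_integral_of_L1' _ hGF.1 (Eventually.of_forall hintk) ?_
    have h1 := tendsto_eLpNorm_mollify_sub le_rfl ENNReal.one_ne_top (memLp_one_iff_integrable.2 hFi)
    have h2 := ENNReal.Tendsto.const_mul (a := ENNReal.ofReal (C * B')) h1 (Or.inr ENNReal.ofReal_ne_top)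
    rw [mul_zero] at h2
    refine tendsto_of_tendsto_of_tendsto_of_le_of_le tendsto_const_nhds h2 (fun _ => zero_le) fun k => ?_
    refine eLpNorm_le_mul_eLpNorm_of_ae_le_mul (Eventually.of_forall fun y => ?_) 1
    simp only [Pi.sub_apply, ← sub_mul, Real.norm_eq_abs, abs_mul]
    calc |G (mollify k F y) - G (F y)| * |fderiv ℝ η y w|
        ≤ (C * |mollify k F y - F y|) * B' := by
          gcongr
          · exact hlip _ _
          · exact hB' y
      _ = C * B' * |mollify k F y - F y| := by ring
  -- The derivative side splits as G'(F_k)(g_k - g') + G'(F_k) g'. The first term vanishes in the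
  -- limit by L¹ convergence of g_k and boundedness of G'; the second needs only almost everywhere
  -- convergence of F_k and the bound by |g'|.
  have hR1 : Tendsto (fun k => ∫ y, deriv G (mollify k F y) * (mollify k g' y - g' y) * η y) atTop
      (𝓝 0) := by
    have hmeas : ∀ k, AEStronglyMeasurable
        (fun y => deriv G (mollify k F y) * (mollify k g' y - g' y) * η y) volume := fun k =>
      ((hG'c.comp (hsm k).continuous).aestronglyMeasurable.mul
        ((hsg k).continuous.aestronglyMeasurable.sub hgi.1)).mul hη.continuous.aestronglyMeasurable
    have h1 := tendsto_eLpNorm_mollify_sub le_rfl ENNReal.one_ne_top (memLp_one_iff_integrable.2 hgi)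
    have h2 := ENNReal.Tendsto.const_mul (a := ENNReal.ofReal (C * B)) h1 (Or.inr ENNReal.ofReal_ne_top)
    rw [mul_zero] at h2
    have hle : ∀ k, eLpNorm (fun y => deriv G (mollify k F y) * (mollify k g' y - g' y) * η y) 1 volume
        ≤ ENNReal.ofReal (C * B) * eLpNorm (fun y => mollify k g' y - g' y) 1 volume := fun k => by
      refine eLpNorm_le_mul_eLpNorm_of_ae_le_mul (Eventually.of_forall fun y => ?_) 1
      simp only [Real.norm_eq_abs, abs_mul]
      calc |deriv G (mollify k F y)| * |mollify k g' y - g' y| * |η y|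
          ≤ C * |mollify k g' y - g' y| * B := by
            gcongr
            · exact hC _
            · exact hB y
        _ = C * B * |mollify k g' y - g' y| := by ring
    have h3 := tendsto_of_tendsto_of_tendsto_of_le_of_le tendsto_const_nhds h2 (fun _ => zero_le) hle
    have h4 : ∀ᶠ k in atTop, Integrable
        (fun y => deriv G (mollify k F y) * (mollify k g' y - g' y) * η y) := by
      filter_upwards [h3.eventually (gt_mem_nhds zero_lt_one)] with k hk
      exact memLp_one_iff_integrable.1 ⟨hmeas k, hk.trans ENNReal.one_lt_top⟩
    have h5 := tendsto_integral_of_L1' (0 : Model n → ℝ) aestronglyMeasurable_zero h4 (by simpa using h3)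
    simpa using h5
  have hR2 : Tendsto (fun k => ∫ y, deriv G (mollify k F y) * g' y * η y) atTop
      (𝓝 (∫ y, deriv G (F y) * g' y * η y)) := by
    refine tendsto_integral_of_dominated_convergence (fun y => C * |g' y| * B) (fun k => ?_)
      ((hgi.norm.const_mul C).mul_const B) (fun k => Eventually.of_forall fun y => ?_) ?_
    · exact ((hG'c.comp (hsm k).continuous).aestronglyMeasurable.mul hgi.1).mul
        hη.continuous.aestronglyMeasurable
    · simp only [Real.norm_eq_abs, abs_mul]
      gcongr
      · exact hC _
      · exact hB y
    · filter_upwards [ae_tendsto_mollify hFi.locallyIntegrable] with y hy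
      exact (((hG'c.tendsto _).comp hy).mul_const _).mul_const _
  have hintg : ∀ k, Integrable fun y => deriv G (mollify k F y) * g' y * η y := fun k => by
    refine ((hgi.norm.const_mul C).mul_const B).mono' ?_ (Eventually.of_forall fun y => ?_)
    · exact ((hG'c.comp (hsm k).continuous).aestronglyMeasurable.mul hgi.1).mul
        hη.continuous.aestronglyMeasurable
    · simp only [Real.norm_eq_abs, abs_mul]
      gcongr
      · exact hC _
      · exact hB y
  have hintg2 : ∀ k, Integrable fun y => deriv G (mollify k F y) * mollify k g' y * η y := fun k =>
    (((hG'c.comp (hsm k).continuous).mul (hsg k).continuous).mul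
      hη.continuous).integrable_of_hasCompactSupport hηc.mul_left
  -- On the support of η the smooth F_k has classical derivative g_k in direction w once the
  -- mollification radius is small, so ordinary integration by parts applies; elsewhere η kills the
  -- integrand.
  have heq : ∀ᶠ k in atTop, ∫ y, G (mollify k F y) * fderiv ℝ η y w =
      -((∫ y, deriv G (mollify k F y) * (mollify k g' y - g' y) * η y)
        + ∫ y, deriv G (mollify k F y) * g' y * η y) := by
    filter_upwards [hev] with k hk
    have hGd : ∀ y, HasFDerivAt (fun y => G (mollify k F y))
        (deriv G (mollify k F y) • fderiv ℝ (mollify k F) y) y := fun y =>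
      ((hG.differentiable (by simp)) _).hasDerivAt.comp_hasFDerivAt y
        (((hsm k).differentiable (by simp)) y).hasFDerivAt
    have hcong : ∀ y, fderiv ℝ (fun y => G (mollify k F y)) y w * η y
        = deriv G (mollify k F y) * mollify k g' y * η y := fun y => by
      by_cases hy : y ∈ tsupport η
      · rw [(hGd y).fderiv, ← hloc.fderiv_mollify hFi.locallyIntegrable (hk y hy)]; simp
      · rw [image_eq_zero_of_notMem_tsupport hy]; simp
    rw [integral_mul_fderiv_eq_neg_fderiv_mul_of_integrable (by simpa only [hcong] using hintg2 k)
      (hintk k) (((hGc.comp (hsm k).continuous).mul hη.continuous).integrable_of_hasCompactSupport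
        hηc.mul_left) (fun y _ => (hGd y).differentiableAt)
        (fun y _ => (hη.differentiable (by simp)) y)]
    simp only [hcong]
    rw [neg_inj, ← integral_add _ (hintg k)]
    · congr 1; ext y; ring
    · refine ((hintg2 k).sub (hintg k)).congr (Eventually.of_forall fun y => ?_)
      simp only [Pi.sub_apply]; ring
  have hfin := tendsto_nhds_unique (hL.congr' heq) (hR1.add hR2).neg
  rw [zero_add] at hfin
  have e1 : ∀ y, G (F y) * fderiv ℝ η y w = G (f y) * fderiv ℝ η y w := fun y => by
    by_cases hy : y ∈ K
    · rw [hF, Set.indicator_of_mem hy]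
    · rw [image_eq_zero_of_notMem_tsupport (f := fun y => fderiv ℝ η y w) (fun h5 =>
        hy (interior_subset (hSK (tsupport_fderiv_apply_subset' η w h5))))]; simp
  have e2 : ∀ y, deriv G (F y) * g' y * η y = deriv G (f y) * g y * η y := fun y => by
    by_cases hy : y ∈ K
    · rw [hF, hg', Set.indicator_of_mem hy, Set.indicator_of_mem hy]
    · rw [image_eq_zero_of_notMem_tsupport (f := η) (fun h5 =>
        hy (interior_subset (hSK h5)))]; simp
  simpa only [e1, e2] using hfin

end

end

/-! ### Cutoffs, uniqueness, limits and smooth approximation for weak derivatives. -/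

noncomputable section

section

variable {n : ℕ}

/-- The product rule for a weakly differentiable function on `O` and a cutoff function in `O`. -/
theorem HasWeakDerivOn.cutoff_mul {O : Set (Model n)} {f g χ : Model n → ℝ} {w : Model n}
    (h : HasWeakDerivOn O f w g) (hχ : ContDiff ℝ ∞ χ) (hc : HasCompactSupport χ)
    (hO : tsupport χ ⊆ O) :
    HasWeakDerivOn Set.univ (fun y => χ y * f y) w
      (fun y => χ y * g y + fderiv ℝ χ y w * f y) := by
  have hχd := continuous_fderiv_apply_of_contDiff hχ w
  have hdO : tsupport (fun y => fderiv ℝ χ y w) ⊆ O := (tsupport_fderiv_apply_subset' χ w).trans hO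
  have i1 : Integrable fun y => χ y * f y := by
    simpa only [mul_comm] using integrable_mul_of_tsupport_subset h.1 hχ.continuous hc hO
  have i2 : Integrable fun y => χ y * g y := by
    simpa only [mul_comm] using integrable_mul_of_tsupport_subset h.2 hχ.continuous hc hO
  have i3 : Integrable fun y => fderiv ℝ χ y w * f y := by
    simpa only [mul_comm] using
      integrable_mul_of_tsupport_subset h.1 hχd (hc.fderiv_apply ℝ w) hdO
  refine ⟨i1.locallyIntegrable.locallyIntegrableOn _,
    (i2.add i3).locallyIntegrable.locallyIntegrableOn _, fun η hη hηc _ => ?_⟩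
  have hηd := continuous_fderiv_apply_of_contDiff hη w
  have hd : ∀ y, fderiv ℝ (fun y => χ y * η y) y w = χ y * fderiv ℝ η y w + η y * fderiv ℝ χ y w :=
    fun y => by
      rw [fderiv_fun_mul ((hχ.differentiable (by simp)) y) ((hη.differentiable (by simp)) y)]
      simp
  -- Testing with χ η, which is supported in O although η need not be.
  have h1 := h.3 (fun y => χ y * η y) (hχ.mul hη) hηc.mul_left
    ((tsupport_mul_subset_left).trans hO)
  simp only [hd] at h1
  have hL : LocallyIntegrableOn (fun y => χ y * f y) Set.univ volume :=
    i1.locallyIntegrable.locallyIntegrableOn _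
  have j1 : Integrable fun y => χ y * f y * fderiv ℝ η y w :=
    integrable_mul_of_tsupport_subset hL hηd (hηc.fderiv_apply ℝ w) (Set.subset_univ _)
  have j2 : Integrable fun y => fderiv ℝ χ y w * f y * η y :=
    integrable_mul_of_tsupport_subset (i3.locallyIntegrable.locallyIntegrableOn _) hη.continuous hηc
      (Set.subset_univ _)
  have j3 : Integrable fun y => χ y * g y * η y :=
    integrable_mul_of_tsupport_subset (i2.locallyIntegrable.locallyIntegrableOn _) hη.continuous hηc
      (Set.subset_univ _)
  have e1 : ∫ y, f y * (χ y * fderiv ℝ η y w + η y * fderiv ℝ χ y w) =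
      (∫ y, χ y * f y * fderiv ℝ η y w) + ∫ y, fderiv ℝ χ y w * f y * η y := by
    rw [← integral_add j1 j2]; congr 1; ext y; ring
  have e2 : ∫ y, (χ y * g y + fderiv ℝ χ y w * f y) * η y =
      (∫ y, χ y * g y * η y) + ∫ y, fderiv ℝ χ y w * f y * η y := by
    rw [← integral_add j3 j2]; congr 1; ext y; ring
  have e3 : ∫ y, g y * (χ y * η y) = ∫ y, χ y * g y * η y := by congr 1; ext y; ring
  rw [e1, e3] at h1
  rw [e2]
  linarith

/-- The difference of the two derivatives integrates to zero against every test function, so the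
fundamental lemma of the calculus of variations applies. -/
theorem HasWeakDerivOn.ae_eq {O : Set (Model n)} (hO : IsOpen O) {f g g' : Model n → ℝ}
    {w : Model n} (h : HasWeakDerivOn O f w g) (h' : HasWeakDerivOn O f w g') :
    ∀ᵐ y, y ∈ O → g y = g' y := by
  have h1 := hO.ae_eq_zero_of_integral_contDiff_smul_eq_zero (h.2.sub h'.2) fun η hη hc hs => by
    have i1 := integrable_mul_of_tsupport_subset h.2 hη.continuous hc hs
    have i2 := integrable_mul_of_tsupport_subset h'.2 hη.continuous hc hs
    have e : ∫ y, η y • (g - g') y = (∫ y, g y * η y) - ∫ y, g' y * η y := by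
      rw [← integral_sub i1 i2]; congr 1; ext y; simp; ring
    rw [e]
    have := h.3 η hη hc hs
    have := h'.3 η hη hc hs
    linarith
  filter_upwards [h1] with y hy hyO
  exact sub_eq_zero.1 (hy hyO)

/-- Weak derivatives pass to dominated pointwise limits. -/
theorem HasWeakDerivOn.of_tendsto {O : Set (Model n)} {F g₀ : Model n → ℝ}
    {f g : ℕ → Model n → ℝ} {f' g' : Model n → ℝ} {w : Model n} {C : ℝ}
    (h : ∀ k, HasWeakDerivOn O (f k) w (g k))
    (hF : LocallyIntegrableOn F O volume) (hg₀ : LocallyIntegrableOn g₀ O volume)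
    (hf'm : LocallyIntegrableOn f' O volume) (hg'm : LocallyIntegrableOn g' O volume)
    (hfC : ∀ k y, |f k y| ≤ C * |F y|) (hgC : ∀ k y, |g k y| ≤ C * |g₀ y|)
    (hf : ∀ y, Tendsto (fun k => f k y) atTop (𝓝 (f' y)))
    (hg : ∀ y, Tendsto (fun k => g k y) atTop (𝓝 (g' y))) :
    HasWeakDerivOn O f' w g' := by
  refine ⟨hf'm, hg'm, fun η hη hc hs => ?_⟩
  have hηd := continuous_fderiv_apply_of_contDiff hη w
  have hdc : HasCompactSupport fun y => fderiv ℝ η y w := hc.fderiv_apply ℝ w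
  have hds := (tsupport_fderiv_apply_subset' η w).trans hs
  have t1 : Tendsto (fun k => ∫ y, f k y * fderiv ℝ η y w) atTop
      (𝓝 (∫ y, f' y * fderiv ℝ η y w)) := by
    refine tendsto_integral_of_dominated_convergence (fun y => C * |F y * fderiv ℝ η y w|)
      (fun k => (integrable_mul_of_tsupport_subset (h k).1 hηd hdc hds).1)
      ((integrable_mul_of_tsupport_subset hF hηd hdc hds).norm.const_mul C)
      (fun k => Eventually.of_forall fun y => ?_) (Eventually.of_forall fun y => (hf y).mul_const _)
    rw [Real.norm_eq_abs, abs_mul, abs_mul, ← mul_assoc]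
    exact mul_le_mul_of_nonneg_right (hfC k y) (abs_nonneg _)
  have t2 : Tendsto (fun k => ∫ y, g k y * η y) atTop (𝓝 (∫ y, g' y * η y)) := by
    refine tendsto_integral_of_dominated_convergence (fun y => C * |g₀ y * η y|)
      (fun k => (integrable_mul_of_tsupport_subset (h k).2 hη.continuous hc hs).1)
      ((integrable_mul_of_tsupport_subset hg₀ hη.continuous hc hs).norm.const_mul C)
      (fun k => Eventually.of_forall fun y => ?_) (Eventually.of_forall fun y => (hg y).mul_const _)
    rw [Real.norm_eq_abs, abs_mul, abs_mul, ← mul_assoc]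
    exact mul_le_mul_of_nonneg_right (hgC k y) (abs_nonneg _)
  refine tendsto_nhds_unique t1 (t2.neg.congr fun k => ?_)
  exact ((h k).3 η hη hc hs).symm

/-- A function with vanishing weak derivatives is locally constant almost everywhere. -/
theorem exists_ae_eq_const_of_weakDeriv_zero {O : Set (Model n)} {f : Model n → ℝ}
    (hO : IsOpen O) (h : ∀ w, HasWeakDerivOn O f w 0) {x₀ : Model n} {R : ℝ}
    (hR : Metric.closedBall x₀ R ⊆ O) :
    ∃ c, ∀ᵐ y, y ∈ Metric.ball x₀ R → f y = c := by
  obtain ⟨K, hK, hSK, hKO, hev⟩ :=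
    exists_compact_nhds_mollify (isCompact_closedBall x₀ R) hO hR
  rcases (Metric.ball x₀ R).eq_empty_or_nonempty with he | hne
  · exact ⟨0, by simp [he]⟩
  set F := K.indicator f with hF
  have hFl : LocallyIntegrable F := ((integrable_indicator_iff hK.measurableSet).2
    ((h 0).1.integrableOn_compact_subset hKO hK)).locallyIntegrable
  have hconst : ∀ᶠ k in atTop, ∀ x ∈ Metric.ball x₀ R, ∀ y ∈ Metric.ball x₀ R,
      mollify k F x = mollify k F y := by
    filter_upwards [hev] with k hk x hx y hy
    refine (convex_ball x₀ R).is_const_of_fderivWithin_eq_zero (𝕜 := ℝ)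
      ((contDiff_mollify k hFl).differentiable (by simp)).differentiableOn (fun z hz => ?_) hx hy
    rw [fderivWithin_of_isOpen Metric.isOpen_ball hz]
    ext w
    rw [((h w).congr_indicator hK hKO).fderiv_mollify hFl (hk z (Metric.ball_subset_closedBall hz)),
      mollify_apply]
    simp
  have hae := ae_tendsto_mollify hFl
  have hpos : 0 < volume (Metric.ball x₀ R) := Metric.isOpen_ball.measure_pos volume hne
  -- The mollifications are eventually constant on the ball, so their convergence at one point z
  -- fixes the limit at all points of convergence.
  obtain ⟨z, hz, hzt⟩ : ∃ z ∈ Metric.ball x₀ R,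
      Tendsto (fun k => mollify k F z) atTop (𝓝 (F z)) := by
    by_contra hcon
    push Not at hcon
    exact hpos.ne' (measure_mono_null (fun y hy => hcon y hy) hae)
  refine ⟨F z, ?_⟩
  filter_upwards [hae] with y hy hyb
  have h1 : F y = F z := tendsto_nhds_unique hy
    (hzt.congr' (hconst.mono fun k hk => hk z hz y hyb))
  rw [← h1, hF, Set.indicator_of_mem (interior_subset (hSK (Metric.ball_subset_closedBall hyb)))]

/-- A compactly supported Sobolev function is approximated by smooth functions with support in a
small neighbourhood. -/
theorem exists_smooth_approx {O S : Set (Model n)} (hS : IsCompact S) (hO : IsOpen O) (hSO : S ⊆ O)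
    {ι : Type*} [Finite ι] {F : Model n → ℝ} {w : ι → Model n} {g : ι → Model n → ℝ} {p : ℝ≥0∞}
    (hp1 : 1 ≤ p) (hp : p ≠ ⊤) (hFS : ∀ y ∉ S, F y = 0) (hF : MemLp F p)
    (hg : ∀ i, MemLp (g i) p) (h : ∀ i, HasWeakDerivOn Set.univ F (w i) (g i)) :
    ∃ K, IsCompact K ∧ S ⊆ K ∧ K ⊆ O ∧ ∀ ε : ℝ≥0∞, 0 < ε → ∃ η : Model n → ℝ, ContDiff ℝ ∞ η ∧
      tsupport η ⊆ K ∧ eLpNorm (fun y => F y - η y) p volume < ε ∧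
      ∀ i, eLpNorm (fun y => g i y - fderiv ℝ η y (w i)) p volume < ε := by
  -- The thickening K is fixed before ε, so that constants depending on K can be chosen before the
  -- accuracy.
  obtain ⟨δ, hδ, hδO⟩ := hS.exists_cthickening_subset_open hO hSO
  have hK : IsCompact (Metric.cthickening δ S) := hS.cthickening
  refine ⟨_, hK, Metric.self_subset_cthickening S, hδO, fun ε hε => ?_⟩
  have hFl := hF.locallyIntegrable hp1
  have e1 := (tendsto_eLpNorm_mollify_sub hp1 hp hF).eventually (gt_mem_nhds hε)
  have e2 : ∀ᶠ k in atTop, ∀ i, eLpNorm (fun x => mollify k (g i) x - g i x) p volume < ε :=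
    eventually_all.2 fun i => (tendsto_eLpNorm_mollify_sub hp1 hp (hg i)).eventually (gt_mem_nhds hε)
  obtain ⟨k, h1, h2, h3⟩ := (e1.and (e2.and ((tendsto_one_div_add_atTop_nhds_zero_nat
    (𝕜 := ℝ)).eventually (gt_mem_nhds hδ)))).exists
  refine ⟨mollify k F, contDiff_mollify k hFl, ?_, ?_, fun i => ?_⟩
  · refine closure_minimal (fun x hx => ?_) Metric.isClosed_cthickening
    by_contra hxK
    refine hx (mollify_eq_zero hFS fun y hy => ?_)
    by_contra hle
    exact hxK (Metric.mem_cthickening_of_dist_le x y δ S hy ((not_lt.1 hle).trans h3.le))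
  · rw [← eLpNorm_neg]
    simpa [Pi.neg_def] using h1
  · rw [← eLpNorm_neg]
    have : (-fun y => g i y - fderiv ℝ (mollify k F) y (w i)) =
        fun y => mollify k (g i) y - g i y := by
      ext y
      rw [Pi.neg_apply, (h i).fderiv_mollify hFl (Set.subset_univ _), neg_sub]
    rw [this]
    exact h2 i

end

end

/-! ### The Riemannian metric in charts. -/

noncomputable section


section ChartGeometry

variable {n : ℕ} {M : Type*} [TopologicalSpace M] [ChartedSpace (Model n) M]
  [IsManifold 𝓘(ℝ, Model n) ∞ M]
  [RiemannianBundle (fun x : M => TangentSpace 𝓘(ℝ, Model n) x)]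

/-- The `i`-th coordinate vector field of a chart. -/
def coordField (e : OpenPartialHomeomorph M (Model n)) (i : Fin n) (y : Model n) :
    TangentSpace 𝓘(ℝ, Model n) (e.symm y) :=
  coordVec e y (EuclideanSpace.single i 1)

theorem coordVec_eq_sum (e : OpenPartialHomeomorph M (Model n)) (y w : Model n) :
    coordVec e y w = ∑ i, w i • coordField e i y := by
  have h : w = ∑ i, w i • EuclideanSpace.single i (1 : ℝ) := by
    ext j
    simp [Finset.sum_apply, Pi.single_apply]
  conv_lhs => rw [h]
  simp only [coordVec, coordField]
  exact (map_sum (mfderiv 𝓘(ℝ, Model n) 𝓘(ℝ, Model n) e.symm y) _ _).trans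
    (Finset.sum_congr rfl fun i _ => map_smul _ _ _)

theorem coordVec_surjective {e : OpenPartialHomeomorph M (Model n)} (he : e ∈ atlas (Model n) M)
    {y : Model n} (hy : y ∈ e.target) (X : TangentSpace 𝓘(ℝ, Model n) (e.symm y)) :
    ∃ c, coordVec e y c = X := by
  have h := (mdifferentiable_of_mem_atlas (I := 𝓘(ℝ, Model n)) he).symm_comp_deriv
    (e.map_target hy)
  refine ⟨mfderiv 𝓘(ℝ, Model n) 𝓘(ℝ, Model n) e (e.symm y) X, ?_⟩
  have h2 : mfderiv 𝓘(ℝ, Model n) 𝓘(ℝ, Model n) e.symm (e (e.symm y))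
      (mfderiv 𝓘(ℝ, Model n) 𝓘(ℝ, Model n) e (e.symm y) X) = X := congrArg (fun L => L X) h
  rw [e.right_inv hy] at h2
  exact h2

theorem coordVec_injective {e : OpenPartialHomeomorph M (Model n)} (he : e ∈ atlas (Model n) M)
    {y : Model n} (hy : y ∈ e.target) {c : Model n} (hc : coordVec e y c = 0) : c = 0 := by
  have h := (mdifferentiable_of_mem_atlas (I := 𝓘(ℝ, Model n)) he).comp_symm_deriv hy
  have h2 := congrArg (fun L => L c) h
  change mfderiv 𝓘(ℝ, Model n) 𝓘(ℝ, Model n) e (e.symm y) (coordVec e y c) = c at h2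
  rw [hc, map_zero] at h2
  exact h2.symm

theorem inner_coordVec_coordVec (e : OpenPartialHomeomorph M (Model n)) (y v w : Model n) :
    inner ℝ (coordVec e y v) (coordVec e y w) =
      WithLp.ofLp v ⬝ᵥ (metricMatrix e y).mulVec (WithLp.ofLp w) := by
  rw [coordVec_eq_sum e y v, coordVec_eq_sum e y w]
  simp only [sum_inner, inner_sum, real_inner_smul_left, real_inner_smul_right, dotProduct,
    Matrix.mulVec, metricMatrix, Matrix.of_apply, coordField, Finset.mul_sum]
  rw [Finset.sum_comm]
  refine Finset.sum_congr rfl fun i _ => Finset.sum_congr rfl fun j _ => ?_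
  ring

theorem metricMatrix_posDef {e : OpenPartialHomeomorph M (Model n)} (he : e ∈ atlas (Model n) M)
    {y : Model n} (hy : y ∈ e.target) : (metricMatrix e y).PosDef := by
  refine Matrix.PosDef.of_dotProduct_mulVec_pos ?_ fun v hv => ?_
  · ext i j
    simp [metricMatrix, real_inner_comm]
  · have h1 := inner_coordVec_coordVec e y (WithLp.toLp 2 v) (WithLp.toLp 2 v)
    have h2 : coordVec e y (WithLp.toLp 2 v) ≠ 0 := fun h => hv (by
      simpa using coordVec_injective he hy h)
    rw [star_trivial]
    have h3 := real_inner_self_pos.2 h2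
    rw [h1] at h3
    exact h3

/-- A weak gradient is known through its covariant components ⟨X, ∂_i⟩. The inverse Gram matrix
recovers inner products from them. -/
theorem inner_eq_dotProduct_inv {e : OpenPartialHomeomorph M (Model n)}
    (he : e ∈ atlas (Model n) M) {y : Model n} (hy : y ∈ e.target)
    (X Y : TangentSpace 𝓘(ℝ, Model n) (e.symm y)) :
    inner ℝ X Y = (fun i => inner ℝ X (coordField e i y)) ⬝ᵥ
      (metricMatrix e y)⁻¹.mulVec (fun i => inner ℝ Y (coordField e i y)) := by
  obtain ⟨c, rfl⟩ := coordVec_surjective he hy X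
  obtain ⟨d, rfl⟩ := coordVec_surjective he hy Y
  have hdet : IsUnit (metricMatrix e y).det := (metricMatrix_posDef he hy).det_pos.ne'.isUnit
  have h1 : ∀ d : Model n, (fun i => inner ℝ (coordVec e y d) (coordField e i y)) =
      (metricMatrix e y).mulVec (WithLp.ofLp d) := fun d => by
    ext i
    rw [real_inner_comm, coordField, inner_coordVec_coordVec]
    simp
  rw [inner_coordVec_coordVec, h1 d, Matrix.mulVec_mulVec, Matrix.nonsing_inv_mul _ hdet,
    Matrix.one_mulVec]
  have h2 : (fun i => inner ℝ (coordVec e y c) (coordField e i y)) =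
      (metricMatrix e y).mulVec (WithLp.ofLp c) := h1 c
  rw [h2, Matrix.dotProduct_mulVec, ← Matrix.mulVec_transpose]
  congr 2
  ext i j
  simp [metricMatrix, real_inner_comm]

variable [IsContMDiffRiemannianBundle 𝓘(ℝ, Model n) ∞ (Model n)
      (fun x : M => TangentSpace 𝓘(ℝ, Model n) x)]

/-- Continuity is stated for a section of the tangent bundle, as needed to apply continuity of the
metric. It comes from the tangent map of the smooth inverse chart. -/
theorem continuousOn_coordVec {e : OpenPartialHomeomorph M (Model n)}
    (he : e ∈ atlas (Model n) M) (w : Model n) :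
    ContinuousOn (fun y => (⟨e.symm y, coordVec e y w⟩ : TangentBundle 𝓘(ℝ, Model n) M))
      e.target := by
  have h1 := (contMDiffOn_symm_of_mem_maximalAtlas (IsManifold.subset_maximalAtlas
    (I := 𝓘(ℝ, Model n)) (n := ∞) he)).continuousOn_tangentMapWithin (by simp)
    e.open_target.uniqueMDiffOn
  have h2 : Continuous fun y : Model n => (⟨y, w⟩ : TangentBundle 𝓘(ℝ, Model n) (Model n)) := by
    exact (tangentBundleModelSpaceHomeomorph 𝓘(ℝ, Model n)).symm.continuous.comp
      (continuous_id.prodMk continuous_const)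
  refine (h1.comp h2.continuousOn fun y hy => hy).congr fun y hy => ?_
  simp only [Function.comp_apply, tangentMapWithin, coordVec]
  rw [mfderivWithin_of_isOpen e.open_target hy]

theorem isContinuousRiemannianBundle_tangentSpace :
    IsContinuousRiemannianBundle (Model n) (fun x : M => TangentSpace 𝓘(ℝ, Model n) x) := by
  obtain ⟨g, hg, hg'⟩ := IsContMDiffRiemannianBundle.exists_contMDiff (IB := 𝓘(ℝ, Model n)) (n := ∞)
    (F := Model n) (E := fun x : M => TangentSpace 𝓘(ℝ, Model n) x)
  exact ⟨g, hg.continuous, hg'⟩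

theorem continuousOn_inner_coordVec {e : OpenPartialHomeomorph M (Model n)}
    (he : e ∈ atlas (Model n) M) (v w : Model n) :
    ContinuousOn (fun y => inner ℝ (coordVec e y v) (coordVec e y w)) e.target := by
  have := isContinuousRiemannianBundle_tangentSpace (n := n) (M := M)
  exact (continuousOn_coordVec he _).inner_bundle (continuousOn_coordVec he _)

theorem continuousOn_metricMatrix {e : OpenPartialHomeomorph M (Model n)}
    (he : e ∈ atlas (Model n) M) : ContinuousOn (metricMatrix e) e.target := by
  refine continuousOn_pi.2 fun i => continuousOn_pi.2 fun j => ?_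
  exact continuousOn_inner_coordVec he _ _

theorem continuousOn_det_metricMatrix {e : OpenPartialHomeomorph M (Model n)}
    (he : e ∈ atlas (Model n) M) : ContinuousOn (fun y => (metricMatrix e y).det) e.target :=
  (continuous_id.matrix_det).comp_continuousOn (continuousOn_metricMatrix he)

theorem continuousOn_inv_metricMatrix {e : OpenPartialHomeomorph M (Model n)}
    (he : e ∈ atlas (Model n) M) : ContinuousOn (fun y => (metricMatrix e y)⁻¹) e.target := by
  have h1 : ContinuousOn (fun y => (metricMatrix e y).adjugate) e.target :=
    (continuous_id.matrix_adjugate).comp_continuousOn (continuousOn_metricMatrix he)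
  refine (((continuousOn_det_metricMatrix he).inv₀ fun y hy =>
    (metricMatrix_posDef he hy).det_pos.ne').smul h1).congr fun y _ => ?_
  rw [Matrix.inv_def, Ring.inverse_eq_inv']
  rfl

/-- On compact subsets of a chart, tangent vectors are controlled by their covariant components. -/
theorem exists_norm_le_sum_inner {e : OpenPartialHomeomorph M (Model n)}
    (he : e ∈ atlas (Model n) M) {S : Set (Model n)} (hS : IsCompact S) (hSe : S ⊆ e.target) :
    ∃ C : ℝ, 0 ≤ C ∧ ∀ y ∈ S, ∀ X : TangentSpace 𝓘(ℝ, Model n) (e.symm y),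
      ‖X‖ ≤ C * ∑ i, |inner ℝ X (coordField e i y)| := by
  have h1 : ∀ i j, ∃ C : ℝ, ∀ y ∈ S, ‖(metricMatrix e y)⁻¹ i j‖ ≤ C := fun i j =>
    hS.exists_bound_of_continuousOn
      (continuousOn_pi.1 (continuousOn_pi.1 ((continuousOn_inv_metricMatrix he).mono hSe) i) j)
  choose C hC using h1
  -- D bounds the sum of all entries of the inverse Gram matrix on S, hence ‖X‖² by D times the
  -- squared sum of the components.
  set D := ∑ i, ∑ j, |C i j| with hD
  have hD0 : 0 ≤ D := Finset.sum_nonneg fun i _ => Finset.sum_nonneg fun j _ => abs_nonneg _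
  refine ⟨Real.sqrt D, Real.sqrt_nonneg _, fun y hy X => ?_⟩
  set b : Fin n → ℝ := fun i => inner ℝ X (coordField e i y) with hb
  set s := ∑ i, |b i| with hs
  have hbs : ∀ i, |b i| ≤ s := fun i =>
    Finset.single_le_sum (f := fun i => |b i|) (fun _ _ => abs_nonneg _) (Finset.mem_univ i)
  have hs0 : 0 ≤ s := Finset.sum_nonneg fun i _ => abs_nonneg _
  have h2 : ‖X‖ ^ 2 ≤ D * s ^ 2 := by
    rw [← real_inner_self_eq_norm_sq, inner_eq_dotProduct_inv he (hSe hy)]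
    simp only [dotProduct, Matrix.mulVec, Finset.mul_sum, hD, Finset.sum_mul]
    refine Finset.sum_le_sum fun i _ => Finset.sum_le_sum fun j _ => ?_
    refine (le_abs_self _).trans ?_
    rw [abs_mul, abs_mul]
    have h3 : |(metricMatrix e y)⁻¹ i j| ≤ |C i j| := (hC i j y hy).trans (le_abs_self _)
    calc |b i| * (|(metricMatrix e y)⁻¹ i j| * |b j|) ≤ s * (|C i j| * s) := by
          gcongr
          · exact hbs i
          · exact hbs j
      _ = |C i j| * s ^ 2 := by ring
  calc ‖X‖ = Real.sqrt (‖X‖ ^ 2) := (Real.sqrt_sq (norm_nonneg _)).symm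
    _ ≤ Real.sqrt (D * s ^ 2) := Real.sqrt_le_sqrt h2
    _ = Real.sqrt D * s := by rw [Real.sqrt_mul hD0, Real.sqrt_sq hs0]

theorem exists_norm_coordVec_le {e : OpenPartialHomeomorph M (Model n)}
    (he : e ∈ atlas (Model n) M) {S : Set (Model n)} (hS : IsCompact S) (hSe : S ⊆ e.target)
    (w : Model n) : ∃ C : ℝ, ∀ y ∈ S, ‖coordVec e y w‖ ≤ C := by
  obtain ⟨C, hC⟩ := hS.exists_bound_of_continuousOn
    ((continuousOn_inner_coordVec he w w).mono hSe)
  refine ⟨Real.sqrt C, fun y hy => Real.le_sqrt_of_sq_le ?_⟩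
  rw [← real_inner_self_eq_norm_sq]
  exact (le_abs_self _).trans (hC y hy)

end ChartGeometry

end

/-! ### Lebesgue measure of a chart and the Riemannian volume. -/

noncomputable section

section ChartLebesgue

variable {n : ℕ} {M : Type*} [TopologicalSpace M] [MeasurableSpace M] [BorelSpace M]

/-- Lebesgue measure of a chart, transported to the manifold. -/
def chartLebesgue (e : OpenPartialHomeomorph M (Model n)) : Measure M :=
  ((volume : Measure (Model n)).comap (Subtype.val : e.target → Model n)).map
    fun y : e.target => e.symm y

/-- On the subtype `e.target` the inverse chart is a measurable embedding. Integrals, null sets and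
measurability can therefore be moved to the chart and back without measurability assumptions on the
function. -/
theorem measurableEmbedding_chart_symm (e : OpenPartialHomeomorph M (Model n)) :
    MeasurableEmbedding fun y : e.target => e.symm (y : Model n) := by
  have h : IsOpenEmbedding fun y : e.target => e.symm (y : Model n) :=
    e.symm.isOpenEmbedding_restrict
  exact h.measurableEmbedding

theorem measurableEmbedding_target (e : OpenPartialHomeomorph M (Model n)) :
    MeasurableEmbedding (Subtype.val : e.target → Model n) :=
  MeasurableEmbedding.subtype_coe e.open_target.measurableSet

theorem range_chart_symm (e : OpenPartialHomeomorph M (Model n)) :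
    (Set.range fun y : e.target => e.symm (y : Model n)) = e.source := by
  rw [← e.symm_image_target_eq_source]
  ext x; simp

theorem chartLebesgue_restrict_source (e : OpenPartialHomeomorph M (Model n)) :
    (chartLebesgue e).restrict e.source = chartLebesgue e := by
  rw [chartLebesgue, (measurableEmbedding_chart_symm e).restrict_map, ← range_chart_symm e]
  simp

theorem chartLebesgue_restrict (e : OpenPartialHomeomorph M (Model n)) (A : Set M) :
    (chartLebesgue e).restrict A = (((volume : Measure (Model n)).restrict (e.symm ⁻¹' A)).comap
      (Subtype.val : e.target → Model n)).map fun y : e.target => e.symm y := by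
  rw [chartLebesgue, (measurableEmbedding_chart_symm e).restrict_map,
    (measurableEmbedding_target e).comap_restrict]
  rfl

theorem map_val_comap_restrict (e : OpenPartialHomeomorph M (Model n)) (B : Set (Model n)) :
    (((volume : Measure (Model n)).restrict B).comap (Subtype.val : e.target → Model n)).map
      Subtype.val = (volume : Measure (Model n)).restrict (e.target ∩ B) := by
  rw [map_comap_subtype_coe e.open_target.measurableSet,
    Measure.restrict_restrict e.open_target.measurableSet]

theorem ae_chartLebesgue_restrict_iff (e : OpenPartialHomeomorph M (Model n)) (A : Set M)
    (P : M → Prop) : (∀ᵐ x ∂((chartLebesgue e).restrict A), P x) ↔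
      ∀ᵐ y ∂((volume : Measure (Model n)).restrict (e.target ∩ e.symm ⁻¹' A)), P (e.symm y) := by
  rw [chartLebesgue_restrict, (measurableEmbedding_chart_symm e).ae_map_iff,
    ← map_val_comap_restrict, (measurableEmbedding_target e).ae_map_iff]

theorem setLIntegral_chartLebesgue (e : OpenPartialHomeomorph M (Model n)) (A : Set M)
    (f : M → ℝ≥0∞) : ∫⁻ x in A, f x ∂(chartLebesgue e) =
      ∫⁻ y in e.target ∩ e.symm ⁻¹' A, f (e.symm y) := by
  rw [chartLebesgue_restrict, (measurableEmbedding_chart_symm e).lintegral_map,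
    ← map_val_comap_restrict, (measurableEmbedding_target e).lintegral_map]

theorem measurableSet_target_inter_preimage (e : OpenPartialHomeomorph M (Model n)) {A : Set M}
    (hA : MeasurableSet A) : MeasurableSet (e.target ∩ e.symm ⁻¹' A) := by
  have h := (measurableEmbedding_target e).measurableSet_image.2
    ((measurableEmbedding_chart_symm e).measurable hA)
  convert h using 1
  ext y; simp [and_comm]

theorem aestronglyMeasurable_chartLebesgue_restrict_iff (e : OpenPartialHomeomorph M (Model n))
    (A : Set M) (f : M → ℝ) : AEStronglyMeasurable f ((chartLebesgue e).restrict A) ↔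
      AEStronglyMeasurable (fun y => f (e.symm y))
        ((volume : Measure (Model n)).restrict (e.target ∩ e.symm ⁻¹' A)) := by
  rw [chartLebesgue_restrict, (measurableEmbedding_chart_symm e).aestronglyMeasurable_map_iff,
    ← map_val_comap_restrict, (measurableEmbedding_target e).aestronglyMeasurable_map_iff]
  rfl

theorem eLpNorm_chartLebesgue_restrict (e : OpenPartialHomeomorph M (Model n))
    (A : Set M) (f : M → ℝ) (p : ℝ≥0∞) : eLpNorm f p ((chartLebesgue e).restrict A) =
      eLpNorm (fun y => f (e.symm y)) p
        ((volume : Measure (Model n)).restrict (e.target ∩ e.symm ⁻¹' A)) := by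
  rw [chartLebesgue_restrict, (measurableEmbedding_chart_symm e).eLpNorm_map_measure,
    ← map_val_comap_restrict, (measurableEmbedding_target e).eLpNorm_map_measure]
  rfl

end ChartLebesgue

section RiemannianVolume

variable {n : ℕ} {M : Type*} [TopologicalSpace M] [MeasurableSpace M] [BorelSpace M]
  [ChartedSpace (Model n) M] [IsManifold 𝓘(ℝ, Model n) ∞ M]
  [RiemannianBundle (fun x : M => TangentSpace 𝓘(ℝ, Model n) x)]
  [IsContMDiffRiemannianBundle 𝓘(ℝ, Model n) ∞ (Model n)
      (fun x : M => TangentSpace 𝓘(ℝ, Model n) x)]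

/-- The density `√(det g_{ij})` of the Riemannian volume in a chart. -/
def chartDensity (e : OpenPartialHomeomorph M (Model n)) (y : Model n) : ℝ :=
  Real.sqrt (metricMatrix e y).det

theorem continuousOn_chartDensity {e : OpenPartialHomeomorph M (Model n)}
    (he : e ∈ atlas (Model n) M) : ContinuousOn (chartDensity e) e.target :=
  (continuousOn_det_metricMatrix he).sqrt

theorem chartDensity_pos {e : OpenPartialHomeomorph M (Model n)}
    (he : e ∈ atlas (Model n) M) {y : Model n} (hy : y ∈ e.target) : 0 < chartDensity e y :=
  Real.sqrt_pos.2 (metricMatrix_posDef he hy).det_pos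

theorem chartVolume_apply {e : OpenPartialHomeomorph M (Model n)} {A : Set M}
    (hA : MeasurableSet A) : chartVolume e A =
      ∫⁻ y in e.target ∩ e.symm ⁻¹' A, ENNReal.ofReal (chartDensity e y) := by
  have hm : AEMeasurable e.symm ((volume : Measure (Model n)).restrict e.target) :=
    e.continuousOn_symm.aemeasurable e.open_target.measurableSet
  have hm2 : AEMeasurable e.symm (((volume : Measure (Model n)).restrict e.target).withDensity
      fun y => ENNReal.ofReal (Real.sqrt (metricMatrix e y).det)) :=
    hm.mono_ac (withDensity_absolutelyContinuous _ _)
  rw [chartVolume, Measure.map_apply_of_aemeasurable hm2 hA, withDensity_apply' _ _,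
    Measure.restrict_restrict' e.open_target.measurableSet, Set.inter_comm]
  rfl

theorem chartVolume_eq_withDensity (e : OpenPartialHomeomorph M (Model n)) :
    chartVolume e = (chartLebesgue e).withDensity
      fun x => ENNReal.ofReal (chartDensity e (e x)) := by
  ext A hA
  rw [chartVolume_apply hA, withDensity_apply _ hA, setLIntegral_chartLebesgue]
  refine setLIntegral_congr_fun (measurableSet_target_inter_preimage e hA) fun y hy => ?_
  simp only [e.right_inv hy.1]

theorem chartVolume_restrict_source (e : OpenPartialHomeomorph M (Model n)) :
    (chartVolume e).restrict e.source = chartVolume e := by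
  rw [chartVolume_eq_withDensity, restrict_withDensity e.open_source.measurableSet,
    chartLebesgue_restrict_source]

/-- Every tangent space is the model space by definition, but the inner product depends on the base
point; this transports it along an equality of points such as `e'.symm (e' x) = x`. -/
theorem inner_tangentSpace_congr {x x' : M} (h : x = x') (v w : Model n) :
    (inner ℝ (show TangentSpace 𝓘(ℝ, Model n) x from v) (show TangentSpace 𝓘(ℝ, Model n) x from w)
      : ℝ) = inner ℝ (show TangentSpace 𝓘(ℝ, Model n) x' from v)
        (show TangentSpace 𝓘(ℝ, Model n) x' from w) := by
  subst h; rfl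

/-- Transformation of the volume density under a change of charts. -/
theorem chartDensity_transition {e e' : OpenPartialHomeomorph M (Model n)}
    (he : e ∈ atlas (Model n) M) (he' : e' ∈ atlas (Model n) M) {y : Model n}
    (hy : y ∈ e.target) (hy' : e.symm y ∈ e'.source) :
    ∃ J : Model n →L[ℝ] Model n, HasFDerivAt (fun z => e' (e.symm z)) J y ∧
      chartDensity e y = |J.det| * chartDensity e' (e' (e.symm y)) := by
  have hs := (mdifferentiable_of_mem_atlas (I := 𝓘(ℝ, Model n)) he).mdifferentiableAt_symm hy
  have ht := (mdifferentiable_of_mem_atlas (I := 𝓘(ℝ, Model n)) he').mdifferentiableAt hy'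
  have hts := (mdifferentiable_of_mem_atlas (I := 𝓘(ℝ, Model n)) he').mdifferentiableAt_symm
    (e'.map_source hy')
  have hτ : MDifferentiableAt 𝓘(ℝ, Model n) 𝓘(ℝ, Model n) (fun z => e' (e.symm z)) y :=
    ht.comp y hs
  set J : Model n →L[ℝ] Model n := fderiv ℝ (fun z => e' (e.symm z)) y with hJ
  refine ⟨J, hτ.differentiableAt.hasFDerivAt, ?_⟩
  -- Near y the inverse chart of e factors through e', so its coordinate vectors are those of e'
  -- applied to the Jacobian J of the transition map.
  have hev : e.symm =ᶠ[𝓝 y] fun z => e'.symm (e' (e.symm z)) := by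
    have h1 : ∀ᶠ z in 𝓝 y, e.symm z ∈ e'.source :=
      (e.continuousAt_symm hy).eventually (e'.open_source.mem_nhds hy')
    filter_upwards [h1] with z hz
    exact (e'.left_inv hz).symm
  have key : ∀ w : Model n, (show Model n from coordVec e y w) =
      coordVec e' (e' (e.symm y)) (J w) := fun w => by
    have h1 := hev.mfderiv_eq (I := 𝓘(ℝ, Model n)) (I' := 𝓘(ℝ, Model n))
    have h2 := mfderiv_comp y hts hτ
    have h3 : mfderiv 𝓘(ℝ, Model n) 𝓘(ℝ, Model n) (fun z => e' (e.symm z)) y = J :=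
      mfderiv_eq_fderiv
    have h4 := congrArg (fun L : Model n →L[ℝ] Model n => L w) (h1.trans h2)
    rw [h3] at h4
    exact h4
  set b := (EuclideanSpace.basisFun (Fin n) ℝ).toBasis with hb
  set A := LinearMap.toMatrix b b (J : Model n →ₗ[ℝ] Model n) with hA
  -- The Gram matrix transforms by congruence with the Jacobian matrix, so its determinant picks up
  -- (det J)² and the density |det J|.
  have hG : metricMatrix e y = A.transpose * metricMatrix e' (e' (e.symm y)) * A := by
    ext i j
    have h1 : metricMatrix e y i j = inner ℝ
        (coordVec e' (e' (e.symm y)) (J (EuclideanSpace.single i 1)))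
        (coordVec e' (e' (e.symm y)) (J (EuclideanSpace.single j 1))) := by
      rw [metricMatrix, Matrix.of_apply]
      have h2 := inner_tangentSpace_congr (e'.left_inv hy').symm
        (coordVec e y (EuclideanSpace.single i 1)) (coordVec e y (EuclideanSpace.single j 1))
      refine h2.trans ?_
      rw [key, key]
    rw [h1, inner_coordVec_coordVec, Matrix.mul_assoc, Matrix.mul_apply]
    simp only [dotProduct, Matrix.mulVec, Matrix.mul_apply, Matrix.transpose_apply, hA,
      LinearMap.toMatrix_apply]
    simp [hb]
  have hdet : A.det = J.det := LinearMap.det_toMatrix b _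
  rw [chartDensity, chartDensity, hG, Matrix.det_mul, Matrix.det_mul, Matrix.det_transpose, hdet,
    ← Real.sqrt_sq_eq_abs, ← Real.sqrt_mul (sq_nonneg _)]
  congr 1; ring

/-- Change of variables along the transition map; the Jacobian factor is exactly the one relating
the two densities. -/
theorem chartVolume_apply_eq {e e' : OpenPartialHomeomorph M (Model n)}
    (he : e ∈ atlas (Model n) M) (he' : e' ∈ atlas (Model n) M) {A : Set M}
    (hA : MeasurableSet A) (hAe : A ⊆ e.source) (hAe' : A ⊆ e'.source) :
    chartVolume e A = chartVolume e' A := by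
  rw [chartVolume_apply hA, chartVolume_apply hA]
  set s := e.target ∩ e.symm ⁻¹' A with hs
  have hex : ∀ y ∈ s, ∃ J : Model n →L[ℝ] Model n, HasFDerivAt (fun z => e' (e.symm z)) J y ∧
      chartDensity e y = |J.det| * chartDensity e' (e' (e.symm y)) := fun y hy =>
    chartDensity_transition he he' hy.1 (hAe' hy.2)
  choose! J hJ hd using hex
  have himg : (fun z => e' (e.symm z)) '' s = e'.target ∩ e'.symm ⁻¹' A := by
    ext z
    constructor
    · rintro ⟨y, hy, rfl⟩
      refine ⟨e'.map_source (hAe' hy.2), ?_⟩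
      simp only [Set.mem_preimage, e'.left_inv (hAe' hy.2)]
      exact hy.2
    · rintro ⟨hz, hzA⟩
      refine ⟨e (e'.symm z), ⟨e.map_source (hAe hzA), ?_⟩, ?_⟩
      · simp only [Set.mem_preimage, e.left_inv (hAe hzA)]
        exact hzA
      · simp only [e.left_inv (hAe hzA), e'.right_inv hz]
  have hinj : Set.InjOn (fun z => e' (e.symm z)) s := fun y hy z hz h =>
    e.symm.injOn hy.1 hz.1 (e'.injOn (hAe' hy.2) (hAe' hz.2) h)
  have hsm : MeasurableSet s := measurableSet_target_inter_preimage e hA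
  rw [← himg, lintegral_image_eq_lintegral_abs_det_fderiv_mul volume hsm
    (fun y hy => (hJ y hy).hasFDerivWithinAt) hinj]
  refine setLIntegral_congr_fun hsm fun y hy => ?_
  simp only [hd y hy, ENNReal.ofReal_mul (abs_nonneg _)]

/-- On a chart domain, the Riemannian volume is the volume of that chart. -/
theorem riemannianVolume_restrict_source {e : OpenPartialHomeomorph M (Model n)}
    (he : e ∈ atlas (Model n) M) :
    (riemannianVolume n M).restrict e.source = chartVolume e := by
  have hm := e.open_source.measurableSet
  apply le_antisymm
  · have h1 : riemannianVolume n M ≤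
        chartVolume e + (riemannianVolume n M).restrict e.sourceᶜ := by
      refine iSup₂_le fun e' he' => ?_
      rw [← Measure.restrict_add_restrict_compl (μ := chartVolume e') hm]
      refine add_le_add ?_ (Measure.restrict_mono le_rfl (le_iSup₂_of_le e' he' le_rfl))
      refine Measure.le_iff.2 fun A hA => ?_
      rw [← chartVolume_restrict_source e', Measure.restrict_apply hA,
        Measure.restrict_apply (hA.inter hm)]
      rw [chartVolume_apply_eq he' he ((hA.inter hm).inter e'.open_source.measurableSet)
        Set.inter_subset_right (Set.inter_subset_left.trans Set.inter_subset_right)]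
      exact measure_mono (Set.inter_subset_left.trans Set.inter_subset_left)
    refine (Measure.restrict_mono (s := e.source) le_rfl h1).trans ?_
    rw [Measure.restrict_add, Measure.restrict_restrict hm, Set.inter_compl_self,
      Measure.restrict_empty, add_zero]
    exact Measure.restrict_le_self
  · rw [← chartVolume_restrict_source e]
    exact Measure.restrict_mono le_rfl (le_iSup₂_of_le e he le_rfl)

variable {φ : M → ℝ}

theorem measurable_weight (hφ : Continuous φ) :
    Measurable fun x => ENNReal.ofReal (Real.exp (-φ x)) := by
  have : Continuous fun x => Real.exp (-φ x) := by fun_prop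
  exact this.measurable.ennreal_ofReal

theorem weightedVolume_restrict_source (hφ : Continuous φ) {e : OpenPartialHomeomorph M (Model n)}
    (he : e ∈ atlas (Model n) M) : (weightedVolume n φ).restrict e.source =
      (chartLebesgue e).withDensity
        fun x => ENNReal.ofReal (Real.exp (-φ x) * chartDensity e (e x)) := by
  have h0 : AEMeasurable (fun x => ENNReal.ofReal (chartDensity e (e x))) (chartLebesgue e) := by
    have h1 : ContinuousOn (fun x => chartDensity e (e x)) e.source :=
      (continuousOn_chartDensity he).comp e.continuousOn fun x hx => e.map_source hx
    rw [← chartLebesgue_restrict_source e]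
    exact (h1.aemeasurable e.open_source.measurableSet).ennreal_ofReal
  rw [weightedVolume, restrict_withDensity e.open_source.measurableSet,
    riemannianVolume_restrict_source he, chartVolume_eq_withDensity,
    ← withDensity_mul₀ h0 (measurable_weight hφ).aemeasurable]
  congr 1
  ext x
  simp only [Pi.mul_apply]
  rw [ENNReal.ofReal_mul (Real.exp_pos _).le, mul_comm]

end RiemannianVolume

end

/-! ### Comparison of the weighted volume with Lebesgue measure in charts. -/

noncomputable section

section WeightedVolume

variable {n : ℕ} {M : Type*} [TopologicalSpace M] [MeasurableSpace M] [BorelSpace M]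
  [ChartedSpace (Model n) M] [IsManifold 𝓘(ℝ, Model n) ∞ M]
  [RiemannianBundle (fun x : M => TangentSpace 𝓘(ℝ, Model n) x)]
  [IsContMDiffRiemannianBundle 𝓘(ℝ, Model n) ∞ (Model n)
      (fun x : M => TangentSpace 𝓘(ℝ, Model n) x)]
  {φ : M → ℝ}

theorem continuousOn_weightedDensity (hφ : Continuous φ) {e : OpenPartialHomeomorph M (Model n)}
    (he : e ∈ atlas (Model n) M) :
    ContinuousOn (fun x => Real.exp (-φ x) * chartDensity e (e x)) e.source :=
  (Real.continuous_exp.comp hφ.neg).continuousOn.mul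
    ((continuousOn_chartDensity he).comp e.continuousOn fun _ hx => e.map_source hx)

theorem weightedDensity_pos {e : OpenPartialHomeomorph M (Model n)}
    (he : e ∈ atlas (Model n) M) {x : M} (hx : x ∈ e.source) :
    0 < Real.exp (-φ x) * chartDensity e (e x) :=
  mul_pos (Real.exp_pos _) (chartDensity_pos he (e.map_source hx))

/-- On compact subsets of a chart, the weighted volume and the Lebesgue measure of the chart are
comparable. -/
theorem exists_weightedVolume_comparison [T2Space M] (hφ : Continuous φ)
    {e : OpenPartialHomeomorph M (Model n)} (he : e ∈ atlas (Model n) M) {T : Set M}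
    (hT : IsCompact T) (hTe : T ⊆ e.source) :
    ∃ C : ℝ≥0∞, C ≠ ⊤ ∧ (weightedVolume n φ).restrict T ≤ C • (chartLebesgue e).restrict T ∧
      (chartLebesgue e).restrict T ≤ C • (weightedVolume n φ).restrict T := by
  have hc := (continuousOn_weightedDensity hφ he).mono hTe
  have hTm := hT.measurableSet
  obtain ⟨A, hA⟩ := hT.exists_bound_of_continuousOn hc
  obtain ⟨B, hB⟩ := hT.exists_bound_of_continuousOn
    (hc.inv₀ fun x hx => (weightedDensity_pos (φ := φ) he (hTe hx)).ne')
  have hm : (weightedVolume n φ).restrict T = ((chartLebesgue e).restrict T).withDensity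
      fun x => ENNReal.ofReal (Real.exp (-φ x) * chartDensity e (e x)) := by
    rw [← restrict_withDensity hTm, ← weightedVolume_restrict_source hφ he,
      Measure.restrict_restrict_of_subset hTe]
  have hle : (weightedVolume n φ).restrict T ≤
      ENNReal.ofReal A • (chartLebesgue e).restrict T := by
    rw [hm, ← withDensity_const]
    refine withDensity_mono ((ae_restrict_iff' hTm).2 (Eventually.of_forall fun x hx => ?_))
    exact ENNReal.ofReal_le_ofReal ((le_abs_self _).trans (hA x hx))
  have hge : (chartLebesgue e).restrict T ≤
      ENNReal.ofReal B • (weightedVolume n φ).restrict T := by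
    rw [hm, ← withDensity_smul' _ _ ENNReal.ofReal_ne_top]
    nth_rewrite 1 [← withDensity_one (μ := (chartLebesgue e).restrict T)]
    refine withDensity_mono ((ae_restrict_iff' hTm).2 (Eventually.of_forall fun x hx => ?_))
    have hp := weightedDensity_pos (φ := φ) he (hTe hx)
    have h2 := (le_abs_self _).trans (hB x hx)
    have hB0 : 0 ≤ B := (norm_nonneg _).trans (hB x hx)
    simp only [Pi.one_apply, Pi.smul_apply, smul_eq_mul]
    rw [← ENNReal.ofReal_mul hB0, ← ENNReal.ofReal_one]
    refine ENNReal.ofReal_le_ofReal ?_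
    rw [Pi.inv_apply] at h2
    calc (1 : ℝ) = (Real.exp (-φ x) * chartDensity e (e x))⁻¹ *
          (Real.exp (-φ x) * chartDensity e (e x)) := (inv_mul_cancel₀ hp.ne').symm
      _ ≤ _ := mul_le_mul_of_nonneg_right h2 hp.le
  refine ⟨max (ENNReal.ofReal A) (ENNReal.ofReal B), by simp, hle.trans ?_, hge.trans ?_⟩
  · exact Measure.le_iff'.2 fun s => by
      simp only [Measure.smul_apply, smul_eq_mul]; gcongr; exact le_max_left _ _
  · exact Measure.le_iff'.2 fun s => by
      simp only [Measure.smul_apply, smul_eq_mul]; gcongr; exact le_max_right _ _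

theorem weightedVolume_restrict_ac_chartLebesgue (hφ : Continuous φ)
    {e : OpenPartialHomeomorph M (Model n)} (he : e ∈ atlas (Model n) M) :
    (weightedVolume n φ).restrict e.source ≪ chartLebesgue e := by
  rw [weightedVolume_restrict_source hφ he]
  exact withDensity_absolutelyContinuous _ _

theorem chartLebesgue_ac_weightedVolume_restrict (hφ : Continuous φ)
    {e : OpenPartialHomeomorph M (Model n)} (he : e ∈ atlas (Model n) M) :
    chartLebesgue e ≪ (weightedVolume n φ).restrict e.source := by
  rw [weightedVolume_restrict_source hφ he]
  have hm := e.open_source.measurableSet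
  refine withDensity_absolutelyContinuous' ?_ ?_
  · rw [← chartLebesgue_restrict_source e]
    exact ((continuousOn_weightedDensity hφ he).aemeasurable hm).ennreal_ofReal
  · rw [← chartLebesgue_restrict_source e]
    refine (ae_restrict_iff' hm).2 (Eventually.of_forall fun x hx => ?_)
    exact (ENNReal.ofReal_pos.2 (weightedDensity_pos he hx)).ne'

theorem ac_weightedVolume (hφ : Continuous φ) : riemannianVolume n M ≪ weightedVolume n φ :=
  withDensity_absolutelyContinuous' (measurable_weight hφ).aemeasurable
    (Eventually.of_forall fun _ => (ENNReal.ofReal_pos.2 (Real.exp_pos _)).ne')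

/-- Almost everywhere statements for the weighted volume, read in a chart. -/
theorem ae_chart_of_ae (hφ : Continuous φ) {Ω : Set M} (hΩ : MeasurableSet Ω)
    {e : OpenPartialHomeomorph M (Model n)} (he : e ∈ atlas (Model n) M) {P : M → Prop}
    (h : ∀ᵐ x ∂((weightedVolume n φ).restrict Ω), P x) :
    ∀ᵐ y ∂((volume : Measure (Model n)).restrict (e.target ∩ e.symm ⁻¹' Ω)), P (e.symm y) := by
  rw [← ae_chartLebesgue_restrict_iff, ae_restrict_iff' hΩ]
  rw [ae_restrict_iff' hΩ] at h
  exact (chartLebesgue_ac_weightedVolume_restrict hφ he).ae_le (ae_restrict_of_ae h)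

variable [SecondCountableTopology M]

/-- Second countability allows null sets and measurability to be checked chart by chart, over
countably many charts. -/
theorem exists_countable_chart_cover (n : ℕ) (M : Type*) [TopologicalSpace M]
    [ChartedSpace (Model n) M] [SecondCountableTopology M] :
    ∃ s : Set M, s.Countable ∧ ⋃ x ∈ s, (chartAt (Model n) x).source = Set.univ :=
  TopologicalSpace.countable_cover_nhds fun x => chart_source_mem_nhds (Model n) x

theorem ae_of_ae_chart (hφ : Continuous φ) {Ω : Set M} (hΩ : MeasurableSet Ω) {P : M → Prop}
    (h : ∀ e ∈ atlas (Model n) M, ∀ᵐ y ∂((volume : Measure (Model n)).restrict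
      (e.target ∩ e.symm ⁻¹' Ω)), P (e.symm y)) :
    ∀ᵐ x ∂((weightedVolume n φ).restrict Ω), P x := by
  obtain ⟨s, hs, hcov⟩ := exists_countable_chart_cover n M
  rw [← Measure.restrict_univ (μ := (weightedVolume n φ).restrict Ω), ← hcov,
    ae_restrict_biUnion_iff _ hs]
  intro x _
  have he := chart_mem_atlas (Model n) x
  have h1 := h _ he
  rw [← ae_chartLebesgue_restrict_iff] at h1
  rw [Measure.restrict_restrict (chartAt (Model n) x).open_source.measurableSet, Set.inter_comm,
    ← Measure.restrict_restrict hΩ]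
  exact ((weightedVolume_restrict_ac_chartLebesgue hφ he).restrict Ω).ae_le h1

theorem aestronglyMeasurable_of_chart (hφ : Continuous φ) {Ω : Set M} (hΩ : MeasurableSet Ω)
    {f : M → ℝ} (h : ∀ e ∈ atlas (Model n) M, AEStronglyMeasurable (fun y => f (e.symm y))
      ((volume : Measure (Model n)).restrict (e.target ∩ e.symm ⁻¹' Ω))) :
    AEStronglyMeasurable f ((weightedVolume n φ).restrict Ω) := by
  obtain ⟨s, hs, hcov⟩ := exists_countable_chart_cover n M
  have := hs.to_subtype
  rw [← Measure.restrict_univ (μ := (weightedVolume n φ).restrict Ω), ← hcov,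
    Set.biUnion_eq_iUnion, aestronglyMeasurable_iUnion_iff]
  intro x
  have he := chart_mem_atlas (Model n) (x : M)
  have h1 := h _ he
  rw [← aestronglyMeasurable_chartLebesgue_restrict_iff] at h1
  rw [Measure.restrict_restrict (chartAt (Model n) (x : M)).open_source.measurableSet,
    Set.inter_comm, ← Measure.restrict_restrict hΩ]
  exact h1.mono_ac ((weightedVolume_restrict_ac_chartLebesgue hφ he).restrict Ω)

end WeightedVolume

end

/-! ### Smooth truncations near zero. -/

noncomputable section

section Truncation

/-- A smooth odd function vanishing near `0` and equal to the identity near infinity. -/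
def smoothTrunc (s : ℝ) : ℝ := s * Real.smoothTransition (s ^ 2 - 1)

theorem contDiff_smoothTrunc : ContDiff ℝ 1 smoothTrunc :=
  contDiff_id.mul (Real.smoothTransition.contDiff.comp ((contDiff_id.pow 2).sub contDiff_const))

theorem smoothTrunc_eq_zero {s : ℝ} (hs : |s| ≤ 1) : smoothTrunc s = 0 := by
  rw [smoothTrunc, Real.smoothTransition.zero_of_nonpos, mul_zero]
  have := (sq_le_one_iff_abs_le_one s).2 hs
  linarith

theorem smoothTrunc_eq_self {s : ℝ} (hs : 2 ≤ |s|) : smoothTrunc s = s := by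
  rw [smoothTrunc, Real.smoothTransition.one_of_one_le, mul_one]
  have : (2 : ℝ) ^ 2 ≤ |s| ^ 2 := pow_le_pow_left₀ (by norm_num) hs 2
  rw [sq_abs] at this
  linarith

theorem abs_smoothTrunc_le (s : ℝ) : |smoothTrunc s| ≤ |s| := by
  rw [smoothTrunc, abs_mul, abs_of_nonneg (Real.smoothTransition.nonneg _)]
  exact mul_le_of_le_one_right (abs_nonneg _) (Real.smoothTransition.le_one _)

theorem deriv_smoothTrunc_eq_zero {s : ℝ} (hs : |s| < 1) : deriv smoothTrunc s = 0 := by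
  have h : smoothTrunc =ᶠ[𝓝 s] fun _ => 0 := by
    filter_upwards [(continuous_abs.tendsto s).eventually (gt_mem_nhds hs)] with t ht
    exact smoothTrunc_eq_zero ht.le
  rw [h.deriv_eq, deriv_const]

theorem deriv_smoothTrunc_eq_one {s : ℝ} (hs : 2 < |s|) : deriv smoothTrunc s = 1 := by
  have h : smoothTrunc =ᶠ[𝓝 s] id := by
    filter_upwards [(continuous_abs.tendsto s).eventually (lt_mem_nhds hs)] with t ht
    exact smoothTrunc_eq_self ht.le
  rw [h.deriv_eq, deriv_id]

theorem exists_abs_deriv_smoothTrunc_le : ∃ C : ℝ, ∀ s, |deriv smoothTrunc s| ≤ C := by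
  obtain ⟨C, hC⟩ := (isCompact_Icc (a := (-2 : ℝ)) (b := 2)).exists_bound_of_continuousOn
    (contDiff_smoothTrunc.continuous_deriv le_rfl).continuousOn
  refine ⟨max C 1, fun s => ?_⟩
  by_cases hs : |s| ≤ 2
  · exact (hC s (abs_le.1 hs)).trans (le_max_left _ _)
  · rw [deriv_smoothTrunc_eq_one (not_le.1 hs)]
    simp

/-- The rescaled truncations, vanishing for `|s| ≤ 1 / (k + 1)`. -/
def truncSeq (k : ℕ) (s : ℝ) : ℝ := smoothTrunc (((k : ℝ) + 1) * s) / ((k : ℝ) + 1)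

theorem contDiff_truncSeq (k : ℕ) : ContDiff ℝ 1 (truncSeq k) :=
  (contDiff_smoothTrunc.comp (contDiff_const.mul contDiff_id)).div_const _

/-- The rescaling leaves the range of the derivative unchanged, so the bound on the derivative is
uniform in k. -/
theorem deriv_truncSeq (k : ℕ) (s : ℝ) :
    deriv (truncSeq k) s = deriv smoothTrunc (((k : ℝ) + 1) * s) := by
  have hk : (k : ℝ) + 1 ≠ 0 := by positivity
  have h1 : HasDerivAt (fun s : ℝ => ((k : ℝ) + 1) * s) ((k : ℝ) + 1) s := by
    simpa using (hasDerivAt_id s).const_mul ((k : ℝ) + 1)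
  have h2 := (((contDiff_smoothTrunc.differentiable (by simp)) (((k : ℝ) + 1) * s)).hasDerivAt.comp
    s h1).div_const ((k : ℝ) + 1)
  rw [mul_div_cancel_right₀ _ hk] at h2
  exact h2.deriv

theorem abs_truncSeq_le (k : ℕ) (s : ℝ) : |truncSeq k s| ≤ |s| := by
  have hk : (0 : ℝ) < (k : ℝ) + 1 := by positivity
  rw [truncSeq, abs_div, abs_of_pos hk, div_le_iff₀ hk]
  refine (abs_smoothTrunc_le _).trans (le_of_eq ?_)
  rw [abs_mul, abs_of_pos hk, mul_comm]

theorem truncSeq_eq_zero {k : ℕ} {s : ℝ} (hs : |s| < 1 / ((k : ℝ) + 1)) :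
    truncSeq k s = 0 ∧ deriv (truncSeq k) s = 0 := by
  have hk : (0 : ℝ) < (k : ℝ) + 1 := by positivity
  have h : |((k : ℝ) + 1) * s| < 1 := by
    rw [abs_mul, abs_of_pos hk]
    rwa [lt_div_iff₀ hk, mul_comm] at hs
  rw [truncSeq, deriv_truncSeq, smoothTrunc_eq_zero h.le, deriv_smoothTrunc_eq_zero h, zero_div]
  exact ⟨rfl, rfl⟩

/-- The truncations recover the identity, but their derivatives tend to 0 at s = 0. This mismatch at
0 is what makes a weak gradient vanish on the zero set. -/
theorem tendsto_truncSeq (s : ℝ) : Tendsto (fun k => truncSeq k s) atTop (𝓝 s) ∧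
    Tendsto (fun k => deriv (truncSeq k) s) atTop (𝓝 (if s = 0 then 0 else 1)) := by
  by_cases hs : s = 0
  · subst hs
    have h : ∀ k : ℕ, truncSeq k 0 = 0 ∧ deriv (truncSeq k) 0 = 0 := fun k =>
      truncSeq_eq_zero (by rw [abs_zero]; positivity)
    simp [h]
  · have h1 : Tendsto (fun k : ℕ => ((k : ℝ) + 1) * |s|) atTop atTop :=
      (tendsto_atTop_add_const_right _ _ tendsto_natCast_atTop_atTop).atTop_mul_const
        (abs_pos.2 hs)
    have h2 : ∀ᶠ k : ℕ in atTop, 2 < |((k : ℝ) + 1) * s| := by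
      filter_upwards [h1.eventually_gt_atTop 2] with k hk
      rwa [abs_mul, abs_of_pos (by positivity : (0 : ℝ) < (k : ℝ) + 1)]
    rw [if_neg hs]
    refine ⟨tendsto_const_nhds.congr' ?_, tendsto_const_nhds.congr' ?_⟩
    · filter_upwards [h2] with k hk
      have : (k : ℝ) + 1 ≠ 0 := by positivity
      rw [truncSeq, smoothTrunc_eq_self hk.le, mul_div_cancel_left₀ _ this]
    · filter_upwards [h2] with k hk
      rw [deriv_truncSeq, deriv_smoothTrunc_eq_one hk]

end Truncation

section ChartSmooth

variable {n : ℕ} {M : Type*} [TopologicalSpace M]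
  [ChartedSpace (Model n) M] [IsManifold 𝓘(ℝ, Model n) ∞ M]

theorem contDiffOn_comp_chart_symm {e : OpenPartialHomeomorph M (Model n)}
    (he : e ∈ atlas (Model n) M) {f : M → ℝ} (hf : ContMDiff 𝓘(ℝ, Model n) 𝓘(ℝ, ℝ) ∞ f) :
    ContDiffOn ℝ ∞ (fun y => f (e.symm y)) e.target :=
  contMDiffOn_iff_contDiffOn.1 (hf.comp_contMDiffOn (contMDiffOn_symm_of_mem_maximalAtlas
    (IsManifold.subset_maximalAtlas he)))

end ChartSmooth

/-! ### Weak gradients on the manifold: measurability and uniqueness. -/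

section WeakGradient

variable {n : ℕ} {M : Type*} [TopologicalSpace M] [MeasurableSpace M] [BorelSpace M]
  [ChartedSpace (Model n) M] [IsManifold 𝓘(ℝ, Model n) ∞ M]
  [RiemannianBundle (fun x : M => TangentSpace 𝓘(ℝ, Model n) x)]
  [IsContMDiffRiemannianBundle 𝓘(ℝ, Model n) ∞ (Model n)
      (fun x : M => TangentSpace 𝓘(ℝ, Model n) x)]
  {φ : M → ℝ}

theorem isWeakGradient_iff {Ω : Set M} {f : M → ℝ}
    {X : (x : M) → TangentSpace 𝓘(ℝ, Model n) x} : IsWeakGradient Ω f X ↔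
      ∀ e ∈ atlas (Model n) M, ∀ w : Model n, HasWeakDerivOn (e.target ∩ e.symm ⁻¹' Ω)
        (fun y => f (e.symm y)) w (fun y => inner ℝ (X (e.symm y)) (coordVec e y w)) :=
  ⟨fun h e he w => ⟨h.1 e he, h.2 e he w, h.3 e he w⟩,
    fun h => ⟨fun e he => (h e he 0).1, fun e he w => (h e he w).2,
      fun e he w => (h e he w).3⟩⟩

theorem isOpen_chart_preimage {Ω : Set M} (hΩ : IsOpen Ω)
    (e : OpenPartialHomeomorph M (Model n)) : IsOpen (e.target ∩ e.symm ⁻¹' Ω) :=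
  e.symm.isOpen_inter_preimage hΩ

theorem IsWeakGradient.comp_contDiff {Ω : Set M} (hΩ : IsOpen Ω) {f : M → ℝ}
    {X : (x : M) → TangentSpace 𝓘(ℝ, Model n) x} (h : IsWeakGradient Ω f X) {G : ℝ → ℝ}
    (hG : ContDiff ℝ 1 G) {C : ℝ} (hC : ∀ s, |deriv G s| ≤ C) :
    IsWeakGradient Ω (fun x => G (f x)) (fun x => deriv G (f x) • X x) := by
  rw [isWeakGradient_iff] at h ⊢
  intro e he w
  have h1 := (h e he w).comp_contDiff (isOpen_chart_preimage hΩ e) hG hC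
  simpa only [real_inner_smul_left] using h1

/-- A vector field whose components in charts are measurable. -/
def IsAEMeasurableField (Ω : Set M) (X : (x : M) → TangentSpace 𝓘(ℝ, Model n) x) : Prop :=
  ∀ e ∈ atlas (Model n) M, ∀ w : Model n,
    AEStronglyMeasurable (fun y => inner ℝ (X (e.symm y)) (coordVec e y w))
      ((volume : Measure (Model n)).restrict (e.target ∩ e.symm ⁻¹' Ω))

theorem IsWeakGradient.isAEMeasurableField {Ω : Set M} {f : M → ℝ}
    {X : (x : M) → TangentSpace 𝓘(ℝ, Model n) x} (h : IsWeakGradient Ω f X) :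
    IsAEMeasurableField Ω X := fun e he w =>
  (h.2 e he w).aestronglyMeasurable

theorem IsAEMeasurableField.sub {Ω : Set M} {X Y : (x : M) → TangentSpace 𝓘(ℝ, Model n) x}
    (hX : IsAEMeasurableField Ω X) (hY : IsAEMeasurableField Ω Y) :
    IsAEMeasurableField Ω (fun x => X x - Y x) := fun e he w => by
  simpa only [inner_sub_left] using! (hX e he w).sub (hY e he w)

theorem inner_riemannianGradient_coordVec {e : OpenPartialHomeomorph M (Model n)}
    (he : e ∈ atlas (Model n) M) {f : M → ℝ} {y : Model n} (hy : y ∈ e.target)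
    (hf : MDifferentiableAt 𝓘(ℝ, Model n) 𝓘(ℝ, ℝ) f (e.symm y)) (w : Model n) :
    inner ℝ (riemannianGradient f (e.symm y)) (coordVec e y w) =
      fderiv ℝ (fun z => f (e.symm z)) y w := by
  rw [inner_riemannianGradient]
  have hs := (mdifferentiable_of_mem_atlas (I := 𝓘(ℝ, Model n)) he).mdifferentiableAt_symm hy
  have h1 := mfderiv_comp y hf hs
  have h2 : mfderiv 𝓘(ℝ, Model n) 𝓘(ℝ, ℝ) (fun z => f (e.symm z)) y =
      fderiv ℝ (fun z => f (e.symm z)) y := mfderiv_eq_fderiv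
  rw [← h2]
  exact (congrArg (fun L : Model n →L[ℝ] ℝ => L w) h1).symm

theorem isAEMeasurableField_riemannianGradient {Ω : Set M} (hΩ : MeasurableSet Ω) {f : M → ℝ}
    (hf : ContMDiff 𝓘(ℝ, Model n) 𝓘(ℝ, ℝ) ∞ f) :
    IsAEMeasurableField (n := n) Ω (riemannianGradient f) := fun e he w => by
  have hm := measurableSet_target_inter_preimage e hΩ
  have h1 : ContinuousOn (fun y => fderiv ℝ (fun z => f (e.symm z)) y w) e.target :=
    ((contDiffOn_comp_chart_symm he hf).continuousOn_fderiv_of_isOpen e.open_target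
      (by simp)).clm_apply continuousOn_const
  refine AEStronglyMeasurable.congr
    ((h1.mono Set.inter_subset_left).aestronglyMeasurable hm) ?_
  refine (ae_restrict_iff' hm).2 (Eventually.of_forall fun y hy => ?_)
  exact (inner_riemannianGradient_coordVec he hy.1 (hf.mdifferentiable (by simp) _) w).symm

/-- In a chart the inner product is a sum of products of covariant components with continuous
entries of the inverse Gram matrix. -/
theorem IsAEMeasurableField.aestronglyMeasurable_inner [SecondCountableTopology M]
    (hφ : Continuous φ) {Ω : Set M} (hΩ : MeasurableSet Ω)
    {X Y : (x : M) → TangentSpace 𝓘(ℝ, Model n) x}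
    (hX : IsAEMeasurableField Ω X) (hY : IsAEMeasurableField Ω Y) :
    AEStronglyMeasurable (fun x => (inner ℝ (X x) (Y x) : ℝ))
      ((weightedVolume n φ).restrict Ω) := by
  refine aestronglyMeasurable_of_chart hφ hΩ fun e he => ?_
  have hm := measurableSet_target_inter_preimage e hΩ
  have h1 : AEStronglyMeasurable (fun y => ∑ i, ∑ j, inner ℝ (X (e.symm y)) (coordField e i y) *
      ((metricMatrix e y)⁻¹ i j * inner ℝ (Y (e.symm y)) (coordField e j y)))
      ((volume : Measure (Model n)).restrict (e.target ∩ e.symm ⁻¹' Ω)) := by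
    refine Finset.aestronglyMeasurable_fun_sum _ fun i _ =>
      Finset.aestronglyMeasurable_fun_sum _ fun j _ => (hX e he _).mul (AEStronglyMeasurable.mul ?_ (hY e he _))
    exact ((continuousOn_pi.1 (continuousOn_pi.1 (continuousOn_inv_metricMatrix he) i) j).mono
      Set.inter_subset_left).aestronglyMeasurable hm
  refine h1.congr ((ae_restrict_iff' hm).2 (Eventually.of_forall fun y hy => ?_))
  have h2 := inner_eq_dotProduct_inv he hy.1 (X (e.symm y)) (Y (e.symm y))
  simp only [dotProduct, Matrix.mulVec, Finset.mul_sum] at h2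
  exact h2.symm

theorem IsAEMeasurableField.aestronglyMeasurable_norm [SecondCountableTopology M]
    (hφ : Continuous φ) {Ω : Set M} (hΩ : MeasurableSet Ω)
    {X : (x : M) → TangentSpace 𝓘(ℝ, Model n) x} (hX : IsAEMeasurableField Ω X) :
    AEStronglyMeasurable (fun x => ‖X x‖) ((weightedVolume n φ).restrict Ω) := by
  simp only [norm_eq_sqrt_real_inner]
  exact Real.continuous_sqrt.comp_aestronglyMeasurable
    (hX.aestronglyMeasurable_inner hφ hΩ hX)

/-- Weak gradients are unique almost everywhere. -/
theorem IsWeakGradient.ae_eq [SecondCountableTopology M] (hφ : Continuous φ) {Ω : Set M}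
    (hΩ : IsOpen Ω) {f : M → ℝ} {X Y : (x : M) → TangentSpace 𝓘(ℝ, Model n) x}
    (hX : IsWeakGradient Ω f X) (hY : IsWeakGradient Ω f Y) :
    ∀ᵐ x ∂((weightedVolume n φ).restrict Ω), X x = Y x := by
  refine ae_of_ae_chart hφ hΩ.measurableSet fun e he => ?_
  have hm := measurableSet_target_inter_preimage e hΩ.measurableSet
  rw [ae_restrict_iff' hm]
  have h1 : ∀ᵐ y ∂(volume : Measure (Model n)), ∀ i, y ∈ e.target ∩ e.symm ⁻¹' Ω →
      (inner ℝ (X (e.symm y)) (coordField e i y) : ℝ) =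
        inner ℝ (Y (e.symm y)) (coordField e i y) :=
    ae_all_iff.2 fun i => (isWeakGradient_iff.1 hX e he _).ae_eq (isOpen_chart_preimage hΩ e)
      (isWeakGradient_iff.1 hY e he _)
  filter_upwards [h1] with y hy hyO
  rw [← sub_eq_zero, ← inner_self_eq_zero (𝕜 := ℝ), inner_eq_dotProduct_inv he hyO.1]
  have h2 : (fun i => (inner ℝ (X (e.symm y) - Y (e.symm y)) (coordField e i y) : ℝ)) = 0 := by
    ext i
    rw [inner_sub_left, hy i hyO, sub_self, Pi.zero_apply]
  rw [h2, zero_dotProduct]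

end WeakGradient

end

/-! ### Transfer of functions and norms between a chart and the manifold. -/

noncomputable section

section ChartTransfer

variable {n : ℕ} {M : Type*} [TopologicalSpace M]
  [ChartedSpace (Model n) M] [IsManifold 𝓘(ℝ, Model n) ∞ M]

/-- A function on `M` supported in the chart `e`, read in the chart and extended by zero. -/
def chartPull (e : OpenPartialHomeomorph M (Model n)) (f : M → ℝ) : Model n → ℝ :=
  e.target.indicator fun y => f (e.symm y)

/-- A function on the model space supported in the chart `e`, seen on `M` and extended by zero. -/
def chartPush (e : OpenPartialHomeomorph M (Model n)) (η : Model n → ℝ) : M → ℝ :=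
  e.source.indicator fun x => η (e x)

theorem isCompact_chart_image {e : OpenPartialHomeomorph M (Model n)} {T : Set M}
    (hT : IsCompact T) (hTe : T ⊆ e.source) : IsCompact (e '' T) :=
  hT.image_of_continuousOn (e.continuousOn.mono hTe)

theorem isCompact_chart_symm_image {e : OpenPartialHomeomorph M (Model n)} {K : Set (Model n)}
    (hK : IsCompact K) (hKe : K ⊆ e.target) : IsCompact (e.symm '' K) :=
  hK.image_of_continuousOn (e.continuousOn_symm.mono hKe)

theorem target_inter_preimage_image_symm {e : OpenPartialHomeomorph M (Model n)}
    {K : Set (Model n)} (hKe : K ⊆ e.target) : e.target ∩ e.symm ⁻¹' (e.symm '' K) = K := by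
  ext y
  constructor
  · rintro ⟨hy, z, hz, hzy⟩
    rwa [← e.symm.injOn (hKe hz) hy hzy]
  · exact fun hy => ⟨hKe hy, y, hy, rfl⟩

theorem image_subset_target_inter_preimage {e : OpenPartialHomeomorph M (Model n)} {Ω T : Set M}
    (hT : T ⊆ e.source ∩ Ω) : e '' T ⊆ e.target ∩ e.symm ⁻¹' Ω := by
  rintro _ ⟨x, hx, rfl⟩
  refine ⟨e.map_source (hT hx).1, ?_⟩
  rw [Set.mem_preimage, e.left_inv (hT hx).1]
  exact (hT hx).2

theorem chartPull_apply {e : OpenPartialHomeomorph M (Model n)} (f : M → ℝ) {y : Model n}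
    (hy : y ∈ e.target) : chartPull e f y = f (e.symm y) := Set.indicator_of_mem hy _

theorem chartPush_symm_apply {e : OpenPartialHomeomorph M (Model n)} (η : Model n → ℝ)
    {y : Model n} (hy : y ∈ e.target) : chartPush e η (e.symm y) = η y := by
  rw [chartPush, Set.indicator_of_mem (e.map_target hy), e.right_inv hy]

/-- The image of the compact support is closed in the model space, so extension by zero adds no
support at the edge of the chart. -/
theorem tsupport_chartPull_subset {e : OpenPartialHomeomorph M (Model n)} {f : M → ℝ}
    (hf : HasCompactSupport f) (hfe : tsupport f ⊆ e.source) :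
    tsupport (chartPull e f) ⊆ e '' tsupport f := by
  refine closure_minimal (fun y hy => ?_) (isCompact_chart_image hf hfe).isClosed
  have hye : y ∈ e.target := by
    by_contra h
    exact hy (Set.indicator_of_notMem h _)
  refine ⟨e.symm y, subset_tsupport _ ?_, e.right_inv hye⟩
  rw [Function.mem_support, chartPull_apply _ hye] at hy
  exact hy

theorem tsupport_chartPush_subset [T2Space M] {e : OpenPartialHomeomorph M (Model n)}
    {η : Model n → ℝ} {K : Set (Model n)} (hK : IsCompact K) (hηK : tsupport η ⊆ K)
    (hKe : K ⊆ e.target) : tsupport (chartPush e η) ⊆ e.symm '' K := by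
  refine closure_minimal (fun x hx => ?_) (isCompact_chart_symm_image hK hKe).isClosed
  have hxe : x ∈ e.source := by
    by_contra h
    exact hx (Set.indicator_of_notMem h _)
  refine ⟨e x, hηK (subset_tsupport _ ?_), e.left_inv hxe⟩
  rw [Function.mem_support, chartPush, Set.indicator_of_mem hxe] at hx
  exact hx

theorem chartPull_eventuallyEq {e : OpenPartialHomeomorph M (Model n)} (f : M → ℝ) {y : Model n}
    (hy : y ∈ e.target) : chartPull e f =ᶠ[𝓝 y] fun z => f (e.symm z) := by
  filter_upwards [e.open_target.mem_nhds hy] with z hz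
  exact chartPull_apply f hz

theorem contDiff_chartPull {e : OpenPartialHomeomorph M (Model n)} (he : e ∈ atlas (Model n) M)
    {f : M → ℝ} (hf : ContMDiff 𝓘(ℝ, Model n) 𝓘(ℝ, ℝ) ∞ f) (hfc : HasCompactSupport f)
    (hfe : tsupport f ⊆ e.source) : ContDiff ℝ ∞ (chartPull e f) := by
  rw [← contMDiff_iff_contDiff]
  refine contMDiff_of_tsupport fun y hy => ?_
  obtain ⟨x, hx, rfl⟩ := tsupport_chartPull_subset hfc hfe hy
  have hy' := e.map_source (hfe hx)
  refine ContMDiffAt.congr_of_eventuallyEq ?_ (chartPull_eventuallyEq f hy')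
  exact contMDiffAt_iff_contDiffAt.2 (((contDiffOn_comp_chart_symm he hf) _ hy').contDiffAt (e.open_target.mem_nhds hy'))

theorem contMDiff_chartPush [T2Space M] {e : OpenPartialHomeomorph M (Model n)}
    (he : e ∈ atlas (Model n) M) {η : Model n → ℝ} (hη : ContDiff ℝ ∞ η) {K : Set (Model n)}
    (hK : IsCompact K) (hηK : tsupport η ⊆ K) (hKe : K ⊆ e.target) :
    ContMDiff 𝓘(ℝ, Model n) 𝓘(ℝ, ℝ) ∞ (chartPush e η) := by
  refine contMDiff_of_tsupport fun x hx => ?_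
  obtain ⟨y, hy, rfl⟩ := tsupport_chartPush_subset hK hηK hKe hx
  have hx' := e.map_target (hKe hy)
  have h1 : ContMDiffAt 𝓘(ℝ, Model n) 𝓘(ℝ, ℝ) ∞ (fun x => η (e x)) (e.symm y) :=
    hη.contMDiff.contMDiffAt.comp _ (contMDiffAt_of_mem_maximalAtlas
      (IsManifold.subset_maximalAtlas he) hx')
  refine h1.congr_of_eventuallyEq ?_
  filter_upwards [e.open_source.mem_nhds hx'] with z hz
  exact Set.indicator_of_mem hz _

end ChartTransfer

section ChartNorm

variable {n : ℕ} {M : Type*} [TopologicalSpace M] [T2Space M] [MeasurableSpace M] [BorelSpace M]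
  [ChartedSpace (Model n) M] [IsManifold 𝓘(ℝ, Model n) ∞ M]
  [RiemannianBundle (fun x : M => TangentSpace 𝓘(ℝ, Model n) x)]
  [IsContMDiffRiemannianBundle 𝓘(ℝ, Model n) ∞ (Model n)
      (fun x : M => TangentSpace 𝓘(ℝ, Model n) x)]
  {φ : M → ℝ}

theorem memLp_comp_chart_symm (hφ : Continuous φ) {Ω : Set M}
    {e : OpenPartialHomeomorph M (Model n)} (he : e ∈ atlas (Model n) M) {K : Set (Model n)}
    (hK : IsCompact K) (hKΩ : K ⊆ e.target ∩ e.symm ⁻¹' Ω) {f : M → ℝ} {p : ℝ≥0∞}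
    (hf : MemLp f p ((weightedVolume n φ).restrict Ω)) :
    MemLp (fun y => f (e.symm y)) p (volume.restrict K) := by
  have hKe := hKΩ.trans Set.inter_subset_left
  have hT := isCompact_chart_symm_image hK hKe
  obtain ⟨C, hC, -, h2⟩ := exists_weightedVolume_comparison hφ he hT
    (by rintro _ ⟨y, hy, rfl⟩; exact e.map_target (hKe hy))
  have hTΩ : e.symm '' K ⊆ Ω := by rintro _ ⟨y, hy, rfl⟩; exact (hKΩ hy).2
  have h3 : MemLp f p ((chartLebesgue e).restrict (e.symm '' K)) :=
    (hf.mono_measure (Measure.restrict_mono_set _ hTΩ)).of_measure_le_smul hC h2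
  have h4 := (aestronglyMeasurable_chartLebesgue_restrict_iff e _ f).1 h3.1
  have h5 := h3.2
  rw [eLpNorm_chartLebesgue_restrict, target_inter_preimage_image_symm hKe] at h5
  rw [target_inter_preimage_image_symm hKe] at h4
  exact ⟨h4, h5⟩

/-- The constant is a power of the ratio of the two measures on K and serves every function
vanishing off the image of K. -/
theorem exists_eLpNorm_le_comp_chart_symm (hφ : Continuous φ) {Ω : Set M}
    {e : OpenPartialHomeomorph M (Model n)} (he : e ∈ atlas (Model n) M) {K : Set (Model n)}
    (hK : IsCompact K) (hKe : K ⊆ e.target) (p : ℝ≥0∞) :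
    ∃ C : ℝ≥0∞, C ≠ ⊤ ∧ ∀ h : M → ℝ, (∀ x ∉ e.symm '' K, h x = 0) →
      eLpNorm h p ((weightedVolume n φ).restrict Ω) ≤
        C * eLpNorm (fun y => h (e.symm y)) p (volume.restrict K) := by
  have hT := isCompact_chart_symm_image hK hKe
  obtain ⟨C, hC, h1, -⟩ := exists_weightedVolume_comparison hφ he hT
    (by rintro _ ⟨y, hy, rfl⟩; exact e.map_target (hKe hy))
  refine ⟨C ^ (1 / p).toReal, ENNReal.rpow_ne_top_of_nonneg ENNReal.toReal_nonneg hC,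
    fun h hh => ?_⟩
  have hs : Function.support h ⊆ e.symm '' K := fun x hx => by
    by_contra hxT
    exact hx (hh x hxT)
  calc eLpNorm h p ((weightedVolume n φ).restrict Ω)
      ≤ eLpNorm h p (weightedVolume n φ) := eLpNorm_mono_measure _ Measure.restrict_le_self
    _ = eLpNorm h p ((weightedVolume n φ).restrict (e.symm '' K)) :=
      (eLpNorm_restrict_eq_of_support_subset hs).symm
    _ ≤ eLpNorm h p (C • (chartLebesgue e).restrict (e.symm '' K)) := eLpNorm_mono_measure _ h1
    _ ≤ C ^ (1 / p).toReal • eLpNorm h p ((chartLebesgue e).restrict (e.symm '' K)) :=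
      eLpNorm_smul_measure_le _ _ _ _
    _ = _ := by
      rw [eLpNorm_chartLebesgue_restrict, target_inter_preimage_image_symm hKe, smul_eq_mul]

end ChartNorm

end

/-! ### Approximation by test functions inside one chart. -/

noncomputable section

section ChartApprox

variable {n : ℕ} {M : Type*} [TopologicalSpace M]
  [ChartedSpace (Model n) M]
  [RiemannianBundle (fun x : M => TangentSpace 𝓘(ℝ, Model n) x)]

theorem riemannianGradient_eq_zero {f : M → ℝ} {x : M} {c : ℝ} (h : f =ᶠ[𝓝 x] fun _ => c) :
    riemannianGradient (n := n) f x = 0 := by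
  rw [← inner_self_eq_zero (𝕜 := ℝ), inner_riemannianGradient, h.mfderiv_eq, mfderiv_const]
  rfl

theorem riemannianGradient_eq_zero_of_notMem_tsupport {f : M → ℝ} {x : M} (h : x ∉ tsupport f) :
    riemannianGradient (n := n) f x = 0 :=
  riemannianGradient_eq_zero (notMem_tsupport_iff_eventuallyEq.1 h)

variable [T2Space M] [MeasurableSpace M] [BorelSpace M] [IsManifold 𝓘(ℝ, Model n) ∞ M]
  [IsContMDiffRiemannianBundle 𝓘(ℝ, Model n) ∞ (Model n)
      (fun x : M => TangentSpace 𝓘(ℝ, Model n) x)]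
  {φ : M → ℝ}

theorem memLp_mul_of_continuous {K : Set (Model n)} {a f : Model n → ℝ}
    {p : ℝ≥0∞} (ha : Continuous a) (hac : HasCompactSupport a)
    (hf : MemLp f p (volume.restrict K)) : MemLp (fun y => a y * f y) p (volume.restrict K) := by
  obtain ⟨C, hC⟩ := ha.bounded_above_of_compact_support hac
  refine MemLp.of_le_mul (c := C) hf (ha.aestronglyMeasurable.mul hf.1)
    (Eventually.of_forall fun y => ?_)
  rw [norm_mul]
  exact mul_le_mul_of_nonneg_right (hC y) (norm_nonneg _)

theorem IsWeakGradient.memLp_inner_coordField (hφ : Continuous φ) {Ω : Set M}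
    {e : OpenPartialHomeomorph M (Model n)} (he : e ∈ atlas (Model n) M) {f : M → ℝ}
    {Z : (x : M) → TangentSpace 𝓘(ℝ, Model n) x} (h : IsWeakGradient Ω f Z) {p : ℝ≥0∞}
    (hZ : MemLp (fun x => ‖Z x‖) p ((weightedVolume n φ).restrict Ω)) {K : Set (Model n)}
    (hK : IsCompact K) (hKΩ : K ⊆ e.target ∩ e.symm ⁻¹' Ω) (i : Fin n) :
    MemLp (fun y => (inner ℝ (Z (e.symm y)) (coordField e i y) : ℝ)) p (volume.restrict K) := by
  obtain ⟨C, hC⟩ := exists_norm_coordVec_le he hK (hKΩ.trans Set.inter_subset_left)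
    (EuclideanSpace.single i (1 : ℝ))
  refine MemLp.of_le_mul (c := C) (memLp_comp_chart_symm hφ he hK hKΩ hZ)
    ((h.isAEMeasurableField e he _).mono_measure (Measure.restrict_mono_set _ hKΩ))
    ((ae_restrict_iff' hK.measurableSet).2 (Eventually.of_forall fun y hy => ?_))
  rw [norm_norm, mul_comm]
  exact (norm_inner_le_norm _ _).trans (mul_le_mul_of_nonneg_left (hC y hy) (norm_nonneg _))

/-- A Sobolev function multiplied by a cutoff supported in a chart is approximated by test
functions. -/
theorem IsWeakGradient.exists_testFunction_near_mul (hφ : Continuous φ) {Ω : Set M}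
    (hΩ : IsOpen Ω) {e : OpenPartialHomeomorph M (Model n)} (he : e ∈ atlas (Model n) M)
    {f : M → ℝ} {Z : (x : M) → TangentSpace 𝓘(ℝ, Model n) x} (h : IsWeakGradient Ω f Z)
    {p : ℝ≥0∞} (hp1 : 1 ≤ p) (hp : p ≠ ⊤)
    (hf : MemLp f p ((weightedVolume n φ).restrict Ω))
    (hZ : MemLp (fun x => ‖Z x‖) p ((weightedVolume n φ).restrict Ω))
    {χ : M → ℝ} (hχ : ContMDiff 𝓘(ℝ, Model n) 𝓘(ℝ, ℝ) ∞ χ) (hχc : HasCompactSupport χ)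
    (hχs : tsupport χ ⊆ e.source ∩ Ω) {ε : ℝ≥0∞} (hε : 0 < ε) :
    ∃ ψ, IsTestFunction n Ω ψ ∧
      eLpNorm (fun x => χ x * f x - ψ x) p ((weightedVolume n φ).restrict Ω) ≤ ε ∧
      eLpNorm (fun x => ‖χ x • Z x + f x • riemannianGradient χ x - riemannianGradient ψ x‖) p
        ((weightedVolume n φ).restrict Ω) ≤ ε := by
  have hχe := hχs.trans Set.inter_subset_left
  have hO := isOpen_chart_preimage hΩ e
  set S := e '' tsupport χ with hSdef
  have hS : IsCompact S := isCompact_chart_image hχc hχe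
  have hSO : S ⊆ e.target ∩ e.symm ⁻¹' Ω := image_subset_target_inter_preimage hχs
  have ha : ContDiff ℝ ∞ (chartPull e χ) := contDiff_chartPull he hχ hχc hχe
  have haS : tsupport (chartPull e χ) ⊆ S := tsupport_chartPull_subset hχc hχe
  have hac : HasCompactSupport (chartPull e χ) := hS.of_isClosed_subset (isClosed_tsupport _) haS
  have hda : ∀ w, tsupport (fun y => fderiv ℝ (chartPull e χ) y w) ⊆ S := fun w =>
    (tsupport_fderiv_apply_subset' _ w).trans haS
  set F : Model n → ℝ := fun y => chartPull e χ y * f (e.symm y) with hF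
  set w : Fin n → Model n := fun i => EuclideanSpace.single i (1 : ℝ) with hw
  -- The partial derivatives of F = χ f given by the product rule; like F they vanish off S, so
  -- local L^p bounds become global ones.
  set g : Fin n → Model n → ℝ := fun i y =>
    chartPull e χ y * inner ℝ (Z (e.symm y)) (coordField e i y) +
      fderiv ℝ (chartPull e χ) y (w i) * f (e.symm y) with hg
  have hweak : ∀ i, HasWeakDerivOn Set.univ F (w i) (g i) := fun i =>
    (isWeakGradient_iff.1 h e he (w i)).cutoff_mul ha hac (haS.trans hSO)
  have haz : ∀ y ∉ S, chartPull e χ y = 0 := fun y hy => image_eq_zero_of_notMem_tsupport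
    fun h => hy (haS h)
  have hdaz : ∀ w, ∀ y ∉ S, fderiv ℝ (chartPull e χ) y w = 0 := fun w y hy =>
    image_eq_zero_of_notMem_tsupport (f := fun y => fderiv ℝ (chartPull e χ) y w)
      fun h => hy (hda w h)
  have hFS : ∀ y ∉ S, F y = 0 := fun y hy => by simp only [hF, haz y hy, zero_mul]
  have hgS : ∀ i, ∀ y ∉ S, g i y = 0 := fun i y hy => by
    simp only [hg, haz y hy, hdaz _ y hy, zero_mul, add_zero]
  have memLp_of : ∀ {G : Model n → ℝ}, (∀ y ∉ S, G y = 0) → MemLp G p (volume.restrict S) →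
      MemLp G p volume := fun {G} hG hGp => by
    rw [← memLp_indicator_iff_restrict hS.measurableSet] at hGp
    rwa [Set.indicator_eq_self.2 fun y hy => by by_contra hyS; exact hy (hG y hyS)] at hGp
  have hfS := memLp_comp_chart_symm hφ he hS hSO hf
  have hFp : MemLp F p volume := memLp_of hFS (memLp_mul_of_continuous ha.continuous hac hfS)
  have hgp : ∀ i, MemLp (g i) p volume := fun i => memLp_of (hgS i)
    ((memLp_mul_of_continuous ha.continuous hac
      (h.memLp_inner_coordField hφ he hZ hS hSO i)).add (memLp_mul_of_continuous
        (continuous_fderiv_apply_of_contDiff ha _) (hac.fderiv_apply ℝ _) hfS))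
  obtain ⟨K, hK, hSK, hKO, happ⟩ := exists_smooth_approx hS hO hSO hp1 hp hFS hFp hgp hweak
  have hKe := hKO.trans Set.inter_subset_left
  obtain ⟨C, hC, hCle⟩ := exists_eLpNorm_le_comp_chart_symm hφ (Ω := Ω) he hK hKe p
  obtain ⟨D, hD0, hD⟩ := exists_norm_le_sum_inner he hK hKe
  -- C converts chart norms to norms on M, D n bounds a gradient error by its n component errors,
  -- and the summand 1 serves the error of the function itself.
  set A : ℝ≥0∞ := C * (ENNReal.ofReal D * n + 1) with hA
  have hAtop : A ≠ ⊤ := by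
    refine ENNReal.mul_ne_top hC (ENNReal.add_ne_top.2 ⟨ENNReal.mul_ne_top ENNReal.ofReal_ne_top
      (ENNReal.natCast_ne_top n), ENNReal.one_ne_top⟩)
  have hεA : 0 < ε / A := ENNReal.div_pos hε.ne' hAtop
  obtain ⟨η, hη, hηK, hη1, hη2⟩ := happ _ hεA
  have hψs := tsupport_chartPush_subset hK hηK hKe
  have hψd := contMDiff_chartPush he hη hK hηK hKe
  have hT := isCompact_chart_symm_image hK hKe
  have hχT : tsupport χ ⊆ e.symm '' K := fun x hx =>
    ⟨e x, hSK ⟨x, hx, rfl⟩, e.left_inv (hχe hx)⟩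
  refine ⟨chartPush e η, ⟨hψd, hT.of_isClosed_subset (isClosed_tsupport _) hψs,
    hψs.trans (by rintro _ ⟨y, hy, rfl⟩; exact (hKO hy).2)⟩, ?_, ?_⟩
  · refine (hCle _ fun x hx => ?_).trans ?_
    · rw [image_eq_zero_of_notMem_tsupport fun h => hx (hχT h),
        image_eq_zero_of_notMem_tsupport fun h => hx (hψs h), zero_mul, sub_zero]
    · have h1 : eLpNorm (fun y => χ (e.symm y) * f (e.symm y) - chartPush e η (e.symm y)) p
          (volume.restrict K) ≤ eLpNorm (fun y => F y - η y) p volume := by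
        rw [eLpNorm_congr_ae ((ae_restrict_iff' hK.measurableSet).2 (Eventually.of_forall
          fun y hy => by
            rw [chartPush_symm_apply η (hKe hy), ← chartPull_apply χ (hKe hy)]) :
              _ =ᵐ[volume.restrict K] fun y => F y - η y)]
        exact eLpNorm_mono_measure _ Measure.restrict_le_self
      calc _ ≤ C * (ε / A) := mul_le_mul_right (h1.trans hη1.le) _
        _ ≤ A * (ε / A) := by
          refine mul_le_mul_left ?_ _
          rw [hA]
          exact le_mul_of_one_le_right' le_add_self
        _ ≤ ε := ENNReal.mul_div_le
  · refine (hCle _ fun x hx => ?_).trans ?_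
    · rw [image_eq_zero_of_notMem_tsupport fun h => hx (hχT h),
        riemannianGradient_eq_zero_of_notMem_tsupport fun h => hx (hχT h),
        riemannianGradient_eq_zero_of_notMem_tsupport fun h => hx (hψs h), zero_smul, smul_zero,
        add_zero, sub_zero, norm_zero]
    · have h1 : ∀ y ∈ K, ∀ i, (inner ℝ (χ (e.symm y) • Z (e.symm y) +
          f (e.symm y) • riemannianGradient χ (e.symm y) -
            riemannianGradient (chartPush e η) (e.symm y)) (coordField e i y) : ℝ) =
            g i y - fderiv ℝ η y (w i) := fun y hy i => by
        have hy' := hKe hy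
        have e1 := inner_riemannianGradient_coordVec he hy'
          (hχ.mdifferentiable (by simp) (e.symm y)) (w i)
        have e2 := inner_riemannianGradient_coordVec he hy'
          (hψd.mdifferentiable (by simp) (e.symm y)) (w i)
        have e3 : (fun z => chartPush e η (e.symm z)) =ᶠ[𝓝 y] η := by
          filter_upwards [e.open_target.mem_nhds hy'] with z hz
          exact chartPush_symm_apply η hz
        rw [e3.fderiv_eq] at e2
        rw [← (chartPull_eventuallyEq χ hy').fderiv_eq] at e1
        change _ = fderiv ℝ (chartPull e χ) y (w i) at e1
        rw [inner_sub_left, inner_add_left, real_inner_smul_left, real_inner_smul_left]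
        change _ + _ * inner ℝ _ (coordVec e y (w i)) - inner ℝ _ (coordVec e y (w i)) = _
        rw [e1, e2, ← chartPull_apply χ hy']
        simp only [hg]
        ring
      have h2 : eLpNorm (fun y => ‖χ (e.symm y) • Z (e.symm y) +
          f (e.symm y) • riemannianGradient χ (e.symm y) -
            riemannianGradient (chartPush e η) (e.symm y)‖) p (volume.restrict K) ≤
          ENNReal.ofReal D * (n * (ε / A)) := by
        refine (eLpNorm_le_mul_eLpNorm_of_ae_le_mul (c := D)
          (g := ∑ i, fun y => ‖g i y - fderiv ℝ η y (w i)‖)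
          ((ae_restrict_iff' hK.measurableSet).2 (Eventually.of_forall fun y hy => ?_)) p).trans ?_
        · rw [norm_norm]
          refine (hD y hy _).trans (mul_le_mul_of_nonneg_left ?_ hD0)
          rw [Finset.sum_apply]
          refine le_trans (le_of_eq ?_) (le_abs_self _)
          exact Finset.sum_congr rfl fun i _ => by rw [h1 y hy i, Real.norm_eq_abs]
        · refine mul_le_mul_right ?_ _
          refine (eLpNorm_sum_le (fun i _ => ?_) hp1).trans ?_
          · exact ((hgp i).1.sub (continuous_fderiv_apply_of_contDiff hη
              (w i)).aestronglyMeasurable).norm.restrict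
          · refine (Finset.sum_le_sum fun i _ => ?_).trans (le_of_eq (?_ :
              ∑ _i : Fin n, ε / A = n * (ε / A)))
            · rw [eLpNorm_norm]
              exact (eLpNorm_mono_measure _ Measure.restrict_le_self).trans (hη2 i).le
            · rw [Finset.sum_const, Finset.card_univ, Fintype.card_fin, nsmul_eq_mul]
      calc _ ≤ C * (ENNReal.ofReal D * (n * (ε / A))) := mul_le_mul_right h2 _
        _ ≤ A * (ε / A) := by
          rw [hA, ← mul_assoc, ← mul_assoc]
          refine mul_le_mul_left ?_ _
          rw [mul_assoc]
          exact mul_le_mul_right le_self_add _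
        _ ≤ ε := ENNReal.mul_div_le

end ChartApprox

end

/-! ### Globalisation by a partition of unity. -/

noncomputable section

section GradientAlgebra

variable {n : ℕ} {M : Type*} [TopologicalSpace M]
  [ChartedSpace (Model n) M]
  [RiemannianBundle (fun x : M => TangentSpace 𝓘(ℝ, Model n) x)]

theorem riemannianGradient_add {f g : M → ℝ} {x : M}
    (hf : MDifferentiableAt 𝓘(ℝ, Model n) 𝓘(ℝ, ℝ) f x)
    (hg : MDifferentiableAt 𝓘(ℝ, Model n) 𝓘(ℝ, ℝ) g x) :
    riemannianGradient (n := n) (fun z => f z + g z) x =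
      riemannianGradient f x + riemannianGradient g x := by
  refine ext_inner_right ℝ fun w => ?_
  rw [inner_add_left, inner_riemannianGradient, inner_riemannianGradient,
    inner_riemannianGradient]
  have h := mfderiv_add hf hg
  exact congrArg (fun L : TangentSpace 𝓘(ℝ, Model n) x →L[ℝ] ℝ => L w) h

theorem contMDiff_real_finset_sum {ι : Type*} (s : Finset ι) {f : ι → M → ℝ}
    (hf : ∀ i ∈ s, ContMDiff 𝓘(ℝ, Model n) 𝓘(ℝ, ℝ) ∞ (f i)) :
    ContMDiff 𝓘(ℝ, Model n) 𝓘(ℝ, ℝ) ∞ fun x => ∑ i ∈ s, f i x := by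
  classical
  induction s using Finset.induction_on with
  | empty => simpa using contMDiff_const
  | insert a s ha ih =>
    simp only [Finset.sum_insert ha]
    exact (hf a (Finset.mem_insert_self a s)).add
      (ih fun i hi => hf i (Finset.mem_insert_of_mem hi))

theorem riemannianGradient_finset_sum {ι : Type*} (s : Finset ι) {f : ι → M → ℝ}
    (hf : ∀ i ∈ s, ContMDiff 𝓘(ℝ, Model n) 𝓘(ℝ, ℝ) ∞ (f i)) (x : M) :
    riemannianGradient (n := n) (fun z => ∑ i ∈ s, f i z) x =
      ∑ i ∈ s, riemannianGradient (f i) x := by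
  classical
  induction s using Finset.induction_on with
  | empty => simpa using riemannianGradient_eq_zero (c := 0) (EventuallyEq.refl _ _)
  | insert a s ha ih =>
    have hs : ∀ i ∈ s, _ := fun i hi => hf i (Finset.mem_insert_of_mem hi)
    simp only [Finset.sum_insert ha]
    rw [riemannianGradient_add ((hf a (Finset.mem_insert_self a s)).mdifferentiable (by simp) x)
      ((contMDiff_real_finset_sum s hs).mdifferentiable (by simp) x), ih hs]

theorem IsTestFunction.finset_sum {Ω : Set M} (hΩc : IsCompact (closure Ω)) {ι : Type*}
    (s : Finset ι) {ψ : ι → M → ℝ} (h : ∀ i ∈ s, IsTestFunction n Ω (ψ i)) :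
    IsTestFunction n Ω fun x => ∑ i ∈ s, ψ i x := by
  have hs : tsupport (fun x => ∑ i ∈ s, ψ i x) ⊆ Ω := by
    refine subset_trans (closure_minimal (fun x hx => ?_)
      (s.finite_toSet.isClosed_biUnion fun i _ => isClosed_tsupport (ψ i)))
      (Set.iUnion₂_subset fun i hi => (h i hi).2.2)
    obtain ⟨i, hi, hne⟩ := Finset.exists_ne_zero_of_sum_ne_zero hx
    exact Set.mem_biUnion hi (subset_tsupport _ hne)
  exact ⟨contMDiff_real_finset_sum s fun i hi => (h i hi).1,
    hΩc.of_isClosed_subset (isClosed_tsupport _) (hs.trans subset_closure), hs⟩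

end GradientAlgebra

section GlobalApprox

variable {n : ℕ} {M : Type*} [TopologicalSpace M] [T2Space M] [SecondCountableTopology M]
  [MeasurableSpace M] [BorelSpace M]
  [ChartedSpace (Model n) M] [IsManifold 𝓘(ℝ, Model n) ∞ M]
  [RiemannianBundle (fun x : M => TangentSpace 𝓘(ℝ, Model n) x)]
  [IsContMDiffRiemannianBundle 𝓘(ℝ, Model n) ∞ (Model n)
      (fun x : M => TangentSpace 𝓘(ℝ, Model n) x)]
  {φ : M → ℝ}

theorem IsAEMeasurableField.add {Ω : Set M} {X Y : (x : M) → TangentSpace 𝓘(ℝ, Model n) x}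
    (hX : IsAEMeasurableField Ω X) (hY : IsAEMeasurableField Ω Y) :
    IsAEMeasurableField Ω (fun x => X x + Y x) := fun e he w => by
  simpa only [inner_add_left] using! (hX e he w).add (hY e he w)

theorem IsAEMeasurableField.smul {Ω : Set M} {X : (x : M) → TangentSpace 𝓘(ℝ, Model n) x}
    (hX : IsAEMeasurableField Ω X) {a : M → ℝ} (ha : ∀ e ∈ atlas (Model n) M,
      AEStronglyMeasurable (fun y => a (e.symm y))
        ((volume : Measure (Model n)).restrict (e.target ∩ e.symm ⁻¹' Ω))) :
    IsAEMeasurableField Ω (fun x => a x • X x) := fun e he w => by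
  simpa only [real_inner_smul_left] using! (ha e he).mul (hX e he w)

/-- Sobolev functions vanishing off a compact subset of `Ω` are approximated by test functions. -/
theorem IsWeakGradient.exists_testFunction_near_of_compact (hφ : Continuous φ) {Ω : Set M}
    (hΩ : IsOpen Ω) (hΩc : IsCompact (closure Ω)) {f : M → ℝ}
    {Z : (x : M) → TangentSpace 𝓘(ℝ, Model n) x} (h : IsWeakGradient Ω f Z)
    {p : ℝ≥0∞} (hp1 : 1 ≤ p) (hp : p ≠ ⊤)
    (hf : MemLp f p ((weightedVolume n φ).restrict Ω))
    (hZ : MemLp (fun x => ‖Z x‖) p ((weightedVolume n φ).restrict Ω))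
    {K : Set M} (hK : IsCompact K) (hKΩ : K ⊆ Ω) (hfK : ∀ x ∈ Ω, x ∉ K → f x = 0 ∧ Z x = 0)
    {ε : ℝ≥0∞} (hε : 0 < ε) :
    ∃ ψ, IsTestFunction n Ω ψ ∧
      eLpNorm (fun x => f x - ψ x) p ((weightedVolume n φ).restrict Ω) ≤ ε ∧
      eLpNorm (fun x => ‖Z x - riemannianGradient ψ x‖) p
        ((weightedVolume n φ).restrict Ω) ≤ ε := by
  have : LocallyCompactSpace M := ChartedSpace.locallyCompactSpace (Model n) M
  -- The partition sums to 1 on a neighbourhood L of K and not only on K, so that its gradients sum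
  -- to zero on K.
  obtain ⟨L, hL, hKL, hLΩ⟩ := exists_compact_between hK hΩ hKΩ
  obtain ⟨t, ht⟩ := hL.elim_finite_subcover (fun x : M => (chartAt (Model n) x).source)
    (fun x => (chartAt (Model n) x).open_source)
    (fun x _ => Set.mem_iUnion.2 ⟨x, mem_chart_source (Model n) x⟩)
  obtain ⟨ρ, hρ⟩ := SmoothPartitionOfUnity.exists_isSubordinate 𝓘(ℝ, Model n) hL.isClosed
    (fun i : t => (chartAt (Model n) (i : M)).source ∩ Ω)
    (fun i => (chartAt (Model n) (i : M)).open_source.inter hΩ) (fun x hx => by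
      obtain ⟨i, hi, hxi⟩ := Set.mem_iUnion₂.1 (ht hx)
      exact Set.mem_iUnion.2 ⟨⟨i, hi⟩, hxi, hLΩ hx⟩)
  have hsum : ∀ x ∈ L, ∑ i, ρ i x = 1 := fun x hx => by
    rw [← finsum_eq_sum_of_fintype]
    exact ρ.sum_eq_one hx
  have hd : ∀ i, ContMDiff 𝓘(ℝ, Model n) 𝓘(ℝ, ℝ) ∞ (ρ i) := fun i => (ρ i).contMDiff
  have hgsum : ∀ x ∈ K, ∑ i, riemannianGradient (n := n) (ρ i) x = 0 := fun x hx => by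
    rw [← riemannianGradient_finset_sum _ fun i _ => hd i]
    refine riemannianGradient_eq_zero (c := 1) ?_
    filter_upwards [mem_interior_iff_mem_nhds.1 (hKL hx)] with z hz
    exact hsum z hz
  -- The error ε is shared equally among the finitely many chart pieces.
  set N : ℝ≥0∞ := (Fintype.card t : ℝ≥0∞) with hN
  have hεN : 0 < ε / N := ENNReal.div_pos hε.ne' (ENNReal.natCast_ne_top _)
  have hex := fun i : t => h.exists_testFunction_near_mul hφ hΩ (chart_mem_atlas (Model n) (i : M))
    hp1 hp hf hZ (hd i) (hΩc.of_isClosed_subset (isClosed_tsupport _)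
      (((hρ i).trans Set.inter_subset_right).trans subset_closure)) (hρ i) hεN
  choose ψ hψ hψ1 hψ2 using hex
  have hψd : ∀ i ∈ Finset.univ, ContMDiff 𝓘(ℝ, Model n) 𝓘(ℝ, ℝ) ∞ (ψ i) := fun i _ => (hψ i).1
  have hsmall : ∀ a : t → ℝ≥0∞, (∀ i, a i ≤ ε / N) → ∑ i, a i ≤ ε := fun a ha =>
    (Finset.sum_le_sum fun i _ => ha i).trans (by
      rw [Finset.sum_const, Finset.card_univ, nsmul_eq_mul]
      exact ENNReal.mul_div_le)
  refine ⟨fun x => ∑ i, ψ i x, IsTestFunction.finset_sum hΩc _ fun i _ => hψ i, ?_, ?_⟩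
  · have h1 : ∀ x ∈ Ω, f x - ∑ i, ψ i x = (∑ i, fun x => ρ i x * f x - ψ i x) x := fun x hx => by
      rw [Finset.sum_apply, Finset.sum_sub_distrib, ← Finset.sum_mul]
      by_cases hxK : x ∈ K
      · rw [hsum x (interior_subset (hKL hxK)), one_mul]
      · rw [(hfK x hx hxK).1, mul_zero]
    rw [eLpNorm_congr_ae (ae_restrict_of_forall_mem hΩ.measurableSet h1)]
    refine (eLpNorm_sum_le (fun i _ => ?_) hp1).trans (hsmall _ hψ1)
    exact ((hd i).continuous.aestronglyMeasurable.mul hf.1).sub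
      (hψ i).1.continuous.aestronglyMeasurable
  · have hm : ∀ i, AEStronglyMeasurable (fun x => ‖ρ i x • Z x + f x •
        riemannianGradient (ρ i) x - riemannianGradient (ψ i) x‖)
        ((weightedVolume n φ).restrict Ω) := fun i => by
      refine IsAEMeasurableField.aestronglyMeasurable_norm hφ hΩ.measurableSet
        (IsAEMeasurableField.sub (IsAEMeasurableField.add
          (h.isAEMeasurableField.smul fun e he => ?_)
          ((isAEMeasurableField_riemannianGradient hΩ.measurableSet (hd i)).smul fun e he => ?_))
          (isAEMeasurableField_riemannianGradient hΩ.measurableSet (hψ i).1))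
      · exact (((hd i).continuous.comp_continuousOn e.continuousOn_symm).mono
          Set.inter_subset_left).aestronglyMeasurable
          (measurableSet_target_inter_preimage e hΩ.measurableSet)
      · exact (h.1 e he).aestronglyMeasurable
    have h1 : ∀ x ∈ Ω, ‖Z x - riemannianGradient (fun z => ∑ i, ψ i z) x‖ ≤
        ‖(∑ i, fun x => ‖ρ i x • Z x + f x • riemannianGradient (ρ i) x -
          riemannianGradient (ψ i) x‖) x‖ := fun x hx => by
      -- The product rule terms f ∇ρ_i cancel in the sum: on K because the gradients of the ρ_i add
      -- up to zero, off K because f and Z vanish.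
      have h2 : Z x - riemannianGradient (fun z => ∑ i, ψ i z) x =
          ∑ i, (ρ i x • Z x + f x • riemannianGradient (ρ i) x -
            riemannianGradient (ψ i) x) := by
        rw [riemannianGradient_finset_sum _ hψd, Finset.sum_sub_distrib, Finset.sum_add_distrib,
          ← Finset.sum_smul, ← Finset.smul_sum]
        by_cases hxK : x ∈ K
        · rw [hsum x (interior_subset (hKL hxK)), one_smul, hgsum x hxK, smul_zero, add_zero]
        · rw [(hfK x hx hxK).1, (hfK x hx hxK).2, zero_smul, smul_zero, add_zero]
      rw [h2, Finset.sum_apply]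
      exact (norm_sum_le _ _).trans (le_abs_self _)
    refine (eLpNorm_mono_ae (g := ∑ i, fun x => ‖ρ i x • Z x + f x • riemannianGradient (ρ i) x -
          riemannianGradient (ψ i) x‖) ((ae_restrict_of_forall_mem hΩ.measurableSet
          fun x hx => by rw [norm_norm]; exact h1 x hx))).trans ?_
    exact (eLpNorm_sum_le (fun i _ => hm i) hp1).trans (hsmall _ hψ2)

end GlobalApprox

end

/-! ### Sobolev functions with zero boundary values are limits of test functions. -/

noncomputable section

section ZeroBoundary

variable {n : ℕ} {M : Type*} [TopologicalSpace M] [T2Space M] [SecondCountableTopology M]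
  [MeasurableSpace M] [BorelSpace M]
  [ChartedSpace (Model n) M] [IsManifold 𝓘(ℝ, Model n) ∞ M]
  [RiemannianBundle (fun x : M => TangentSpace 𝓘(ℝ, Model n) x)]
  [IsContMDiffRiemannianBundle 𝓘(ℝ, Model n) ∞ (Model n)
      (fun x : M => TangentSpace 𝓘(ℝ, Model n) x)]
  {φ : M → ℝ}

/-- The gradient of a Sobolev function can be replaced by zero on its zero set. -/
theorem IsWeakGradient.ite_zero {Ω : Set M}
    (hΩ : IsOpen Ω) {f : M → ℝ} {X : (x : M) → TangentSpace 𝓘(ℝ, Model n) x}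
    (h : IsWeakGradient Ω f X) :
    IsWeakGradient Ω f fun x => (if f x = 0 then (0 : ℝ) else 1) • X x := by
  obtain ⟨C, hC⟩ := exists_abs_deriv_smoothTrunc_le
  -- The chain rule for the truncations passes to the limit: the functions tend to f, the gradients
  -- to X times the indicator of f ≠ 0.
  have hk : ∀ k, IsWeakGradient Ω (fun x => truncSeq k (f x))
      fun x => deriv (truncSeq k) (f x) • X x := fun k =>
    h.comp_contDiff hΩ (contDiff_truncSeq k) (C := C) fun s => by
      rw [deriv_truncSeq]; exact hC _
  rw [isWeakGradient_iff] at h ⊢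
  intro e he w
  have hkw := fun k => isWeakGradient_iff.1 (hk k) e he w
  have hlim : ∀ y, Tendsto (fun k => (inner ℝ (deriv (truncSeq k) (f (e.symm y)) • X (e.symm y))
      (coordVec e y w) : ℝ)) atTop (𝓝 (inner ℝ ((if f (e.symm y) = 0 then (0 : ℝ) else 1) •
        X (e.symm y)) (coordVec e y w))) := fun y => by
    simp only [real_inner_smul_left]
    exact (tendsto_truncSeq _).2.mul_const _
  refine HasWeakDerivOn.of_tendsto (C := max C 1) hkw (h e he w).1 (h e he w).2 (h e he w).1 ?_
    (fun k y => ?_) (fun k y => ?_) (fun y => (tendsto_truncSeq _).1) hlim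
  · refine (locallyIntegrableOn_iff
      (isOpen_chart_preimage hΩ e).isLocallyClosed).2 fun K hKO hK => ?_
    refine Integrable.mono ((h e he w).2.integrableOn_compact_subset hKO hK)
      (aestronglyMeasurable_of_tendsto_ae atTop (fun k =>
        ((hkw k).2.integrableOn_compact_subset hKO hK).1) (Eventually.of_forall hlim))
      (Eventually.of_forall fun y => ?_)
    rw [real_inner_smul_left, norm_mul]
    refine mul_le_of_le_one_left (norm_nonneg _) ?_
    split_ifs <;> simp
  · refine (abs_truncSeq_le _ _).trans (le_mul_of_one_le_left (abs_nonneg _) (le_max_right _ _))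
  · rw [real_inner_smul_left, abs_mul]
    refine mul_le_mul_of_nonneg_right ?_ (abs_nonneg _)
    rw [deriv_truncSeq]
    exact (hC _).trans (le_max_left _ _)

/-- A function is small near the boundary of `Ω`. -/
def VanishesAtBoundary (Ω : Set M) (f : M → ℝ) : Prop :=
  ∀ ε : ℝ, 0 < ε → ∃ K, IsCompact K ∧ K ⊆ Ω ∧ ∀ x ∈ Ω, x ∉ K → |f x| < ε

/-- Removing from the compact closure of Ω an open neighbourhood of the frontier on which f is small
leaves a compact subset of Ω. -/
theorem vanishesAtBoundary_of_tendsto {Ω : Set M} (hΩ : IsOpen Ω) (hΩc : IsCompact (closure Ω))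
    {f : M → ℝ} (h : ∀ x ∈ frontier Ω, Tendsto f (𝓝[Ω] x) (𝓝 0)) : VanishesAtBoundary Ω f := by
  intro ε hε
  have h1 : ∀ x ∈ frontier Ω, ∃ U, IsOpen U ∧ x ∈ U ∧ ∀ z ∈ U ∩ Ω, |f z| < ε := fun x hx => by
    have h2 := (h x hx).eventually (Metric.ball_mem_nhds 0 hε)
    obtain ⟨U, hU, hxU, hUΩ⟩ := mem_nhdsWithin.1 h2
    exact ⟨U, hU, hxU, fun z hz => by simpa using hUΩ hz⟩
  choose! U hU hxU hUf using h1
  refine ⟨closure Ω \ ⋃ x ∈ frontier Ω, U x,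
    hΩc.diff (isOpen_biUnion hU), fun x hx => ?_, fun x hx hxK => ?_⟩
  · by_contra hxΩ
    have hxf : x ∈ frontier Ω := by
      rw [hΩ.frontier_eq]
      exact ⟨hx.1, hxΩ⟩
    exact hx.2 (Set.mem_biUnion hxf (hxU x hxf))
  · have h3 : x ∈ ⋃ x ∈ frontier Ω, U x := by
      by_contra h4
      exact hxK ⟨subset_closure hx, h4⟩
    obtain ⟨z, hz, hxz⟩ := Set.mem_iUnion₂.1 h3
    exact hUf z hz x ⟨hxz, hx⟩

theorem VanishesAtBoundary.comp {Ω : Set M} {f : M → ℝ} (h : VanishesAtBoundary Ω f) {G : ℝ → ℝ}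
    (hG : ContinuousAt G 0) (hG0 : G 0 = 0) : VanishesAtBoundary Ω fun x => G (f x) := by
  intro ε hε
  obtain ⟨δ, hδ, hGδ⟩ := Metric.continuousAt_iff.1 hG ε hε
  obtain ⟨K, hK, hKΩ, hfK⟩ := h δ hδ
  refine ⟨K, hK, hKΩ, fun x hx hxK => ?_⟩
  have := @hGδ (f x) (by simpa using hfK x hx hxK)
  rw [hG0] at this
  simpa using this

/-- The truncations of a function vanishing at the boundary have compact support in `Ω`. -/
theorem VanishesAtBoundary.exists_truncSeq_eq_zero {Ω : Set M} {f : M → ℝ}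
    (h : VanishesAtBoundary Ω f) (k : ℕ) : ∃ K, IsCompact K ∧ K ⊆ Ω ∧
      ∀ x ∈ Ω, x ∉ K → truncSeq k (f x) = 0 ∧ deriv (truncSeq k) (f x) = 0 := by
  obtain ⟨K, hK, hKΩ, hfK⟩ := h (1 / ((k : ℝ) + 1)) (by positivity)
  exact ⟨K, hK, hKΩ, fun x hx hxK => truncSeq_eq_zero (hfK x hx hxK)⟩

/-- A Sobolev function vanishing at the boundary is a limit of test functions. -/
theorem IsWeakGradient.exists_testFunction_near (hφ : Continuous φ) {Ω : Set M}
    (hΩ : IsOpen Ω) (hΩc : IsCompact (closure Ω)) {f : M → ℝ}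
    {X : (x : M) → TangentSpace 𝓘(ℝ, Model n) x} (h : IsWeakGradient Ω f X)
    (hb : VanishesAtBoundary Ω f) {p : ℝ≥0∞} (hp1 : 1 ≤ p) (hp : p ≠ ⊤)
    (hf : MemLp f p ((weightedVolume n φ).restrict Ω))
    (hX : MemLp (fun x => ‖X x‖) p ((weightedVolume n φ).restrict Ω)) {ε : ℝ≥0∞} (hε : 0 < ε) :
    ∃ ψ, IsTestFunction n Ω ψ ∧
      eLpNorm (fun x => f x - ψ x) p ((weightedVolume n φ).restrict Ω) ≤ ε ∧
      eLpNorm (fun x => ‖X x - riemannianGradient ψ x‖) p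
        ((weightedVolume n φ).restrict Ω) ≤ ε := by
  set m := (weightedVolume n φ).restrict Ω with hm
  have hp0 : p ≠ 0 := (zero_lt_one.trans_le hp1).ne'
  obtain ⟨C, hC⟩ := exists_abs_deriv_smoothTrunc_le
  have hk : ∀ k, IsWeakGradient Ω (fun x => truncSeq k (f x))
      fun x => deriv (truncSeq k) (f x) • X x := fun k =>
    h.comp_contDiff hΩ (contDiff_truncSeq k) (C := C) fun s => by
      rw [deriv_truncSeq]; exact hC _
  have hfk : ∀ k, MemLp (fun x => truncSeq k (f x)) p m := fun k =>
    MemLp.mono hf ((contDiff_truncSeq k).continuous.comp_aestronglyMeasurable hf.1)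
      (Eventually.of_forall fun x => abs_truncSeq_le k (f x))
  have hXk : ∀ k, MemLp (fun x => ‖deriv (truncSeq k) (f x) • X x‖) p m := fun k =>
    MemLp.of_le_mul (c := C) hX
      ((hk k).isAEMeasurableField.aestronglyMeasurable_norm hφ hΩ.measurableSet)
      (Eventually.of_forall fun x => by
        rw [norm_norm, norm_norm, norm_smul, deriv_truncSeq]
        exact mul_le_mul_of_nonneg_right (hC _) (norm_nonneg _))
  -- By uniqueness X vanishes almost everywhere on the zero set of f, which is exactly where the
  -- truncated gradients fail to converge to X by themselves.
  have hXeq := h.ae_eq hφ hΩ (h.ite_zero hΩ)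
  have hδ : 0 < ε / 2 := ENNReal.half_pos hε.ne'
  have l1 : Tendsto (fun k => eLpNorm (fun x => f x - truncSeq k (f x)) p m) atTop (𝓝 0) := by
    refine tendsto_eLpNorm_zero_of_dominated hp0 hp (fun k => hf.1.sub (hfk k).1)
      (hf.norm.const_mul 2) (fun k => Eventually.of_forall fun x => ?_)
      (Eventually.of_forall fun x => ?_)
    · rw [norm_mul, norm_norm, Real.norm_ofNat]
      have := abs_truncSeq_le k (f x)
      have := norm_sub_le (f x) (truncSeq k (f x))
      simp only [Real.norm_eq_abs] at *
      linarith
    · have := (tendsto_const_nhds (x := f x)).sub (tendsto_truncSeq (f x)).1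
      rwa [sub_self] at this
  have hsm : ∀ k, IsAEMeasurableField Ω
      (fun x => X x - deriv (truncSeq k) (f x) • X x) := fun k =>
    h.isAEMeasurableField.sub (hk k).isAEMeasurableField
  have l2 : Tendsto (fun k => eLpNorm (fun x => ‖X x - deriv (truncSeq k) (f x) • X x‖) p m)
      atTop (𝓝 0) := by
    refine tendsto_eLpNorm_zero_of_dominated hp0 hp
      (fun k => (hsm k).aestronglyMeasurable_norm hφ hΩ.measurableSet)
      (hX.const_mul (1 + C)) (fun k => Eventually.of_forall fun x => ?_) ?_
    · have hC0 : 0 ≤ C := (abs_nonneg _).trans (hC 0)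
      rw [norm_norm, norm_mul, norm_norm, Real.norm_of_nonneg (by positivity), add_mul, one_mul]
      refine (norm_sub_le _ _).trans (add_le_add le_rfl ?_)
      rw [norm_smul, deriv_truncSeq]
      exact mul_le_mul_of_nonneg_right (hC _) (norm_nonneg _)
    · filter_upwards [hXeq] with x hx
      have h1 : Tendsto (fun k => |1 - deriv (truncSeq k) (f x)| * ‖X x‖) atTop
          (𝓝 (|1 - (if f x = 0 then (0 : ℝ) else 1)| * ‖X x‖)) :=
        ((tendsto_const_nhds.sub (tendsto_truncSeq (f x)).2).abs).mul_const _
      have h2 : |1 - (if f x = 0 then (0 : ℝ) else 1)| * ‖X x‖ = 0 := by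
        split_ifs at hx ⊢ with h0
        · rw [hx, zero_smul, norm_zero, mul_zero]
        · simp
      rw [h2] at h1
      refine h1.congr fun k => ?_
      have h3 : X x - deriv (truncSeq k) (f x) • X x = (1 - deriv (truncSeq k) (f x)) • X x := by
        rw [sub_smul, one_smul]
      rw [h3, norm_smul, Real.norm_eq_abs]
  obtain ⟨k, hk1, hk2⟩ := ((l1.eventually (gt_mem_nhds hδ)).and
    (l2.eventually (gt_mem_nhds hδ))).exists
  obtain ⟨K, hK, hKΩ, hKz⟩ := hb.exists_truncSeq_eq_zero k
  obtain ⟨ψ, hψ, hψ1, hψ2⟩ := (hk k).exists_testFunction_near_of_compact hφ hΩ hΩc hp1 hp (hfk k)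
    (hXk k) hK hKΩ (fun x hx hxK => ⟨(hKz x hx hxK).1, by rw [(hKz x hx hxK).2, zero_smul]⟩) hδ
  have hψg := isAEMeasurableField_riemannianGradient (n := n) hΩ.measurableSet hψ.1
  refine ⟨ψ, hψ, ?_, ?_⟩
  · have h1 : (fun x => f x - ψ x) =
        (fun x => f x - truncSeq k (f x)) + fun x => truncSeq k (f x) - ψ x := by
      ext x; simp
    rw [h1]
    refine (eLpNorm_add_le (hf.1.sub (hfk k).1)
      ((hfk k).1.sub hψ.1.continuous.aestronglyMeasurable) hp1).trans ?_
    exact (add_le_add hk1.le hψ1).trans (ENNReal.add_halves ε).le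
  · refine (eLpNorm_mono_real (g := (fun x => ‖X x - deriv (truncSeq k) (f x) • X x‖) +
      fun x => ‖deriv (truncSeq k) (f x) • X x - riemannianGradient ψ x‖) fun x => ?_).trans ?_
    · rw [norm_norm]
      exact norm_sub_le_norm_sub_add_norm_sub _ _ _
    · refine (eLpNorm_add_le ((hsm k).aestronglyMeasurable_norm hφ hΩ.measurableSet)
        (((hk k).isAEMeasurableField.sub hψg).aestronglyMeasurable_norm hφ hΩ.measurableSet)
        hp1).trans ?_
      exact (add_le_add hk2.le hψ2).trans (ENNReal.add_halves ε).le

end ZeroBoundary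

end

/-! ### Functions with vanishing weak gradient. -/

noncomputable section

section ZeroGradient

theorem HasWeakDerivOn.zero_of_ae {n : ℕ} {O : Set (Model n)} (hO : IsOpen O)
    {f g : Model n → ℝ} {w : Model n} (h : HasWeakDerivOn O f w g)
    (hg : ∀ᵐ y ∂(volume.restrict O), g y = 0) : HasWeakDerivOn O f w 0 := by
  refine ⟨h.1, locallyIntegrableOn_zero, fun η hη hc hs => ?_⟩
  rw [h.3 η hη hc hs]
  congr 1
  refine integral_congr_ae ?_
  filter_upwards [(ae_restrict_iff' hO.measurableSet).1 hg] with y hy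
  by_cases hyO : y ∈ O
  · rw [hy hyO, Pi.zero_apply]
  · rw [image_eq_zero_of_notMem_tsupport fun h => hyO (hs h), mul_zero, mul_zero]

variable {n : ℕ} {M : Type*} [TopologicalSpace M] [T2Space M] [SecondCountableTopology M]
  [MeasurableSpace M] [BorelSpace M]
  [ChartedSpace (Model n) M] [IsManifold 𝓘(ℝ, Model n) ∞ M]
  [RiemannianBundle (fun x : M => TangentSpace 𝓘(ℝ, Model n) x)]
  [IsContMDiffRiemannianBundle 𝓘(ℝ, Model n) ∞ (Model n)
      (fun x : M => TangentSpace 𝓘(ℝ, Model n) x)]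
  {φ : M → ℝ}

/-- Two almost everywhere constant values on overlapping open sets must therefore agree, and a
continuous function that is zero almost everywhere is zero. -/
theorem weightedVolume_ne_zero_of_isOpen (hφ : Continuous φ) {W : Set M} (hW : IsOpen W)
    (hne : W.Nonempty) : weightedVolume n φ W ≠ 0 := by
  intro h0
  obtain ⟨x, hx⟩ := hne
  set e := chartAt (Model n) x with hedef
  have he : e ∈ atlas (Model n) M := chart_mem_atlas (Model n) x
  have h1 : ∀ᵐ _x ∂((weightedVolume n φ).restrict W), False := by
    rw [Measure.restrict_eq_zero.2 h0]
    exact ae_zero ▸ trivial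
  have h2 := ae_chart_of_ae hφ hW.measurableSet he h1
  have h3 : volume (e.target ∩ e.symm ⁻¹' W) = 0 := by
    rw [← Measure.restrict_eq_zero, ← ae_eq_bot]
    exact eventually_false_iff_eq_bot.1 h2
  have hxe : x ∈ e.source := mem_chart_source (Model n) x
  refine ((isOpen_chart_preimage hW e).measure_pos volume ⟨e x, e.map_source hxe, ?_⟩).ne' h3
  rw [Set.mem_preimage, e.left_inv hxe]
  exact hx

/-- Near a point of `Ω`, a function with vanishing weak gradient is constant. -/
theorem IsWeakGradient.exists_locally_const (hφ : Continuous φ) {Ω : Set M}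
    (hΩ : IsOpen Ω) {f : M → ℝ} {X : (x : M) → TangentSpace 𝓘(ℝ, Model n) x}
    (h : IsWeakGradient Ω f X) (hX : ∀ᵐ x ∂((weightedVolume n φ).restrict Ω), X x = 0) {x : M}
    (hx : x ∈ Ω) : ∃ V, IsOpen V ∧ x ∈ V ∧ V ⊆ Ω ∧ ∃ c : ℝ,
      ∀ᵐ z ∂(weightedVolume n φ), z ∈ V → f z = c := by
  set e := chartAt (Model n) x with hedef
  have he : e ∈ atlas (Model n) M := chart_mem_atlas (Model n) x
  have hxe : x ∈ e.source := mem_chart_source (Model n) x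
  have hO := isOpen_chart_preimage hΩ e
  have hxO : e x ∈ e.target ∩ e.symm ⁻¹' Ω := by
    refine ⟨e.map_source hxe, ?_⟩
    rw [Set.mem_preimage, e.left_inv hxe]
    exact hx
  obtain ⟨R, hR, hRO⟩ := Metric.nhds_basis_closedBall.mem_iff.1 (hO.mem_nhds hxO)
  have hw : ∀ w, HasWeakDerivOn (e.target ∩ e.symm ⁻¹' Ω) (fun y => f (e.symm y)) w 0 := fun w =>
    (isWeakGradient_iff.1 h e he w).zero_of_ae hO (by
      filter_upwards [ae_chart_of_ae hφ hΩ.measurableSet he hX] with y hy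
      rw [hy, inner_zero_left])
  obtain ⟨c, hc⟩ := exists_ae_eq_const_of_weakDeriv_zero hO hw hRO
  set V := e.source ∩ e ⁻¹' Metric.ball (e x) R with hV
  have hVo : IsOpen V := e.isOpen_inter_preimage Metric.isOpen_ball
  refine ⟨V, hVo, ⟨hxe, Metric.mem_ball_self hR⟩, fun z hz => ?_, c, ?_⟩
  · have := (hRO (Metric.ball_subset_closedBall hz.2)).2
    rwa [Set.mem_preimage, e.left_inv hz.1] at this
  · have h1 : ∀ᵐ z ∂((chartLebesgue e).restrict Set.univ), z ∈ V → f z = c := by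
      rw [ae_chartLebesgue_restrict_iff,
        ae_restrict_iff' (measurableSet_target_inter_preimage e MeasurableSet.univ)]
      filter_upwards [hc] with y hy hyt hyV
      have h3 := hyV.2
      rw [Set.mem_preimage, e.right_inv hyt.1] at h3
      exact hy h3
    rw [Measure.restrict_univ] at h1
    have h2 : ∀ᵐ z ∂((weightedVolume n φ).restrict e.source), z ∈ V → f z = c :=
      (weightedVolume_restrict_ac_chartLebesgue hφ he).ae_le h1
    rw [ae_restrict_iff' e.open_source.measurableSet] at h2
    filter_upwards [h2] with z hz hzV
    exact hz hzV.1 hzV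

/-- On a proper open subset of a connected manifold, a function with vanishing weak gradient which
vanishes off a compact subset is zero. -/
theorem IsWeakGradient.ae_eq_zero_of_compact [ConnectedSpace M] (hφ : Continuous φ) {Ω : Set M}
    (hΩ : IsOpen Ω) (hΩM : Ω ≠ Set.univ) {f : M → ℝ}
    {X : (x : M) → TangentSpace 𝓘(ℝ, Model n) x}
    (h : IsWeakGradient Ω f X) (hX : ∀ᵐ x ∂((weightedVolume n φ).restrict Ω), X x = 0)
    {K : Set M} (hK : IsCompact K) (hKΩ : K ⊆ Ω) (hfK : ∀ x ∈ Ω, x ∉ K → f x = 0) :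
    ∀ᵐ x ∂((weightedVolume n φ).restrict Ω), f x = 0 := by
  -- Connectedness of M, not of Ω, is used: the points near which f vanishes almost everywhere
  -- within Ω include all points outside K, in particular those outside Ω.
  set A : Set M := {x | ∃ U, IsOpen U ∧ x ∈ U ∧
    ∀ᵐ z ∂(weightedVolume n φ), z ∈ U → z ∈ Ω → f z = 0} with hA
  have hKA : Kᶜ ⊆ A := fun x hx => ⟨Kᶜ, hK.isClosed.isOpen_compl, hx,
    Eventually.of_forall fun z hz hzΩ => hfK z hzΩ hz⟩
  have hAo : IsOpen A := isOpen_iff_forall_mem_open.2 fun x ⟨U, hU, hxU, hz⟩ =>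
    ⟨U, fun y hy => ⟨U, hU, hy, hz⟩, hU, hxU⟩
  -- At a limit point of A in K the function is almost everywhere a constant c nearby. That
  -- neighbourhood meets an open set where f vanishes, in positive measure, so c = 0.
  have hAc : IsClosed A := by
    refine isClosed_of_closure_subset fun x hx => ?_
    by_cases hxK : x ∈ K
    · obtain ⟨V, hV, hxV, hVΩ, c, hc⟩ := h.exists_locally_const hφ hΩ hX (hKΩ hxK)
      obtain ⟨y, hyV, U, hU, hyU, hz⟩ := mem_closure_iff.1 hx V hV hxV
      have hc0 : c = 0 := by
        by_contra hne
        refine weightedVolume_ne_zero_of_isOpen (n := n) hφ (hV.inter hU) ⟨y, hyV, hyU⟩ ?_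
        refine measure_mono_null (fun z hzm => ?_) (hc.and hz : ∀ᵐ z ∂_, _)
        exact fun hh => hne ((hh.1 hzm.1).symm.trans (hh.2 hzm.2 (hVΩ hzm.1)))
      refine ⟨V, hV, hxV, ?_⟩
      filter_upwards [hc] with z hz hzV _
      rw [hz hzV, hc0]
    · exact hKA hxK
  have huniv : A = Set.univ := by
    refine IsClopen.eq_univ ⟨hAc, hAo⟩ ?_
    obtain ⟨x, hx⟩ := (Set.ne_univ_iff_exists_notMem Ω).1 hΩM
    exact ⟨x, hKA fun hxK => hx (hKΩ hxK)⟩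
  rw [ae_restrict_iff' hΩ.measurableSet]
  refine measure_null_of_locally_null _ fun x _ => ?_
  obtain ⟨U, hU, hxU, hz⟩ : x ∈ A := huniv ▸ Set.mem_univ x
  refine ⟨_, inter_mem_nhdsWithin _ (hU.mem_nhds hxU), ?_⟩
  refine measure_mono_null (fun z hzm => ?_) hz
  exact fun hh => hzm.1 (hh hzm.2)

/-- Sobolev functions with zero boundary values and vanishing gradient are zero. -/
theorem IsWeakGradient.ae_eq_zero [ConnectedSpace M] (hφ : Continuous φ) {Ω : Set M}
    (hΩ : IsOpen Ω) (hΩM : Ω ≠ Set.univ) {f : M → ℝ}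
    {X : (x : M) → TangentSpace 𝓘(ℝ, Model n) x}
    (h : IsWeakGradient Ω f X) (hX : ∀ᵐ x ∂((weightedVolume n φ).restrict Ω), X x = 0)
    (hb : VanishesAtBoundary Ω f) :
    ∀ᵐ x ∂((weightedVolume n φ).restrict Ω), f x = 0 := by
  obtain ⟨C, hC⟩ := exists_abs_deriv_smoothTrunc_le
  -- Each truncation has compact support in Ω and zero gradient, so it vanishes; f is the limit of
  -- its truncations.
  have hk : ∀ k, ∀ᵐ x ∂((weightedVolume n φ).restrict Ω), truncSeq k (f x) = 0 := fun k => by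
    obtain ⟨K, hK, hKΩ, hKz⟩ := hb.exists_truncSeq_eq_zero k
    refine (h.comp_contDiff hΩ (contDiff_truncSeq k) (C := C) fun s => by
      rw [deriv_truncSeq]; exact hC _).ae_eq_zero_of_compact hφ hΩ hΩM ?_ hK hKΩ
      fun x hx hxK => (hKz x hx hxK).1
    filter_upwards [hX] with x hx
    rw [hx, smul_zero]
  filter_upwards [ae_all_iff.2 hk] with x hx
  have := (tendsto_truncSeq (f x)).1
  simp only [hx] at this
  exact (tendsto_nhds_unique tendsto_const_nhds this).symm

end ZeroGradient

end

/-! ### Hölder and Young pairings, and differentiable curves in Lebesgue spaces. -/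

noncomputable section

section Holder

variable {α : Type*} {mα : MeasurableSpace α} {μ : Measure α} {p r : ℝ}

theorem holderTriple_ofReal (h : r.HolderConjugate p) :
    ENNReal.HolderTriple (ENNReal.ofReal r) (ENNReal.ofReal p) 1 := h.ennrealOfReal

theorem integrable_mul_of_holder (h : r.HolderConjugate p) {a b : α → ℝ}
    (ha : MemLp a (ENNReal.ofReal r) μ) (hb : MemLp b (ENNReal.ofReal p) μ) :
    Integrable (fun x => a x * b x) μ :=
  haveI := holderTriple_ofReal h
  ha.integrable_mul hb

theorem enorm_integral_mul_le (h : r.HolderConjugate p) {a b : α → ℝ}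
    (ha : AEStronglyMeasurable a μ) (hb : AEStronglyMeasurable b μ) :
    ‖∫ x, a x * b x ∂μ‖ₑ ≤ eLpNorm a (ENNReal.ofReal r) μ * eLpNorm b (ENNReal.ofReal p) μ := by
  have := holderTriple_ofReal h
  refine (enorm_integral_le_lintegral_enorm _).trans ?_
  rw [← eLpNorm_one_eq_lintegral_enorm]
  change eLpNorm (a • b) 1 μ ≤ _
  exact eLpNorm_smul_le_mul_eLpNorm hb ha

theorem tendsto_zero_of_enorm_le {ι : Type*} {l : Filter ι} {c : ι → ℝ} {a : ι → ℝ≥0∞}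
    (h : ∀ᶠ i in l, ‖c i‖ₑ ≤ a i) (ha : Tendsto a l (𝓝 0)) : Tendsto c l (𝓝 0) := by
  rw [tendsto_zero_iff_enorm_tendsto_zero]
  exact tendsto_of_tendsto_of_tendsto_of_le_of_le' tendsto_const_nhds ha
    (Eventually.of_forall fun _ => zero_le) h

/-- Young's inequality with a parameter, integrated. -/
theorem mul_integral_mul_le (h : r.HolderConjugate p) {a b : α → ℝ}
    (ha : MemLp a (ENNReal.ofReal r) μ) (hb : MemLp b (ENNReal.ofReal p) μ) {c : ℝ} (hc : 0 < c) :
    c * ∫ x, a x * b x ∂μ ≤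
      (∫ x, |a x| ^ r ∂μ) / r + c ^ p * (∫ x, |b x| ^ p ∂μ) / p := by
  have hr0 : 0 < r := h.pos
  have hp0 : 0 < p := h.symm.pos
  have i1 : Integrable (fun x => |a x| ^ r) μ := by
    have := ha.integrable_norm_rpow (by simpa using hr0) ENNReal.ofReal_ne_top
    rwa [ENNReal.toReal_ofReal hr0.le] at this
  have i2 : Integrable (fun x => |b x| ^ p) μ := by
    have := hb.integrable_norm_rpow (by simpa using hp0) ENNReal.ofReal_ne_top
    rwa [ENNReal.toReal_ofReal hp0.le] at this
  rw [← integral_const_mul, ← integral_const_mul, ← integral_div, ← integral_div,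
    ← integral_add (i1.div_const r) ((i2.const_mul _).div_const p)]
  refine integral_mono ((integrable_mul_of_holder h ha hb).const_mul c)
    ((i1.div_const r).add ((i2.const_mul _).div_const p)) fun x => ?_
  have h1 := Real.young_inequality (a x) (c * b x) h
  rw [abs_mul, abs_of_pos hc, Real.mul_rpow hc.le (abs_nonneg _)] at h1
  calc c * (a x * b x) = a x * (c * b x) := by ring
    _ ≤ _ := h1

end Holder

section Curve

variable {α : Type*} {mα : MeasurableSpace α} {μ : Measure α} {p r : ℝ}

theorem memLp_differenceQuotient_sub {q : ℝ≥0∞} {f g w : α → ℝ} (hf : MemLp f q μ)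
    (hg : MemLp g q μ) (hw : MemLp w q μ) (k : ℝ) :
    MemLp (fun x => (f x - g x) / k - w x) q μ := by
  simpa only [div_eq_mul_inv] using! ((hf.sub hg).mul_const k⁻¹).sub hw

/-- The pairing of a differentiable `L^r` curve with a fixed `L^p` function is differentiable. -/
theorem hasDerivAt_integral_mul (h : r.HolderConjugate p) {u : ℝ → α → ℝ} {w b : α → ℝ} {t : ℝ}
    (hu : ∀ᶠ s in 𝓝 t, MemLp (u s) (ENNReal.ofReal r) μ) (hw : MemLp w (ENNReal.ofReal r) μ)
    (hb : MemLp b (ENNReal.ofReal p) μ)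
    (hd : Tendsto (fun k : ℝ => eLpNorm (fun x => (u (t + k) x - u t x) / k - w x)
      (ENNReal.ofReal r) μ) (𝓝[≠] 0) (𝓝 0)) :
    HasDerivAt (fun s => ∫ x, u s x * b x ∂μ) (∫ x, w x * b x ∂μ) t := by
  rw [hasDerivAt_iff_tendsto_slope_zero, ← tendsto_sub_nhds_zero_iff]
  have hut := hu.self_of_nhds
  have hu' : ∀ᶠ k in 𝓝[≠] (0 : ℝ), MemLp (u (t + k)) (ENNReal.ofReal r) μ := by
    have h1 : Tendsto (fun k : ℝ => t + k) (𝓝[≠] 0) (𝓝 t) := by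
      have : Tendsto (fun k : ℝ => t + k) (𝓝 0) (𝓝 (t + 0)) := (continuous_const_add t).tendsto 0
      rw [add_zero] at this
      exact this.mono_left nhdsWithin_le_nhds
    exact h1.eventually hu
  have hlim := ENNReal.Tendsto.mul_const (b := eLpNorm b (ENNReal.ofReal p) μ) hd
    (Or.inr hb.2.ne)
  rw [zero_mul] at hlim
  refine tendsto_zero_of_enorm_le ?_ hlim
  filter_upwards [hu'] with k hk
  have e : k⁻¹ • ((∫ x, u (t + k) x * b x ∂μ) - ∫ x, u t x * b x ∂μ) - (∫ x, w x * b x ∂μ) =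
      ∫ x, ((u (t + k) x - u t x) / k - w x) * b x ∂μ := by
    have i1 := integrable_mul_of_holder h hk hb
    have i2 := integrable_mul_of_holder h hut hb
    have i3 := integrable_mul_of_holder h hw hb
    have i4 : Integrable (fun x => k⁻¹ * (u (t + k) x * b x - u t x * b x)) μ :=
      (i1.sub i2).const_mul k⁻¹
    rw [← integral_sub i1 i2, smul_eq_mul, ← integral_const_mul,
      ← integral_sub i4 i3]
    congr 1
    ext x
    ring
  rw [e]
  refine enorm_integral_mul_le h ?_ hb.1
  exact (memLp_differenceQuotient_sub hk hut hw k).1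

/-- The increment of the curve is k times the sum of w and an error tending to 0 in L^r, so the
curve is continuous in L^r and its norm varies continuously. -/
theorem continuousAt_integral_rpow (hr : 1 ≤ r) {u : ℝ → α → ℝ} {w : α → ℝ} {t : ℝ}
    (hu : ∀ᶠ s in 𝓝 t, MemLp (u s) (ENNReal.ofReal r) μ) (hw : MemLp w (ENNReal.ofReal r) μ)
    (hd : Tendsto (fun k : ℝ => eLpNorm (fun x => (u (t + k) x - u t x) / k - w x)
      (ENNReal.ofReal r) μ) (𝓝[≠] 0) (𝓝 0)) :
    ContinuousAt (fun s => ∫ x, |u s x| ^ r ∂μ) t := by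
  have hr0 : 0 < r := zero_lt_one.trans_le hr
  have hr1 : 1 ≤ ENNReal.ofReal r := ENNReal.one_le_ofReal.2 hr
  have hut := hu.self_of_nhds
  have hN : ∀ s, MemLp (u s) (ENNReal.ofReal r) μ →
      ∫ x, |u s x| ^ r ∂μ = (eLpNorm (u s) (ENNReal.ofReal r) μ).toReal ^ r := fun s hs => by
    have h0 : 0 ≤ ∫ x, |u s x| ^ r ∂μ := integral_nonneg fun x => by positivity
    rw [hs.eLpNorm_eq_integral_rpow_norm (by simpa using hr0) ENNReal.ofReal_ne_top,
      ENNReal.toReal_ofReal hr0.le]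
    simp only [Real.norm_eq_abs]
    rw [ENNReal.toReal_ofReal (by positivity), ← Real.rpow_mul h0, inv_mul_cancel₀ hr0.ne',
      Real.rpow_one]
  have hu' : ∀ᶠ k in 𝓝 (0 : ℝ), MemLp (u (t + k)) (ENNReal.ofReal r) μ := by
    have h1 : Tendsto (fun k : ℝ => t + k) (𝓝 0) (𝓝 (t + 0)) := (continuous_const_add t).tendsto 0
    rw [add_zero] at h1
    exact h1.eventually hu
  have hdiff : Tendsto (fun k : ℝ => eLpNorm (fun x => u (t + k) x - u t x) (ENNReal.ofReal r) μ)
      (𝓝[≠] 0) (𝓝 0) := by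
    have hk0 : Tendsto (fun k : ℝ => ‖k‖ₑ) (𝓝[≠] 0) (𝓝 0) := by
      have := (continuous_enorm (E := ℝ)).tendsto 0
      rw [enorm_zero] at this
      exact this.mono_left nhdsWithin_le_nhds
    have h1 := ENNReal.Tendsto.mul hk0 (Or.inr (by simp [hw.2.ne])) (hd.add
      (tendsto_const_nhds (x := eLpNorm w (ENNReal.ofReal r) μ))) (Or.inr ENNReal.zero_ne_top)
    rw [zero_add, zero_mul] at h1
    refine tendsto_of_tendsto_of_tendsto_of_le_of_le' tendsto_const_nhds h1
      (Eventually.of_forall fun _ => zero_le) ?_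
    filter_upwards [hu'.filter_mono nhdsWithin_le_nhds, self_mem_nhdsWithin] with k hk hk0
    have e : (fun x => u (t + k) x - u t x) =
        k • ((fun x => (u (t + k) x - u t x) / k - w x) + w) := by
      ext x
      have : k ≠ 0 := hk0
      simp only [Pi.smul_apply, Pi.add_apply, smul_eq_mul]
      field_simp
      ring
    rw [e, eLpNorm_const_smul]
    exact mul_le_mul_right (eLpNorm_add_le (memLp_differenceQuotient_sub hk hut hw k).1 hw.1 hr1) _
  have hc : ContinuousAt (fun s => (eLpNorm (u s) (ENNReal.ofReal r) μ).toReal) t := by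
    have : Fact (1 ≤ ENNReal.ofReal r) := ⟨hr1⟩
    have h1 : Tendsto (fun k : ℝ => eLpNorm (fun x => u (t + k) x - u t x)
        (ENNReal.ofReal r) μ) (𝓝 0) (𝓝 0) := by
      have h2 : ContinuousAt (fun k : ℝ => eLpNorm (fun x => u (t + k) x - u t x)
          (ENNReal.ofReal r) μ) 0 := by
        rw [← continuousWithinAt_compl_self, ContinuousWithinAt]
        simpa using hdiff
      simpa [ContinuousAt] using h2
    rw [ContinuousAt, ← map_add_left_nhds_zero, tendsto_map'_iff, ← tendsto_sub_nhds_zero_iff]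
    refine tendsto_zero_of_enorm_le ?_ h1
    filter_upwards [hu'] with k hk
    have h3 := abs_norm_sub_norm_le (hk.toLp (u (t + k))) (hut.toLp (u t))
    rw [← MemLp.toLp_sub, Lp.norm_toLp, Lp.norm_toLp, Lp.norm_toLp] at h3
    rw [← ofReal_norm, Real.norm_eq_abs]
    exact (ENNReal.ofReal_le_ofReal h3).trans (ENNReal.ofReal_toReal (hk.sub hut).2.ne).le
  refine (hc.rpow_const (Or.inr hr0.le)).congr ?_
  filter_upwards [hu] with s hs
  exact (hN s hs).symm

end Curve

end

/-! ### Signed powers, and testing the equation with Sobolev functions. -/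

noncomputable section

section SignedPow

theorem abs_signedPow {q : ℝ} (hq : 0 < q) (s : ℝ) : |signedPow q s| = |s| ^ q := by
  rcases eq_or_ne s 0 with rfl | hs
  · simp [signedPow, Real.zero_rpow hq.ne']
  · rw [signedPow, abs_mul, abs_of_nonneg (by positivity)]
    nth_rewrite 2 [← Real.rpow_one |s|]
    rw [← Real.rpow_add (abs_pos.2 hs), sub_add_cancel]

theorem mul_signedPow {q : ℝ} (hq : 0 < q) (s : ℝ) : s * signedPow q s = |s| ^ (q + 1) := by
  rcases eq_or_ne s 0 with rfl | hs
  · simp [signedPow, Real.zero_rpow (by positivity : q + 1 ≠ 0)]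
  · have h1 : s * signedPow q s = |s| ^ (q - 1) * |s| ^ (2 : ℝ) := by
      rw [signedPow, Real.rpow_two, sq_abs]; ring
    rw [h1, ← Real.rpow_add (abs_pos.2 hs)]
    congr 1; ring

theorem continuousAt_signedPow_zero {q : ℝ} (hq : 0 < q) : ContinuousAt (signedPow q) 0 := by
  have h1 : Tendsto (fun s : ℝ => |s| ^ q) (𝓝 0) (𝓝 0) := by
    have h2 : Continuous fun s : ℝ => |s| ^ q := continuous_abs.rpow_const fun _ => Or.inr hq.le
    have := h2.tendsto 0
    rwa [abs_zero, Real.zero_rpow hq.ne'] at this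
  have h0 : signedPow q 0 = 0 := by simp [signedPow]
  rw [ContinuousAt, h0]
  exact squeeze_zero_norm (fun s => by rw [Real.norm_eq_abs, abs_signedPow hq]) h1

theorem measurable_signedPow (q : ℝ) : Measurable (signedPow q) := by
  unfold signedPow
  exact (measurable_norm.pow_const (q - 1)).mul measurable_id

/-- By q p = q + 1, the p-th power of |f|^q is |f|^{q+1}. -/
theorem memLp_signedPow {α : Type*} {mα : MeasurableSpace α} {μ : Measure α} {p q : ℝ}
    (hq : 0 < q) (hpq : q * p = q + 1) {f : α → ℝ} (hf : MemLp f (ENNReal.ofReal (q + 1)) μ) :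
    MemLp (fun x => signedPow q (f x)) (ENNReal.ofReal p) μ := by
  have h1 := hf.norm_rpow_div (ENNReal.ofReal q)
  rw [ENNReal.toReal_ofReal hq.le, ← ENNReal.ofReal_div_of_pos hq, ← hpq,
    mul_div_cancel_left₀ _ hq.ne'] at h1
  refine h1.mono ((measurable_signedPow q).comp_aemeasurable
    hf.1.aemeasurable).aestronglyMeasurable (Eventually.of_forall fun x => ?_)
  rw [Real.norm_eq_abs, abs_signedPow hq, Real.norm_eq_abs, Real.norm_eq_abs]
  exact le_abs_self _

end SignedPow

section Flux

variable {n : ℕ} {M : Type*} [TopologicalSpace M] [T2Space M] [SecondCountableTopology M]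
  [MeasurableSpace M] [BorelSpace M]
  [ChartedSpace (Model n) M] [IsManifold 𝓘(ℝ, Model n) ∞ M]
  [RiemannianBundle (fun x : M => TangentSpace 𝓘(ℝ, Model n) x)]
  [IsContMDiffRiemannianBundle 𝓘(ℝ, Model n) ∞ (Model n)
      (fun x : M => TangentSpace 𝓘(ℝ, Model n) x)]
  {φ : M → ℝ} {Ω : Set M} {p r : ℝ}

/-- The component of `Y` in the direction of `X`. -/
def componentAlong (X Y : (x : M) → TangentSpace 𝓘(ℝ, Model n) x) (x : M) : ℝ :=
  inner ℝ (X x) (Y x) / ‖X x‖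

theorem abs_componentAlong_le (X Y : (x : M) → TangentSpace 𝓘(ℝ, Model n) x) (x : M) :
    |componentAlong X Y x| ≤ ‖Y x‖ := by
  rw [componentAlong, abs_div, abs_norm]
  refine div_le_of_le_mul₀ (norm_nonneg _) (norm_nonneg _) ?_
  rw [mul_comm]
  exact abs_real_inner_le_norm _ _

theorem componentAlong_sub (X Y Z : (x : M) → TangentSpace 𝓘(ℝ, Model n) x) (x : M) :
    componentAlong X (fun x => Y x - Z x) x = componentAlong X Y x - componentAlong X Z x := by
  rw [componentAlong, componentAlong, componentAlong, inner_sub_right, sub_div]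

/-- The flux pairing becomes a product of a function in the dual exponent and a component in L^p, so
scalar Hölder and Young apply. Where X = 0 both sides are 0, whatever the sign of p - 2. -/
theorem rpow_mul_componentAlong (X Y : (x : M) → TangentSpace 𝓘(ℝ, Model n) x) (x : M) :
    ‖X x‖ ^ (p - 1) * componentAlong X Y x = ‖X x‖ ^ (p - 2) * inner ℝ (X x) (Y x) := by
  rcases eq_or_ne (X x) 0 with h | h
  · simp [componentAlong, h]
  · have h1 : p - 1 = (p - 2) + 1 := by ring
    rw [componentAlong, h1, Real.rpow_add_one (norm_ne_zero_iff.2 h)]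
    have := norm_ne_zero_iff.2 h
    field_simp

theorem IsAEMeasurableField.memLp_componentAlong (hφ : Continuous φ) (hΩ : MeasurableSet Ω)
    {X Y : (x : M) → TangentSpace 𝓘(ℝ, Model n) x} (hX : IsAEMeasurableField Ω X)
    (hY : IsAEMeasurableField Ω Y) {s : ℝ≥0∞}
    (hYs : MemLp (fun x => ‖Y x‖) s ((weightedVolume n φ).restrict Ω)) :
    MemLp (componentAlong X Y) s ((weightedVolume n φ).restrict Ω) :=
  hYs.mono ((hX.aestronglyMeasurable_inner hφ hΩ hY).aemeasurable.div
    (hX.aestronglyMeasurable_norm hφ hΩ).aemeasurable).aestronglyMeasurable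
    (Eventually.of_forall fun x => by
      rw [norm_norm]; exact abs_componentAlong_le X Y x)

theorem memLp_rpow_sub_one {α : Type*} {mα : MeasurableSpace α} {μ : Measure α}
    (h : r.HolderConjugate p) {f : α → ℝ} (hf0 : ∀ x, 0 ≤ f x)
    (hf : MemLp f (ENNReal.ofReal p) μ) : MemLp (fun x => f x ^ (p - 1)) (ENNReal.ofReal r) μ := by
  have hp : 0 < p - 1 := sub_pos.2 h.symm.lt
  have h1 := hf.norm_rpow_div (ENNReal.ofReal (p - 1))
  rw [ENNReal.toReal_ofReal hp.le, ← ENNReal.ofReal_div_of_pos hp, ← h.symm.conjugate_eq] at h1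
  simpa only [Real.norm_of_nonneg (hf0 _)] using h1

/-- The weak `p`-Laplace equation may be tested with Sobolev functions vanishing at the
boundary. -/
theorem IsWeakPLaplacian.integral_mul_eq (hφ : Continuous φ) (hΩ : IsOpen Ω)
    (hΩc : IsCompact (closure Ω)) (hc : r.HolderConjugate p)
    {w : M → ℝ} {X : (x : M) → TangentSpace 𝓘(ℝ, Model n) x} (heq : IsWeakPLaplacian φ Ω p X w)
    (hX : IsAEMeasurableField Ω X)
    (hXp : MemLp (fun x => ‖X x‖) (ENNReal.ofReal p) ((weightedVolume n φ).restrict Ω))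
    (hw : MemLp w (ENNReal.ofReal r) ((weightedVolume n φ).restrict Ω))
    {f : M → ℝ} {Y : (x : M) → TangentSpace 𝓘(ℝ, Model n) x} (h : IsWeakGradient Ω f Y)
    (hb : VanishesAtBoundary Ω f)
    (hf : MemLp f (ENNReal.ofReal p) ((weightedVolume n φ).restrict Ω))
    (hY : MemLp (fun x => ‖Y x‖) (ENNReal.ofReal p) ((weightedVolume n φ).restrict Ω)) :
    ∫ x in Ω, w x * f x ∂(weightedVolume n φ) =
      -∫ x in Ω, ‖X x‖ ^ (p - 1) * componentAlong X Y x ∂(weightedVolume n φ) := by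
  set m := (weightedVolume n φ).restrict Ω with hm
  have hp1 : 1 ≤ ENNReal.ofReal p := ENNReal.one_le_ofReal.2 hc.symm.lt.le
  have hYm := h.isAEMeasurableField
  have ha : MemLp (fun x => ‖X x‖ ^ (p - 1)) (ENNReal.ofReal r) m :=
    memLp_rpow_sub_one hc (fun _ => norm_nonneg _) hXp
  have hβ := hX.memLp_componentAlong hφ hΩ.measurableSet hYm hY
  -- Test functions within 1/(k+1) of f in W^{1,p}. The equation is linear in the test function, and
  -- both sides are continuous by Hölder, so the identity passes to the limit.
  have hex := fun k : ℕ => h.exists_testFunction_near hφ hΩ hΩc hb hp1 ENNReal.ofReal_ne_top hf hY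
    (ε := ((k + 1 : ℕ) : ℝ≥0∞)⁻¹) (ENNReal.inv_pos.2 (ENNReal.natCast_ne_top _))
  choose ψ hψ hψ1 hψ2 using hex
  have hfin : ∀ k : ℕ, ((k + 1 : ℕ) : ℝ≥0∞)⁻¹ < ⊤ := fun k => by
    rw [ENNReal.inv_lt_top]; exact_mod_cast Nat.succ_pos k
  have hlim0 : Tendsto (fun k : ℕ => ((k + 1 : ℕ) : ℝ≥0∞)⁻¹) atTop (𝓝 0) :=
    ENNReal.tendsto_inv_nat_nhds_zero.comp (tendsto_add_atTop_nat 1)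
  set A := eLpNorm w (ENNReal.ofReal r) m with hA
  set B := eLpNorm (fun x => ‖X x‖ ^ (p - 1)) (ENNReal.ofReal r) m with hB
  have hlim : Tendsto (fun k : ℕ => A * ((k + 1 : ℕ) : ℝ≥0∞)⁻¹ + B * ((k + 1 : ℕ) : ℝ≥0∞)⁻¹)
      atTop (𝓝 0) := by
    have := (ENNReal.Tendsto.const_mul hlim0 (Or.inr hw.2.ne)).add
      (ENNReal.Tendsto.const_mul hlim0 (Or.inr ha.2.ne))
    simpa using this
  have key : ∀ k : ℕ, ‖(∫ x, w x * f x ∂m) + ∫ x, ‖X x‖ ^ (p - 1) * componentAlong X Y x ∂m‖ₑ ≤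
      A * ((k + 1 : ℕ) : ℝ≥0∞)⁻¹ + B * ((k + 1 : ℕ) : ℝ≥0∞)⁻¹ := fun k => by
    have hψg := isAEMeasurableField_riemannianGradient (n := n) hΩ.measurableSet (hψ k).1
    have d1 : MemLp (fun x => f x - ψ k x) (ENNReal.ofReal p) m :=
      ⟨hf.1.sub (hψ k).1.continuous.aestronglyMeasurable, (hψ1 k).trans_lt (hfin k)⟩
    have d2 : MemLp (fun x => ‖Y x - riemannianGradient (ψ k) x‖) (ENNReal.ofReal p) m :=
      ⟨(hYm.sub hψg).aestronglyMeasurable_norm hφ hΩ.measurableSet, (hψ2 k).trans_lt (hfin k)⟩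
    have d3 := hX.memLp_componentAlong hφ hΩ.measurableSet (hYm.sub hψg) d2
    have e0 := heq (ψ k) (hψ k)
    simp only [← rpow_mul_componentAlong (p := p) X (riemannianGradient (ψ k))] at e0
    have e1 : ∫ x, w x * ψ k x ∂m = (∫ x, w x * f x ∂m) - ∫ x, w x * (f x - ψ k x) ∂m := by
      rw [← integral_sub (integrable_mul_of_holder hc hw hf) (integrable_mul_of_holder hc hw d1)]
      congr 1; ext x; ring
    have e2 : ∫ x, ‖X x‖ ^ (p - 1) * componentAlong X (riemannianGradient (ψ k)) x ∂m =
        (∫ x, ‖X x‖ ^ (p - 1) * componentAlong X Y x ∂m) - ∫ x, ‖X x‖ ^ (p - 1) *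
          componentAlong X (fun x => Y x - riemannianGradient (ψ k) x) x ∂m := by
      rw [← integral_sub (integrable_mul_of_holder hc ha hβ) (integrable_mul_of_holder hc ha d3)]
      congr 1; ext x; rw [componentAlong_sub]; ring
    rw [e1, e2] at e0
    have e3 : (∫ x, w x * f x ∂m) + ∫ x, ‖X x‖ ^ (p - 1) * componentAlong X Y x ∂m =
        (∫ x, w x * (f x - ψ k x) ∂m) + ∫ x, ‖X x‖ ^ (p - 1) *
          componentAlong X (fun x => Y x - riemannianGradient (ψ k) x) x ∂m := by
      linarith
    rw [e3]
    refine (enorm_add_le _ _).trans (add_le_add ?_ ?_)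
    · exact (enorm_integral_mul_le hc hw.1 d1.1).trans (mul_le_mul_right (hψ1 k) _)
    · refine (enorm_integral_mul_le hc ha.1 d3.1).trans (mul_le_mul_right ?_ _)
      exact (eLpNorm_mono_real fun x => abs_componentAlong_le X _ x).trans (hψ2 k)
  have h0 := tendsto_nhds_unique (tendsto_const_nhds (x := (∫ x, w x * f x ∂m) +
    ∫ x, ‖X x‖ ^ (p - 1) * componentAlong X Y x ∂m))
    (tendsto_zero_of_enorm_le (Eventually.of_forall key) hlim)
  linarith

end Flux

end

/-! ### Ancient solutions: conclusion. -/

noncomputable section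

section AncientSolution

variable {n : ℕ} {M : Type*} [TopologicalSpace M] [T2Space M] [SecondCountableTopology M]
  [MeasurableSpace M] [BorelSpace M]
  [ChartedSpace (Model n) M] [IsManifold 𝓘(ℝ, Model n) ∞ M]
  [RiemannianBundle (fun x : M => TangentSpace 𝓘(ℝ, Model n) x)]
  [IsContMDiffRiemannianBundle 𝓘(ℝ, Model n) ∞ (Model n)
      (fun x : M => TangentSpace 𝓘(ℝ, Model n) x)]
  {φ : M → ℝ} {Ω : Set M} {p q : ℝ} {u : ℝ → M → ℝ}

theorem IsAncientDirichletSolution.vanishesAtBoundary_signedPow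
    (hu : IsAncientDirichletSolution n φ Ω p q u) (hq : 0 < q) (hΩ : IsOpen Ω)
    (hΩc : IsCompact (closure Ω)) {t : ℝ} (ht : t < 0) :
    VanishesAtBoundary Ω fun x => signedPow q (u t x) :=
  (vanishesAtBoundary_of_tendsto hΩ hΩc (hu.boundary t ht)).comp
    (continuousAt_signedPow_zero hq) (by simp [signedPow])

/-- The gradient of `u^q` vanishes for ancient solutions of polynomial growth. -/
theorem IsAncientDirichletSolution.exists_weakGradient_ae_eq_zero
    (hu : IsAncientDirichletSolution n φ Ω p q u) (hφ : Continuous φ) (hq : 0 < q)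
    (hpq : q * p = q + 1) (hΩ : IsOpen Ω) (hΩc : IsCompact (closure Ω)) {C d : ℝ}
    (hI : ∀ t < 0, weightedEnergy n φ Ω q (u t) ≤ C * (1 + |t|) ^ d) {t : ℝ} (ht : t < 0) :
    ∃ X : (x : M) → TangentSpace 𝓘(ℝ, Model n) x,
      IsWeakGradient Ω (fun x => signedPow q (u t x)) X ∧
      ∀ᵐ x ∂((weightedVolume n φ).restrict Ω), X x = 0 := by
  set m := (weightedVolume n φ).restrict Ω with hm
  have hc : (q + 1).HolderConjugate p := by
    have hp : p = (q + 1) / q := by field_simp; linarith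
    rw [Real.holderConjugate_iff, hp]
    refine ⟨by linarith, ?_⟩
    field_simp
    ring
  have hp0 : 0 < p := hc.symm.pos
  -- Time derivative and gradient are chosen separately at each time, with default value 0 for t ≥
  -- 0; no regularity of these choices in t is needed.
  have hex : ∀ t, ∃ (w : M → ℝ) (X : (x : M) → TangentSpace 𝓘(ℝ, Model n) x), t < 0 →
      HasTimeDerivAt n φ Ω (q + 1) u w t ∧ MemSobolevZero n φ Ω (q + 1) w ∧
      IsWeakGradient Ω (fun x => signedPow q (u t x)) X ∧
      MemLp (fun x => ‖X x‖) (ENNReal.ofReal p) m ∧ IsWeakPLaplacian φ Ω p X w := fun t => by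
    by_cases ht : t < 0
    · obtain ⟨w, X, h⟩ := hu.equation t ht
      exact ⟨w, X, fun _ => h⟩
    · exact ⟨0, fun _ => 0, fun h => absurd h ht⟩
  choose w X hwX using hex
  have hul : ∀ t < 0, MemLp (u t) (ENNReal.ofReal (q + 1)) m := fun t ht =>
    (hu.mem_sobolev t ht).1
  have hwl : ∀ t < 0, MemLp (w t) (ENNReal.ofReal (q + 1)) m := fun t ht => (hwX t ht).2.1.1
  have hvl : ∀ t < 0, MemLp (fun x => signedPow q (u t x)) (ENNReal.ofReal p) m := fun t ht =>
    memLp_signedPow hq hpq (hul t ht)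
  have hXl : ∀ t < 0, MemLp (fun x => ‖X t x‖) (ENNReal.ofReal p) m := fun t ht =>
    (hwX t ht).2.2.2.1
  have hgrad : ∀ t < 0, IsWeakGradient Ω (fun x => signedPow q (u t x)) (X t) := fun t ht =>
    (hwX t ht).2.2.1
  have hule : ∀ t < 0, ∀ᶠ s in 𝓝 t, MemLp (u s) (ENNReal.ofReal (q + 1)) m := fun t ht => by
    filter_upwards [Iio_mem_nhds ht] with s hs
    exact hul s hs
  have hint : ∀ t < 0, Integrable (fun x => ‖X t x‖ ^ p) m := fun t ht => by
    have := (hXl t ht).integrable_norm_rpow (by simpa using hp0) ENNReal.ofReal_ne_top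
    simpa only [norm_norm, ENNReal.toReal_ofReal hp0.le] using this
  -- The equation at time t is tested with u^q at another time s.
  have hid : ∀ s < 0, ∀ t < 0, ∫ x, w t x * signedPow q (u s x) ∂m =
      -∫ x, ‖X t x‖ ^ (p - 1) * componentAlong (X t) (X s) x ∂m := fun s hs t ht =>
    (hwX t ht).2.2.2.2.integral_mul_eq hφ hΩ hΩc hc (hgrad t ht).isAEMeasurableField (hXl t ht)
      (hwl t ht) (hgrad s hs) (hu.vanishesAtBoundary_signedPow hq hΩ hΩc hs) (hvl s hs) (hXl s hs)
  have hE := dissipation_eq_zero_of_polynomial_growth hq hpq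
    (fun t => ∫ x, |u t x| ^ (q + 1) ∂m) (fun t => ∫ x, ‖X t x‖ ^ p ∂m)
    (fun s t => ∫ x, u t x * signedPow q (u s x) ∂m)
    (fun s t => ∫ x, w t x * signedPow q (u s x) ∂m)
    (fun t ht => (continuousAt_integral_rpow (by linarith) (hule t ht) (hwl t ht)
      (hwX t ht).1).continuousWithinAt)
    (fun t _ => integral_nonneg fun x => by positivity)
    (fun t _ => integral_nonneg fun x => by positivity)
    (fun t _ => by simp only [mul_signedPow hq])
    (fun t ht => by
      rw [hid t ht t ht]
      congr 2
      ext x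
      rw [rpow_mul_componentAlong, real_inner_self_eq_norm_sq, ← Real.rpow_natCast]
      rcases eq_or_ne (X t x) 0 with h | h
      · simp [h, Real.zero_rpow hp0.ne']
      · rw [← Real.rpow_add (norm_pos_iff.2 h)]
        congr 1
        push_cast
        ring)
    (fun s hs t ht => hasDerivAt_integral_mul hc (hule t ht) (hwl t ht) (hvl s hs) (hwX t ht).1)
    (fun s hs t ht c hc0 => by
      refine (mul_integral_mul_le hc (hul t ht) (hvl s hs) hc0).trans (le_of_eq ?_)
      simp only [abs_signedPow hq, ← Real.rpow_mul (abs_nonneg _), hpq])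
    (fun s hs t ht c hc0 => by
      -- Young for the flux ‖X t‖^{p-1} against the component of X s along X t. Since (p-1)(q+1) =
      -- p, the first factor contributes E t, and the component is at most ‖X s‖.
      rw [hid s hs t ht, neg_mul_neg]
      have hβ := (hgrad t ht).isAEMeasurableField.memLp_componentAlong hφ hΩ.measurableSet
        (hgrad s hs).isAEMeasurableField (hXl s hs)
      refine (mul_integral_mul_le hc (memLp_rpow_sub_one hc (fun _ => norm_nonneg _) (hXl t ht))
        hβ hc0).trans (add_le_add (le_of_eq ?_) ?_)
      · have h1 : (p - 1) * (q + 1) = p := by linarith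
        simp only [abs_of_nonneg (Real.rpow_nonneg (norm_nonneg _) _),
          ← Real.rpow_mul (norm_nonneg _), h1]
      · have h2 : ∫ x, |componentAlong (X t) (X s) x| ^ p ∂m ≤ ∫ x, ‖X s x‖ ^ p ∂m := by
          refine integral_mono_of_nonneg (Eventually.of_forall fun x => by positivity)
            (hint s hs) (Eventually.of_forall fun x => ?_)
          exact Real.rpow_le_rpow (abs_nonneg _) (abs_componentAlong_le _ _ x) hp0.le
        gcongr)
    hI t ht
  refine ⟨X t, hgrad t ht, ?_⟩
  filter_upwards [(integral_eq_zero_iff_of_nonneg (fun x => by positivity) (hint t ht)).1 hE]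
    with x hx
  exact norm_eq_zero.1 ((Real.rpow_eq_zero (norm_nonneg _) hp0.ne').1 hx)

theorem eqOn_zero_of_ae_eq_zero (hφ : Continuous φ) (hΩ : IsOpen Ω) {f : M → ℝ}
    (hf : ∀ᵐ x ∂((weightedVolume n φ).restrict Ω), f x = 0) (hc : ContinuousOn f Ω) :
    ∀ x ∈ Ω, f x = 0 := by
  intro x hx
  by_contra hne
  have hW : IsOpen (Ω ∩ f ⁻¹' {0}ᶜ) := hc.isOpen_inter_preimage hΩ isOpen_compl_singleton
  refine weightedVolume_ne_zero_of_isOpen (n := n) hφ hW ⟨x, hx, hne⟩ ?_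
  rw [ae_restrict_iff' hΩ.measurableSet] at hf
  exact measure_mono_null (fun z hz => fun (h : z ∈ Ω → f z = 0) => hz.2 (h hz.1)) hf

end AncientSolution

theorem mainTheorem7 {n : ℕ} {M : Type*} [MetricSpace M] [CompleteSpace M]
    [SecondCountableTopology M] [ConnectedSpace M] [MeasurableSpace M] [BorelSpace M]
    [ChartedSpace (Model n) M] [IsManifold 𝓘(ℝ, Model n) ∞ M]
    [RiemannianBundle (fun x : M => TangentSpace 𝓘(ℝ, Model n) x)]
    [IsContMDiffRiemannianBundle 𝓘(ℝ, Model n) ∞ (Model n)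
      (fun x : M => TangentSpace 𝓘(ℝ, Model n) x)]
    [IsRiemannianManifold 𝓘(ℝ, Model n) M]
    (φ : M → ℝ) (hφ : ContMDiff 𝓘(ℝ, Model n) 𝓘(ℝ, ℝ) ∞ φ)
    (p q : ℝ) (hp : 1 < p) (hq : 0 < q) (hδ : q * (p - 1) - 1 = 0)
    (Ω : Set M) (hΩ : IsOpen Ω) (hΩc : IsCompact (closure Ω)) (hΩM : Ω ≠ Set.univ)
    (u : ℝ → M → ℝ) (hu : IsAncientDirichletSolution n φ Ω p q u)
    (C d : ℝ) (hC : 0 < C) (hd : 0 < d)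
    (hI : ∀ t < 0, weightedEnergy n φ Ω q (u t) ≤ C * (1 + |t|) ^ d) :
    ∀ t < 0, (∀ᵐ x ∂((riemannianVolume n M).restrict Ω), u t x = 0) ∧
      (ContinuousOn (u t) Ω → ∀ x ∈ Ω, u t x = 0) := by
  intro t ht
  -- The condition δ = 0 in the form used throughout: q + 1 and p are conjugate.
  have hpq : q * p = q + 1 := by linarith
  have hφc := hφ.continuous
  obtain ⟨X, hX, hX0⟩ := hu.exists_weakGradient_ae_eq_zero hφc hq hpq hΩ hΩc hI ht
  have h1 := hX.ae_eq_zero hφc hΩ hΩM hX0 (hu.vanishesAtBoundary_signedPow hq hΩ hΩc ht)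
  have h2 : ∀ᵐ x ∂((weightedVolume n φ).restrict Ω), u t x = 0 := by
    filter_upwards [h1] with x hx
    have h3 := abs_signedPow hq (u t x)
    rw [hx, abs_zero] at h3
    exact abs_eq_zero.1 ((Real.rpow_eq_zero (abs_nonneg _) hq.ne').1 h3.symm)
  exact ⟨((ac_weightedVolume hφc).restrict Ω).ae_le h2, eqOn_zero_of_ae_eq_zero hφc hΩ h2⟩

end
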